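/- Let $M$ be a connected smooth $6$-manifold with a symplectic half-flat (SHF) structure $(\omega,\psi)$, that is, an $\mathrm{SU}(3)$-structure with $d\omega=0$ and $d\psi=0$. In detail: $\omega$ is a smooth non-degenerate $2$-form and $\psi$ a smooth $3$-form on $M$; with the volume form $\frac{\omega^3}{6}$, the endomorphism $S$ of $TM$ is defined by $\iota_v\psi\wedge\psi\wedge\eta=\eta(S v)\,\frac{\omega^3}{6}$ for all covectors $\eta$, and it satisfies $S^2=P\,\mathrm{Id}$ for a function $P$; one requires $P<0$ everywhere, and puts $J=\frac{1}{\sqrt{-P}}S$ and $\widehat\psi=J\psi=\psi(J\cdot,J\cdot,J\cdot)$; finally $\omega\wedge\psi=0$, $\psi\wedge\widehat\psi=\frac23\omega^3$, and $g=\omega(\cdot,J\cdot)$ is positive definite. Let $|\cdot|$ be the pointwise norm on forms induced by $g$ (so that $|e^1\wedge e^2|=1$ for orthonormal covectors $e^1,e^2$). Call the Ricci tensor of $g$ $J$-Hermitian if $\mathrm{Ric}(J\cdot,J\cdot)=\mathrm{Ric}$. There is a unique smooth $2$-form $\sigma$ (the intrinsic torsion form) such that $\sigma\wedge\omega^2=0$,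 $\sigma(J\cdot,J\cdot)=\sigma$ and $d\widehat\psi=\sigma\wedge\omega$, and there is a unique smooth $3$-form $\nu$ (the primitive $(2,1)+(1,2)$ component of $d\sigma$) such that $$\nu\wedge\omega=0,\qquad \nu\wedge\psi=\nu\wedge\widehat\psi=0,\qquad d\sigma=\frac{|\sigma|^2}{4}\,\psi+\nu .$$ The following are equivalent: (i) the Ricci tensor of $g$ is $J$-Hermitian; (ii) $d\sigma=\frac{|\sigma|^2}{4}\,\psi$; (iii) $\nu=0$. If they hold, the scalar curvature of $g$ is constant. -/

import Mathlib

open scoped Manifold Topology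

noncomputable section

namespace SHF

/-! ### Exterior algebra of a six-dimensional real vector space -/

section Linear

variable {V : Type*} [AddCommGroup V] [Module ℝ V]

/-- The wedge product of alternating forms, as a sum over `(p, q)`-shuffles (determinant
convention): `(α ∧ β)(v₁, …, v_{p+q}) = ∑_s sign(s) α(v_{s 1}, …) β(v_{s (p+1)}, …)`. -/
def wedge {p q : ℕ} (α : V [⋀^Fin p]→ₗ[ℝ] ℝ) (β : V [⋀^Fin q]→ₗ[ℝ] ℝ) :
    V [⋀^Fin (p + q)]→ₗ[ℝ] ℝ :=
  ((LinearMap.mul' ℝ ℝ).compAlternatingMap (α.domCoprod β)).domDomCongr finSumFinEquiv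

/-- A linear functional regarded as a `1`-form. -/
def oneForm (η : V →ₗ[ℝ] ℝ) : V [⋀^Fin 1]→ₗ[ℝ] ℝ :=
  AlternatingMap.ofSubsingleton ℝ V ℝ (0 : Fin 1) η

/-- The `6`-form `ω³ = ω ∧ ω ∧ ω`. -/
def cube (ω : V [⋀^Fin 2]→ₗ[ℝ] ℝ) : V [⋀^Fin 6]→ₗ[ℝ] ℝ :=
  wedge (wedge ω ω) ω

/-- The volume form `ω³ / 6`. -/
def volForm (ω : V [⋀^Fin 2]→ₗ[ℝ] ℝ) : V [⋀^Fin 6]→ₗ[ℝ] ℝ :=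
  (6 : ℝ)⁻¹ • cube ω

/-- The `6`-form `ι_v ρ ∧ ρ ∧ η`. -/
def contractWedge (ρ : V [⋀^Fin 3]→ₗ[ℝ] ℝ) (v : V) (η : V →ₗ[ℝ] ℝ) : V [⋀^Fin 6]→ₗ[ℝ] ℝ :=
  wedge (wedge (ρ.curryLeft v) ρ) (oneForm η)

variable (b : Module.Basis (Fin 6) ℝ V)

/-- The endomorphism `S_ρ` of `V` attached to a `3`-form `ρ` and a volume form `vol`, determined by
`ι_v ρ ∧ ρ ∧ η = η(S_ρ v) vol` for all covectors `η` (see `endo_spec`). It is written in the basis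
`b`, on which it does not depend when `vol ≠ 0`. -/
def endo (vol : V [⋀^Fin 6]→ₗ[ℝ] ℝ) (ρ : V [⋀^Fin 3]→ₗ[ℝ] ℝ) : V →ₗ[ℝ] V :=
  Matrix.toLin b b (Matrix.of fun j i ↦ contractWedge ρ (b i) (b.coord j) b / vol b)

theorem wedge_add_left {p q : ℕ} (α α' : V [⋀^Fin p]→ₗ[ℝ] ℝ) (β : V [⋀^Fin q]→ₗ[ℝ] ℝ) :
    wedge (α + α') β = wedge α β + wedge α' β := by
  ext x
  simp only [wedge, ← AlternatingMap.domCoprod'_apply, TensorProduct.add_tmul, map_add]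
  simp

theorem wedge_add_right {p q : ℕ} (α : V [⋀^Fin p]→ₗ[ℝ] ℝ) (β β' : V [⋀^Fin q]→ₗ[ℝ] ℝ) :
    wedge α (β + β') = wedge α β + wedge α β' := by
  ext x
  simp only [wedge, ← AlternatingMap.domCoprod'_apply, TensorProduct.tmul_add, map_add]
  simp

theorem wedge_smul_left {p q : ℕ} (c : ℝ) (α : V [⋀^Fin p]→ₗ[ℝ] ℝ) (β : V [⋀^Fin q]→ₗ[ℝ] ℝ) :
    wedge (c • α) β = c • wedge α β := by
  ext x
  simp only [wedge, ← AlternatingMap.domCoprod'_apply, ← TensorProduct.smul_tmul', map_smul]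
  simp

theorem wedge_smul_right {p q : ℕ} (c : ℝ) (α : V [⋀^Fin p]→ₗ[ℝ] ℝ) (β : V [⋀^Fin q]→ₗ[ℝ] ℝ) :
    wedge α (c • β) = c • wedge α β := by
  ext x
  simp only [wedge, ← AlternatingMap.domCoprod'_apply, TensorProduct.tmul_smul, map_smul]
  simp

/-- The defining identity of `S_ρ`. -/
theorem endo_spec (vol : V [⋀^Fin 6]→ₗ[ℝ] ℝ) (hvol : vol ≠ 0) (ρ : V [⋀^Fin 3]→ₗ[ℝ] ℝ) (v : V)
    (η : V →ₗ[ℝ] ℝ) : contractWedge ρ v η = η (endo b vol ρ v) • vol := by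
  have hvb : vol b ≠ 0 := by
    intro h
    apply hvol
    rw [AlternatingMap.eq_smul_basis_det b vol, h, zero_smul]
  -- both sides are bilinear in `(v, η)`
  let L : V →ₗ[ℝ] (V →ₗ[ℝ] ℝ) →ₗ[ℝ] (V [⋀^Fin 6]→ₗ[ℝ] ℝ) := LinearMap.mk₂ ℝ (contractWedge ρ)
    (fun v w η ↦ by
      simp only [contractWedge, map_add]
      rw [wedge_add_left, wedge_add_left])
    (fun c v η ↦ by
      simp only [contractWedge, map_smul]
      rw [wedge_smul_left, wedge_smul_left])
    (fun v η θ ↦ by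
      rw [contractWedge, show oneForm (η + θ) = oneForm η + oneForm θ by ext; simp [oneForm],
        wedge_add_right]
      rfl)
    (fun c v η ↦ by
      rw [contractWedge, show oneForm (c • η) = c • oneForm η by ext; simp [oneForm],
        wedge_smul_right]
      rfl)
  let R : V →ₗ[ℝ] (V →ₗ[ℝ] ℝ) →ₗ[ℝ] (V [⋀^Fin 6]→ₗ[ℝ] ℝ) := LinearMap.mk₂ ℝ
    (fun v η ↦ η (endo b vol ρ v) • vol)
    (fun v w η ↦ by simp [add_smul]) (fun c v η ↦ by simp [mul_smul])
    (fun v η θ ↦ by simp [add_smul]) (fun c v η ↦ by simp [mul_smul])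
  have hLR : L = R := by
    refine b.ext fun i ↦ b.dualBasis.ext fun j ↦ ?_
    have hj : b.dualBasis j = b.coord j := by simp
    rw [hj]
    simp only [L, R, LinearMap.mk₂_apply]
    have hc : b.coord j (endo b vol ρ (b i)) = contractWedge ρ (b i) (b.coord j) b / vol b := by
      rw [endo, Matrix.toLin_self]
      simp [Finsupp.single_apply]
    rw [hc]
    generalize contractWedge ρ (b i) (b.coord j) = F
    refine (AlternatingMap.eq_smul_basis_det b F).trans ?_
    refine Eq.trans ?_ (congrArg (fun u ↦ (F b / vol b) • u)
      (AlternatingMap.eq_smul_basis_det b vol).symm)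
    rw [smul_smul, div_mul_cancel₀ _ hvb]
  have := congrArg (fun F ↦ F v η) hLR
  simpa only [L, R, LinearMap.mk₂_apply] using this

/-- The quartic invariant `P(ρ)`, i.e. the number with `S_ρ² = P(ρ) Id`. -/
def quartic (vol : V [⋀^Fin 6]→ₗ[ℝ] ℝ) (ρ : V [⋀^Fin 3]→ₗ[ℝ] ℝ) : ℝ :=
  LinearMap.trace ℝ V (endo b vol ρ ∘ₗ endo b vol ρ) / 6

/-- The complex structure `J = S_ψ / √(-P(ψ))` induced by `ψ` and the volume form `ω³ / 6`. -/
def cplx (ω : V [⋀^Fin 2]→ₗ[ℝ] ℝ) (ψ : V [⋀^Fin 3]→ₗ[ℝ] ℝ) : V →ₗ[ℝ] V :=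
  (√(-quartic b (volForm ω) ψ))⁻¹ • endo b (volForm ω) ψ

/-- The bilinear form `g = ω(·, J ·)`. -/
def metric (ω : V [⋀^Fin 2]→ₗ[ℝ] ℝ) (ψ : V [⋀^Fin 3]→ₗ[ℝ] ℝ) (v w : V) : ℝ :=
  ω ![v, cplx b ω ψ w]

/-- The `3`-form `ψ̂ = Jψ = ψ(J ·, J ·, J ·)`. -/
def hat (ω : V [⋀^Fin 2]→ₗ[ℝ] ℝ) (ψ : V [⋀^Fin 3]→ₗ[ℝ] ℝ) : V [⋀^Fin 3]→ₗ[ℝ] ℝ :=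
  ψ.compLinearMap (cplx b ω ψ)

/-- `(ω, ψ)` defines an `SU(3)`-structure on the vector space `V`. -/
structure IsSU3 (ω : V [⋀^Fin 2]→ₗ[ℝ] ℝ) (ψ : V [⋀^Fin 3]→ₗ[ℝ] ℝ) : Prop where
  nondegenerate : ∀ v, (∀ w, ω ![v, w] = 0) → v = 0
  stable : quartic b (volForm ω) ψ < 0
  compatible : wedge ω ψ = 0
  normalized : wedge ψ (hat b ω ψ) = (2 / 3 : ℝ) • cube ω
  posDef : ∀ v, v ≠ 0 → 0 < metric b ω ψ v v

/-- `κ` is a primitive `2`-form of type `(1,1)`: `κ ∧ ω² = 0` and `Jκ = κ`. -/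
def IsPrimitive11 (ω : V [⋀^Fin 2]→ₗ[ℝ] ℝ) (ψ : V [⋀^Fin 3]→ₗ[ℝ] ℝ)
    (κ : V [⋀^Fin 2]→ₗ[ℝ] ℝ) : Prop :=
  wedge κ (wedge ω ω) = 0 ∧ κ.compLinearMap (cplx b ω ψ) = κ

/-- `φ` is a primitive `3`-form of type `(2,1) + (1,2)`: `φ ∧ ω = 0` and `φ ∧ ψ = φ ∧ ψ̂ = 0`. -/
def IsPrimitive21 (ω : V [⋀^Fin 2]→ₗ[ℝ] ℝ) (ψ : V [⋀^Fin 3]→ₗ[ℝ] ℝ)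
    (φ : V [⋀^Fin 3]→ₗ[ℝ] ℝ) : Prop :=
  wedge φ ω = 0 ∧ wedge φ ψ = 0 ∧ wedge φ (hat b ω ψ) = 0

/-- The Gram matrix of `g` in the basis `b`. -/
def gram (ω : V [⋀^Fin 2]→ₗ[ℝ] ℝ) (ψ : V [⋀^Fin 3]→ₗ[ℝ] ℝ) : Matrix (Fin 6) (Fin 6) ℝ :=
  Matrix.of fun i j ↦ metric b ω ψ (b i) (b j)

/-- The squared norm of a `2`-form `κ` induced by `g`, `|κ|² = ½ g^{ik} g^{jl} κ_{ij} κ_{kl}`, which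
is the sum of `κ(e_i, e_j)²` over `i < j` for a `g`-orthonormal basis `e`. -/
def normSq (ω : V [⋀^Fin 2]→ₗ[ℝ] ℝ) (ψ : V [⋀^Fin 3]→ₗ[ℝ] ℝ) (κ : V [⋀^Fin 2]→ₗ[ℝ] ℝ) : ℝ :=
  (1 / 2) * ∑ i, ∑ j, ∑ k, ∑ l,
    (gram b ω ψ)⁻¹ i k * (gram b ω ψ)⁻¹ j l * κ ![b i, b j] * κ ![b k, b l]

end Linear

/-! ### The Ricci tensor of a metric in coordinates -/

section Coordinates

/-- The `i`-th partial derivative on `ℝ⁶`. -/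
def partialDeriv (i : Fin 6) (f : EuclideanSpace ℝ (Fin 6) → ℝ) (y : EuclideanSpace ℝ (Fin 6)) : ℝ :=
  fderiv ℝ f y (EuclideanSpace.single i 1)

variable (G : EuclideanSpace ℝ (Fin 6) → Matrix (Fin 6) (Fin 6) ℝ)

/-- The Christoffel symbol `Γ^k_{ij}` of the Levi-Civita connection of the metric `G`. -/
def christoffel (k i j : Fin 6) (y : EuclideanSpace ℝ (Fin 6)) : ℝ :=
  (1 / 2) * ∑ l, (G y)⁻¹ k l *
    (partialDeriv i (fun z ↦ G z j l) y + partialDeriv j (fun z ↦ G z i l) y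
      - partialDeriv l (fun z ↦ G z i j) y)

/-- The component `R_{ij} = ∂_k Γ^k_{ij} - ∂_j Γ^k_{ik} + Γ^k_{kl} Γ^l_{ij} - Γ^k_{jl} Γ^l_{ik}` of
the Ricci tensor of the metric `G`. -/
def ricciCoord (i j : Fin 6) (y : EuclideanSpace ℝ (Fin 6)) : ℝ :=
  ∑ k, (partialDeriv k (christoffel G k i j) y - partialDeriv j (christoffel G k i k) y
    + ∑ l, (christoffel G k k l y * christoffel G l i j y
      - christoffel G k j l y * christoffel G l i k y))

end Coordinates

/-! ### Differential forms on a smooth six-manifold -/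

section Manifold

/-- A (not necessarily smooth) differential `k`-form on the six-dimensional manifold `M`. -/
abbrev DForm (M : Type*) [TopologicalSpace M] [ChartedSpace (EuclideanSpace ℝ (Fin 6)) M] (k : ℕ) :=
  ∀ x : M, TangentSpace (𝓡 6) x [⋀^Fin k]→L[ℝ] ℝ

variable {M : Type*} [TopologicalSpace M] [ChartedSpace (EuclideanSpace ℝ (Fin 6)) M]

/-- The expression of a form in the preferred chart `φ` at `x₀`, i.e. its pullback by `φ⁻¹`. -/
def DForm.inChart {k : ℕ} (α : DForm M k) (x₀ : M) :
    EuclideanSpace ℝ (Fin 6) → EuclideanSpace ℝ (Fin 6) [⋀^Fin k]→L[ℝ] ℝ := fun y ↦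
  (α ((extChartAt (𝓡 6) x₀).symm y)).compContinuousLinearMap
    (mfderiv (𝓡 6) (𝓡 6) (extChartAt (𝓡 6) x₀).symm y)

/-- Smoothness of a differential form: it is smooth in every preferred chart. -/
def DForm.IsSmooth {k : ℕ} (α : DForm M k) : Prop :=
  ∀ x₀ : M, ContDiffOn ℝ ((⊤ : ℕ∞) : WithTop ℕ∞) (α.inChart x₀) (extChartAt (𝓡 6) x₀).target

/-- The exterior derivative: at `x`, it is computed in the preferred chart at `x`. -/
def DForm.d {k : ℕ} (α : DForm M k) : DForm M (k + 1) := fun x ↦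
  (extDeriv (α.inChart x) (extChartAt (𝓡 6) x x)).compContinuousLinearMap
    (mfderiv (𝓡 6) (𝓡 6) (extChartAt (𝓡 6) x) x)

/-- The value of a form at `x`, as an alternating map. -/
abbrev DForm.toAlt {k : ℕ} (α : DForm M k) (x : M) : TangentSpace (𝓡 6) x [⋀^Fin k]→ₗ[ℝ] ℝ :=
  (α x).toAlternatingMap

/-- The standard basis of the tangent space `T_x M` (the coordinate frame of the preferred chart). -/
def tangentBasis (x : M) : Module.Basis (Fin 6) ℝ (TangentSpace (𝓡 6) x) :=
  (EuclideanSpace.basisFun (Fin 6) ℝ).toBasis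

/-- The almost complex structure `J` induced by `ψ` and `ω³ / 6`. -/
def almostCplx (ω : DForm M 2) (ψ : DForm M 3) (x : M) :
    TangentSpace (𝓡 6) x →ₗ[ℝ] TangentSpace (𝓡 6) x :=
  cplx (tangentBasis x) (ω.toAlt x) (ψ.toAlt x)

/-- The `3`-form `ψ̂ = Jψ`. -/
def psiHat (ω : DForm M 2) (ψ : DForm M 3) : DForm M 3 := fun x ↦
  (ψ x).compContinuousLinearMap
    (show EuclideanSpace ℝ (Fin 6) →L[ℝ] EuclideanSpace ℝ (Fin 6) from
      LinearMap.toContinuousLinearMap (almostCplx ω ψ x))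

/-- The metric `g = ω(·, J ·)` on `M` induced by `(ω, ψ)`. -/
def inducedMetric (ω : DForm M 2) (ψ : DForm M 3) (x : M) (v w : TangentSpace (𝓡 6) x) : ℝ :=
  metric (tangentBasis x) (ω.toAlt x) (ψ.toAlt x) v w

/-- The coordinate matrix `g_{ij}` of a metric `g` in the preferred chart at `x₀`. -/
def gramInChart (g : ∀ x : M, TangentSpace (𝓡 6) x → TangentSpace (𝓡 6) x → ℝ) (x₀ : M) :
    EuclideanSpace ℝ (Fin 6) → Matrix (Fin 6) (Fin 6) ℝ := fun y ↦
  Matrix.of fun i j ↦ g ((extChartAt (𝓡 6) x₀).symm y)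
    (mfderiv (𝓡 6) (𝓡 6) (extChartAt (𝓡 6) x₀).symm y (EuclideanSpace.single i 1))
    (mfderiv (𝓡 6) (𝓡 6) (extChartAt (𝓡 6) x₀).symm y (EuclideanSpace.single j 1))

/-- The Ricci tensor of a metric `g`: at `x`, it is computed in the preferred chart at `x`. -/
def ricci (g : ∀ x : M, TangentSpace (𝓡 6) x → TangentSpace (𝓡 6) x → ℝ) (x : M)
    (v w : TangentSpace (𝓡 6) x) : ℝ :=
  let dφ : TangentSpace (𝓡 6) x → EuclideanSpace ℝ (Fin 6) :=
    mfderiv (𝓡 6) (𝓡 6) (extChartAt (𝓡 6) x) x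
  ∑ i, ∑ j, ricciCoord (gramInChart g x) i j (extChartAt (𝓡 6) x x) * dφ v i * dφ w j

/-- The scalar curvature of a metric `g`, the `g`-trace of its Ricci tensor. -/
def scal (g : ∀ x : M, TangentSpace (𝓡 6) x → TangentSpace (𝓡 6) x → ℝ) (x : M) : ℝ :=
  ∑ i, ∑ j, (Matrix.of fun k l ↦ g x (tangentBasis x k) (tangentBasis x l))⁻¹ i j *
    ricci g x (tangentBasis x i) (tangentBasis x j)

/-- `(ω, ψ)` is a (smooth) `SU(3)`-structure on `M`. -/
structure IsSU3Structure (ω : DForm M 2) (ψ : DForm M 3) : Prop where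
  smooth_omega : ω.IsSmooth
  smooth_psi : ψ.IsSmooth
  isSU3 : ∀ x, IsSU3 (tangentBasis x) (ω.toAlt x) (ψ.toAlt x)

/-- `(ω, ψ)` is a symplectic half-flat structure on `M`: an `SU(3)`-structure with `ω` and `ψ`
closed. -/
structure IsSHF (ω : DForm M 2) (ψ : DForm M 3) : Prop extends IsSU3Structure ω ψ where
  closed_omega : ω.d = 0
  closed_psi : ψ.d = 0

/-- `σ` is the intrinsic torsion form of `(ω, ψ)`: a smooth primitive `(1,1)`-form with
`dψ̂ = σ ∧ ω`. -/
structure IsTorsionForm (ω : DForm M 2) (ψ : DForm M 3) (σ : DForm M 2) : Prop where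
  smooth : σ.IsSmooth
  primitive : ∀ x, IsPrimitive11 (tangentBasis x) (ω.toAlt x) (ψ.toAlt x) (σ.toAlt x)
  d_psiHat : ∀ x, (psiHat ω ψ).d.toAlt x = wedge (σ.toAlt x) (ω.toAlt x)

/-- `ν` is a smooth primitive `3`-form of type `(2,1) + (1,2)` on `M`. -/
structure IsPrimitive21Form (ω : DForm M 2) (ψ : DForm M 3) (ν : DForm M 3) : Prop where
  smooth : ν.IsSmooth
  primitive : ∀ x, IsPrimitive21 (tangentBasis x) (ω.toAlt x) (ψ.toAlt x) (ν.toAlt x)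

/-- The squared pointwise norm `|σ|²` of a `2`-form with respect to the induced metric. -/
def formNormSq (ω : DForm M 2) (ψ : DForm M 3) (σ : DForm M 2) (x : M) : ℝ :=
  normSq (tangentBasis x) (ω.toAlt x) (ψ.toAlt x) (σ.toAlt x)

/-- The Ricci tensor of the induced metric is `J`-Hermitian: `Ric(J ·, J ·) = Ric`. -/
def IsRicciHermitian (ω : DForm M 2) (ψ : DForm M 3) : Prop :=
  ∀ (x : M) (v w : TangentSpace (𝓡 6) x),
    ricci (inducedMetric ω ψ) x (almostCplx ω ψ x v) (almostCplx ω ψ x w) =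
      ricci (inducedMetric ω ψ) x v w

end Manifold
end SHF
end

set_option linter.unusedSimpArgs false
set_option linter.unnecessarySeqFocus false

open scoped Manifold Topology

noncomputable section

namespace SHF

/-! ### Shuffle expansions of the wedge product -/

section Wedge

open Equiv

variable {V : Type*} [AddCommGroup V] [Module ℝ V]

/-! Everything except the last step is pointwise or local, and rests on a formula for the Ricci
tensor in terms of the torsion. At each point there is a basis (`IsSU3.exists_adapted`) in which ω
is the standard Kähler form and ψ, ψ̂ are the real and imaginary parts of Ω = dz₁ ∧ dz₂ ∧ dz₃.

First order. Let ∇ be the Levi-Civita connection. Differentiating J² = -1, g = ω(·, J·), ψ(J·, ·, ·)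
= ψ(·, J·, ·) and the normalisation of ψ ∧ ψ̂ shows that ∇_u ω is -1/2 times the contraction of ψ̂
with a vector s_u, and that ∇_u ψ and ∇_u ψ̂ depend only on s_u and one number q_u
(`dPsiComp_of_type`). The equations dω = 0 and dψ = 0 are linear in s and q; they force q = 0 and
make s a primitive (1,1)-form (`torsion_symmetries`). Alternating ∇ψ̂ then gives dψ̂ = s ∧ ω.
Wedging with ω is injective on 2-forms in dimension six, so s is the torsion form σ and σ is unique.

Second order. From d²ψ̂ = 0 comes dσ ∧ ω = 0, and differentiating the type condition on σ fixes the
components of dσ along ψ and ψ̂. Hence ν = dσ - |σ|²ψ/4 is primitive of type (2,1)+(1,2)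
(`isPrimitiveComp_nuComp`). The Ricci identities for ω and ψ̂, contracted and combined with the
Bianchi identity (`ricci_cplx_eq`, `hess_eq_ricciComp`), give Ric(z, u) = -1/4 ∑ ν(e_k, e_m, u)
ψ(e_k, e_m, z) + 1/2 ∑ σ(z, e_m) σ(u, e_m) - 1/4 |σ|² g(z, u). The last two terms are J-Hermitian
because σ has type (1,1). The first is anti-Hermitian, and it vanishes only for ν = 0. This is the
equivalence.

Scalar curvature. The trace of the formula is -|σ|²/2. If ν = 0, then 0 = d²σ = d|σ|² ∧ ψ / 4, and
wedging a covector with ψ is injective, so |σ|² is locally constant, hence constant on a connected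
manifold.

The local theory lives on open subsets of ℝ⁶. It passes to M because the algebraic constructions are
natural under linear isomorphisms and d commutes with pullback by transition maps. -/

/-- A permutation is determined by the index k that it sends to 0 and by what it does to the other
indices. The cycle `k.cycleRange` moves k to the front, keeps the order of the rest and has sign
(-1)^k, as in a Laplace expansion. -/
theorem sum_perm_fin_succ {n : ℕ} (F : Perm (Fin (n + 1)) → ℝ) :
    ∑ s, F s = ∑ k : Fin (n + 1), ∑ t : Perm (Fin n),
      F (Perm.decomposeFin.symm (0, t) * k.cycleRange) := by
  rw [← Fintype.sum_prod_type'
    (f := fun (k : Fin (n + 1)) (t : Perm (Fin n)) ↦ F (Perm.decomposeFin.symm (0, t) * k.cycleRange))]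
  symm
  refine Fintype.sum_bijective
    (fun x : Fin (n + 1) × Perm (Fin n) ↦ Perm.decomposeFin.symm (0, x.2) * x.1.cycleRange) ?_ _ _
    fun _ ↦ rfl
  rw [Fintype.bijective_iff_injective_and_card]
  refine ⟨?_, by simp [Fintype.card_perm, Nat.factorial_succ]⟩
  rintro ⟨k, t⟩ ⟨k', t'⟩ h
  have hk (k : Fin (n + 1)) (t : Perm (Fin n)) :
      (Perm.decomposeFin.symm (0, t) * k.cycleRange) k = 0 := by
    simp
  have h1 : k = k' := by
    have h2 : (Perm.decomposeFin.symm (0, t) * k.cycleRange) k' = 0 := by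
      have := hk k' t'
      simp only at h
      rwa [← h] at this
    exact (Perm.decomposeFin.symm (0, t) * k.cycleRange).injective ((hk k t).trans h2.symm)
  subst h1
  have := mul_right_cancel h
  simpa using this

theorem decomposeFin_mul_cycleRange_succAbove {n : ℕ} (k : Fin (n + 1)) (t : Perm (Fin n))
    (j : Fin n) : (Perm.decomposeFin.symm (0, t) * k.cycleRange) (k.succAbove j) = (t j).succ := by
  simp [Fin.cycleRange_succAbove]

theorem sign_decomposeFin_mul_cycleRange {n : ℕ} (k : Fin (n + 1)) (t : Perm (Fin n)) :
    (Perm.sign (Perm.decomposeFin.symm (0, t) * k.cycleRange) : ℤ) =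
      (-1) ^ (k : ℕ) * (Perm.sign t : ℤ) := by
  simp [Fin.sign_cycleRange, mul_comm]

/-- The sum over all permutations defining a multiple of the wedge product. -/
def permSum {p q n : ℕ} (a : Fin p → Fin n) (b : Fin q → Fin n) (α : V [⋀^Fin p]→ₗ[ℝ] ℝ)
    (β : V [⋀^Fin q]→ₗ[ℝ] ℝ) (v : Fin n → V) : ℝ :=
  ∑ s : Perm (Fin n), ((Perm.sign s : ℤ) : ℝ) * (α (fun i ↦ v (s (a i))) * β fun j ↦ v (s (b j)))

/-- The shuffles are the cosets of all permutations by those preserving the two blocks. Multiplying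
by p! q! turns the sum over cosets into a sum over the full symmetric group, which has a simple
recursion. -/
theorem factorial_mul_wedge {p q : ℕ} (α : V [⋀^Fin p]→ₗ[ℝ] ℝ) (β : V [⋀^Fin q]→ₗ[ℝ] ℝ)
    (v : Fin (p + q) → V) :
    (p.factorial * q.factorial : ℝ) * wedge α β v =
      permSum (Fin.castAdd q) (Fin.natAdd p) α β v := by
  have h := congrArg (fun F ↦ (LinearMap.mul' ℝ ℝ) (F (v ∘ finSumFinEquiv)))
    (MultilinearMap.domCoprod_alternization_eq α β)
  simp only [MultilinearMap.alternatization_apply, AlternatingMap.smul_apply, map_sum,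
    Fintype.card_fin, map_nsmul] at h
  rw [wedge, AlternatingMap.domDomCongr_apply, LinearMap.compAlternatingMap_apply]
  rw [nsmul_eq_mul] at h
  push_cast at h
  rw [← h, permSum, ← (finSumFinEquiv.permCongr).sum_comp]
  refine Finset.sum_congr rfl fun s _ ↦ ?_
  rw [MultilinearMap.domDomCongr_apply, Perm.sign_permCongr, Units.smul_def, map_zsmul,
    zsmul_eq_mul]
  simp [MultilinearMap.domCoprod_apply, Equiv.permCongr_apply]

/-- The recursion of the sums over permutations, obtained by removing the first vector. -/
theorem permSum_cons {p q n : ℕ} (a : Fin (p + 1) → Fin (n + 1)) (b : Fin (q + 1) → Fin (n + 1))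
    (a₁ : Fin p → Fin n) (b₁ : Fin (q + 1) → Fin n) (a₂ : Fin (p + 1) → Fin n)
    (b₂ : Fin q → Fin n) (ha : ∀ i, (a i : ℕ) = i) (hb : ∀ i, (b i : ℕ) = p + 1 + i)
    (ha₁ : ∀ i, (a₁ i : ℕ) = i) (hb₁ : ∀ i, (b₁ i : ℕ) = p + i)
    (ha₂ : ∀ i, (a₂ i : ℕ) = i) (hb₂ : ∀ i, (b₂ i : ℕ) = p + 1 + i) (hn : p + q + 1 = n)
    (α : V [⋀^Fin (p + 1)]→ₗ[ℝ] ℝ) (β : V [⋀^Fin (q + 1)]→ₗ[ℝ] ℝ) (x : V) (v : Fin n → V) :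
    permSum a b α β (Matrix.vecCons x v) =
      (p + 1) * permSum a₁ b₁ (α.curryLeft x) β v +
      (q + 1) * ((-1) ^ (p + 1) * permSum a₂ b₂ α (β.curryLeft x) v) := by
  subst hn
  -- Deleting an index of one block re-embeds the remaining indices of both blocks by `succAbove`.
  -- The embeddings are known only through their values, so no casts between equal sums of naturals
  -- arise.
  have e1 (k : Fin (p + 1)) (i : Fin p) : a (k.succAbove i) = (a k).succAbove (a₁ i) := by
    ext; simp only [Fin.succAbove, Fin.lt_def, ha, Fin.val_castSucc, ha₁]
    split_ifs <;> simp [ha₁]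
  have e2 (k : Fin (p + 1)) (j : Fin (q + 1)) : b j = (a k).succAbove (b₁ j) := by
    have := k.2
    ext; simp only [Fin.succAbove, Fin.lt_def, ha, Fin.val_castSucc, hb₁]
    split_ifs <;> simp [hb, hb₁] <;> omega
  have e3 (k : Fin (q + 1)) (i : Fin (p + 1)) : a i = (b k).succAbove (a₂ i) := by
    have := i.2
    ext; simp only [Fin.succAbove, Fin.lt_def, hb, Fin.val_castSucc, ha₂]
    split_ifs <;> simp [ha, ha₂] <;> omega
  have e4 (k : Fin (q + 1)) (j : Fin q) : b (k.succAbove j) = (b k).succAbove (b₂ j) := by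
    ext; simp only [Fin.succAbove, Fin.lt_def, hb, Fin.val_castSucc, hb₂]
    split_ifs <;> simp [hb₂] <;> omega
  -- The first vector `x` lands either in a slot of α or in a slot of β.
  have hsplit (G : Fin (p + q + 1 + 1) → ℝ) : ∑ k, G k = ∑ i, G (a i) + ∑ j, G (b j) := by
    have hc : p + 1 + (q + 1) = p + q + 1 + 1 := by omega
    rw [← (finCongr hc).sum_comp, Fin.sum_univ_add]
    congr 1
    · refine Finset.sum_congr rfl fun i _ ↦ congrArg G (Fin.ext ?_)
      simp [ha]
    · refine Finset.sum_congr rfl fun i _ ↦ congrArg G (Fin.ext ?_)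
      simp [hb]
  rw [permSum, sum_perm_fin_succ, hsplit]
  congr 1
  · rw [permSum]
    have : ∀ k : Fin (p + 1), (∑ t : Perm (Fin (p + q + 1)),
        ((Perm.sign (Perm.decomposeFin.symm (0, t) * (a k).cycleRange) : ℤ) : ℝ) *
        (α (fun i ↦ Matrix.vecCons x v ((Perm.decomposeFin.symm (0, t) * (a k).cycleRange) (a i))) *
        β (fun j ↦ Matrix.vecCons x v ((Perm.decomposeFin.symm (0, t) * (a k).cycleRange) (b j)))))
        = ∑ s : Perm (Fin (p + q + 1)), ((Perm.sign s : ℤ) : ℝ) *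
          (α.curryLeft x (fun i ↦ v (s (a₁ i))) * β fun j ↦ v (s (b₁ j))) := by
      intro k
      refine Finset.sum_congr rfl fun t _ ↦ ?_
      have h1 : (fun i ↦ Matrix.vecCons x v
          ((Perm.decomposeFin.symm (0, t) * (a k).cycleRange) (a i))) =
          k.insertNth x (fun i ↦ v (t (a₁ i))) := by
        rw [Fin.eq_insertNth_iff]
        refine ⟨by simp, ?_⟩
        funext i
        rw [Fin.removeNth, e1, decomposeFin_mul_cycleRange_succAbove]
        simp
      have h2 : (fun j ↦ Matrix.vecCons x v
          ((Perm.decomposeFin.symm (0, t) * (a k).cycleRange) (b j))) =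
          (fun j ↦ v (t (b₁ j))) := by
        funext j
        rw [e2 k, decomposeFin_mul_cycleRange_succAbove]
        simp
      rw [h1, h2, sign_decomposeFin_mul_cycleRange, AlternatingMap.map_insertNth, ha,
        AlternatingMap.curryLeft_apply_apply]
      push_cast
      -- The sign of the cycle cancels the sign of moving `x` to the first slot of α, so the p + 1
      -- slots contribute equally. For β below, (-1)^(p+1) remains from passing the whole block of
      -- α.
      have hs : ((-1 : ℝ) ^ (k : ℕ)) * (-1) ^ (k : ℕ) = 1 := by
        rw [← mul_pow]; simp
      simp only [zsmul_eq_mul, Int.cast_pow, Int.cast_neg, Int.cast_one]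
      linear_combination (((Perm.sign t : ℤ) : ℝ) * α (Matrix.vecCons x fun i ↦ v (t (a₁ i))) *
        β (fun j ↦ v (t (b₁ j)))) * hs
    rw [Finset.sum_congr rfl fun k _ ↦ this k]
    simp
  · rw [permSum]
    have : ∀ k : Fin (q + 1), (∑ t : Perm (Fin (p + q + 1)),
        ((Perm.sign (Perm.decomposeFin.symm (0, t) * (b k).cycleRange) : ℤ) : ℝ) *
        (α (fun i ↦ Matrix.vecCons x v ((Perm.decomposeFin.symm (0, t) * (b k).cycleRange) (a i))) *
        β (fun j ↦ Matrix.vecCons x v ((Perm.decomposeFin.symm (0, t) * (b k).cycleRange) (b j)))))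
        = (-1) ^ (p + 1) * ∑ s : Perm (Fin (p + q + 1)), ((Perm.sign s : ℤ) : ℝ) *
          (α (fun i ↦ v (s (a₂ i))) * β.curryLeft x fun j ↦ v (s (b₂ j))) := by
      intro k
      rw [Finset.mul_sum]
      refine Finset.sum_congr rfl fun t _ ↦ ?_
      have h1 : (fun j ↦ Matrix.vecCons x v
          ((Perm.decomposeFin.symm (0, t) * (b k).cycleRange) (b j))) =
          k.insertNth x (fun j ↦ v (t (b₂ j))) := by
        rw [Fin.eq_insertNth_iff]
        refine ⟨by simp, ?_⟩
        funext i
        rw [Fin.removeNth, e4, decomposeFin_mul_cycleRange_succAbove]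
        simp
      have h2 : (fun i ↦ Matrix.vecCons x v
          ((Perm.decomposeFin.symm (0, t) * (b k).cycleRange) (a i))) =
          (fun i ↦ v (t (a₂ i))) := by
        funext j
        rw [e3 k, decomposeFin_mul_cycleRange_succAbove]
        simp
      rw [h1, h2, sign_decomposeFin_mul_cycleRange, AlternatingMap.map_insertNth, hb,
        AlternatingMap.curryLeft_apply_apply]
      push_cast
      have hs : ((-1 : ℝ) ^ (k : ℕ)) * (-1) ^ (k : ℕ) = 1 := by
        rw [← mul_pow]; simp
      simp only [zsmul_eq_mul, Int.cast_pow, Int.cast_neg, Int.cast_one, pow_add (-1 : ℝ) (p + 1) k]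
      linear_combination ((-1) ^ (p + 1) * ((Perm.sign t : ℤ) : ℝ) *
        α (fun i ↦ v (t (a₂ i))) * β (Matrix.vecCons x fun i ↦ v (t (b₂ i)))) * hs
    rw [Finset.sum_congr rfl fun k _ ↦ this k]
    simp

/-- Contraction with a vector is an antiderivation of the wedge product. -/
theorem wedge_vecCons {p q : ℕ} (α : V [⋀^Fin (p + 1)]→ₗ[ℝ] ℝ) (β : V [⋀^Fin (q + 1)]→ₗ[ℝ] ℝ)
    (x : V) (v : Fin (p + q + 1) → V) (h : p + 1 + (q + 1) = p + q + 1 + 1)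
    (h' : p + 1 + q = p + q + 1) :
    wedge α β (Matrix.vecCons x v ∘ Fin.cast h) =
      wedge (α.curryLeft x) β v + (-1) ^ (p + 1) * wedge α (β.curryLeft x) (v ∘ Fin.cast h') := by
  have key (m n N : ℕ) (hN : m + n = N) (γ : V [⋀^Fin m]→ₗ[ℝ] ℝ) (δ : V [⋀^Fin n]→ₗ[ℝ] ℝ)
      (w : Fin N → V) : (m.factorial * n.factorial : ℝ) * wedge γ δ (w ∘ Fin.cast hN) =
      permSum (Fin.cast hN ∘ Fin.castAdd n) (Fin.cast hN ∘ Fin.natAdd m) γ δ w := by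
    subst hN
    simpa using factorial_mul_wedge γ δ w
  have h0 := key _ _ _ h α β (Matrix.vecCons x v)
  have h1 := key _ _ _ rfl (α.curryLeft x) β v
  have h2 := key _ _ _ h' α (β.curryLeft x) v
  rw [permSum_cons _ _ (Fin.cast rfl ∘ Fin.castAdd (q + 1)) (Fin.cast rfl ∘ Fin.natAdd p)
    (Fin.cast h' ∘ Fin.castAdd q) (Fin.cast h' ∘ Fin.natAdd (p + 1)) (by simp) (by simp)
    (by simp) (by simp) (by simp) (by simp) rfl, ← h1, ← h2] at h0
  simp only [Nat.factorial_succ, Nat.cast_mul, Nat.cast_add, Nat.cast_one] at h0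
  have hp : (p.factorial : ℝ) ≠ 0 := by positivity
  have hq : (q.factorial : ℝ) ≠ 0 := by positivity
  have hp' : (p + 1 : ℝ) ≠ 0 := by positivity
  have hq' : (q + 1 : ℝ) ≠ 0 := by positivity
  have hne : ((p + 1) * p.factorial * ((q + 1) * q.factorial) : ℝ) ≠ 0 := by positivity
  refine mul_left_cancel₀ hne (h0.trans ?_)
  simp only [Fin.cast_refl, Function.comp_id]
  ring

/-- The antiderivation rule with its casts replaced by pointwise equations that `simp` checks on
literal tuples. Iterating it yields the explicit expansions below, up to total degree six. -/
theorem wedge_eq_add {p q : ℕ} {α : V [⋀^Fin (p + 1)]→ₗ[ℝ] ℝ} {β : V [⋀^Fin (q + 1)]→ₗ[ℝ] ℝ}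
    {x : V} {v : Fin (p + q + 1) → V} {w : Fin (p + 1 + (q + 1)) → V} {w' : Fin (p + 1 + q) → V}
    (hw : ∀ i, w i = Matrix.vecCons x v (Fin.cast (by omega) i))
    (hw' : ∀ i, w' i = v (Fin.cast (by omega) i)) :
    wedge α β w = wedge (α.curryLeft x) β v + (-1) ^ (p + 1) * wedge α (β.curryLeft x) w' := by
  rw [show w' = v ∘ Fin.cast (by omega) from funext hw', ← wedge_vecCons _ _ _ _ (by omega)]
  exact congrArg _ (funext hw)

theorem wedge_zero_right {p : ℕ} (α : V [⋀^Fin p]→ₗ[ℝ] ℝ) (β : V [⋀^Fin 0]→ₗ[ℝ] ℝ)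
    (v : Fin p → V) : wedge α β v = α v * β ![] := by
  have h := factorial_mul_wedge α β v
  have : permSum (Fin.castAdd 0) (Fin.natAdd p) α β v =
      ∑ s : Perm (Fin p), α v * β ![] := by
    refine Finset.sum_congr rfl fun s _ ↦ ?_
    have h1 : α (fun i ↦ v (s (Fin.castAdd 0 i))) = (Perm.sign s : ℤ) * α v := by
      have := α.map_perm v s
      rw [Units.smul_def, zsmul_eq_mul] at this
      exact this
    rw [h1, Subsingleton.elim (fun j ↦ v (s (Fin.natAdd p j))) ![]]
    have hs : (((Perm.sign s : ℤ) : ℝ)) * ((Perm.sign s : ℤ) : ℝ) = 1 := by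
      rw [← Int.cast_mul, Int.units_coe_mul_self]; simp
    linear_combination (α v * β ![]) * hs
  rw [this] at h
  simp [Fintype.card_perm] at h
  have hp : (p.factorial : ℝ) ≠ 0 := by positivity
  exact mul_left_cancel₀ hp (by simpa using h)

theorem wedge_zero_left {q : ℕ} (α : V [⋀^Fin 0]→ₗ[ℝ] ℝ) (β : V [⋀^Fin q]→ₗ[ℝ] ℝ)
    (v : Fin (0 + q) → V) : wedge α β v = α ![] * β (v ∘ Fin.natAdd 0) := by
  have h := factorial_mul_wedge α β v
  have : permSum (Fin.castAdd q) (Fin.natAdd 0) α β v =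
      ∑ s : Perm (Fin (0 + q)), α ![] * β (v ∘ Fin.natAdd 0) := by
    refine Finset.sum_congr rfl fun s _ ↦ ?_
    have h1 : β (fun i ↦ v (s (Fin.natAdd 0 i))) = (Perm.sign s : ℤ) * β (v ∘ Fin.natAdd 0) := by
      have := β.map_perm (v ∘ Fin.natAdd 0) ((finCongr (zero_add q)).permCongr s)
      rw [Perm.sign_permCongr, Units.smul_def, zsmul_eq_mul] at this
      rw [← this]
      congr 1
      funext i
      simp only [Function.comp_apply, permCongr_apply, finCongr_symm, finCongr_apply]
      congr 1
      ext
      simp only [Fin.natAdd, Fin.cast, Fin.val_mk, zero_add]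
    rw [h1, Subsingleton.elim (fun j ↦ v (s (Fin.castAdd q j))) ![]]
    have hs : (((Perm.sign s : ℤ) : ℝ)) * ((Perm.sign s : ℤ) : ℝ) = 1 := by
      rw [← Int.cast_mul, Int.units_coe_mul_self]; simp
    linear_combination (α ![] * β (v ∘ Fin.natAdd 0)) * hs
  rw [this] at h
  simp [Fintype.card_perm] at h
  have hp : (q.factorial : ℝ) ≠ 0 := by positivity
  exact mul_left_cancel₀ hp (by simpa using h)

theorem wedge_zero_left_one (α : V [⋀^Fin 0]→ₗ[ℝ] ℝ) (β : V [⋀^Fin 1]→ₗ[ℝ] ℝ) (a : V) :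
    wedge α β (![a] : Fin 1 → V) = α ![] * β ![a] := by
  refine (wedge_zero_left α β _).trans ?_
  congr 2
  ext i
  fin_cases i <;> rfl

theorem wedge_zero_left_two (α : V [⋀^Fin 0]→ₗ[ℝ] ℝ) (β : V [⋀^Fin 2]→ₗ[ℝ] ℝ) (a b : V) :
    wedge α β (![a, b] : Fin 2 → V) = α ![] * β ![a, b] := by
  refine (wedge_zero_left α β _).trans ?_
  congr 2
  ext i
  fin_cases i <;> rfl

theorem wedge_zero_left_three (α : V [⋀^Fin 0]→ₗ[ℝ] ℝ) (β : V [⋀^Fin 3]→ₗ[ℝ] ℝ) (a b c : V) :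
    wedge α β (![a, b, c] : Fin 3 → V) = α ![] * β ![a, b, c] := by
  refine (wedge_zero_left α β _).trans ?_
  congr 2
  ext i
  fin_cases i <;> rfl

theorem wedge_zero_left_four (α : V [⋀^Fin 0]→ₗ[ℝ] ℝ) (β : V [⋀^Fin 4]→ₗ[ℝ] ℝ) (a b c d : V) :
    wedge α β (![a, b, c, d] : Fin 4 → V) = α ![] * β ![a, b, c, d] := by
  refine (wedge_zero_left α β _).trans ?_
  congr 2
  ext i
  fin_cases i <;> rfl

theorem wedge_one_one (α : V [⋀^Fin 1]→ₗ[ℝ] ℝ) (β : V [⋀^Fin 1]→ₗ[ℝ] ℝ) (a b : V) :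
    wedge α β (![a, b] : Fin 2 → V) =
      α ![a] * β ![b] - α ![b] * β ![a] := by
  rw [wedge_eq_add (p := 0) (q := 0) (x := a) (v := ![b]) (w' := ![b]) (by simp)
    (by simp)]
  rw [wedge_zero_left_one, wedge_zero_right α (β.curryLeft a)]
  simp only [AlternatingMap.curryLeft_apply_apply]
  ring

theorem wedge_one_two (α : V [⋀^Fin 1]→ₗ[ℝ] ℝ) (β : V [⋀^Fin 2]→ₗ[ℝ] ℝ) (a b c : V) :
    wedge α β (![a, b, c] : Fin 3 → V) =
      α ![a] * β ![b, c] - α ![b] * β ![a, c] + α ![c] * β ![a, b] := by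
  rw [wedge_eq_add (p := 0) (q := 1) (x := a) (v := ![b, c]) (w' := ![b, c]) (by simp)
    (by simp)]
  rw [wedge_zero_left_two, wedge_one_one]
  simp only [AlternatingMap.curryLeft_apply_apply]
  ring

theorem wedge_one_three (α : V [⋀^Fin 1]→ₗ[ℝ] ℝ) (β : V [⋀^Fin 3]→ₗ[ℝ] ℝ) (a b c d : V) :
    wedge α β (![a, b, c, d] : Fin 4 → V) =
      α ![a] * β ![b, c, d] - α ![b] * β ![a, c, d] + α ![c] * β ![a, b, d]
      - α ![d] * β ![a, b, c] := by
  rw [wedge_eq_add (p := 0) (q := 2) (x := a) (v := ![b, c, d]) (w' := ![b, c, d]) (by simp)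
    (by simp)]
  rw [wedge_zero_left_three, wedge_one_two]
  simp only [AlternatingMap.curryLeft_apply_apply]
  ring

theorem wedge_one_four (α : V [⋀^Fin 1]→ₗ[ℝ] ℝ) (β : V [⋀^Fin 4]→ₗ[ℝ] ℝ) (a b c d e : V) :
    wedge α β (![a, b, c, d, e] : Fin 5 → V) =
      α ![a] * β ![b, c, d, e] - α ![b] * β ![a, c, d, e] + α ![c] * β ![a, b, d, e]
      - α ![d] * β ![a, b, c, e] + α ![e] * β ![a, b, c, d] := by
  rw [wedge_eq_add (p := 0) (q := 3) (x := a) (v := ![b, c, d, e]) (w' := ![b, c, d, e]) (by simp)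
    (by simp)]
  rw [wedge_zero_left_four, wedge_one_three]
  simp only [AlternatingMap.curryLeft_apply_apply]
  ring

theorem wedge_two_one (α : V [⋀^Fin 2]→ₗ[ℝ] ℝ) (β : V [⋀^Fin 1]→ₗ[ℝ] ℝ) (a b c : V) :
    wedge α β (![a, b, c] : Fin 3 → V) =
      α ![a, b] * β ![c] - α ![a, c] * β ![b] + α ![b, c] * β ![a] := by
  rw [wedge_eq_add (p := 1) (q := 0) (x := a) (v := ![b, c]) (w' := ![b, c]) (by simp)
    (by simp)]
  rw [wedge_one_one, wedge_zero_right α (β.curryLeft a)]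
  simp only [AlternatingMap.curryLeft_apply_apply]
  ring

theorem wedge_two_two (α : V [⋀^Fin 2]→ₗ[ℝ] ℝ) (β : V [⋀^Fin 2]→ₗ[ℝ] ℝ) (a b c d : V) :
    wedge α β (![a, b, c, d] : Fin 4 → V) =
      α ![a, b] * β ![c, d] - α ![a, c] * β ![b, d] + α ![a, d] * β ![b, c]
      + α ![b, c] * β ![a, d] - α ![b, d] * β ![a, c] + α ![c, d] * β ![a, b] := by
  rw [wedge_eq_add (p := 1) (q := 1) (x := a) (v := ![b, c, d]) (w' := ![b, c, d]) (by simp)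
    (by simp)]
  rw [wedge_one_two, wedge_two_one]
  simp only [AlternatingMap.curryLeft_apply_apply]
  ring

theorem wedge_two_three (α : V [⋀^Fin 2]→ₗ[ℝ] ℝ) (β : V [⋀^Fin 3]→ₗ[ℝ] ℝ) (a b c d e : V) :
    wedge α β (![a, b, c, d, e] : Fin 5 → V) =
      α ![a, b] * β ![c, d, e] - α ![a, c] * β ![b, d, e] + α ![a, d] * β ![b, c, e]
      - α ![a, e] * β ![b, c, d] + α ![b, c] * β ![a, d, e] - α ![b, d] * β ![a, c, e]
      + α ![b, e] * β ![a, c, d] + α ![c, d] * β ![a, b, e] - α ![c, e] * β ![a, b, d]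
      + α ![d, e] * β ![a, b, c] := by
  rw [wedge_eq_add (p := 1) (q := 2) (x := a) (v := ![b, c, d, e]) (w' := ![b, c, d, e]) (by simp)
    (by simp)]
  rw [wedge_one_three, wedge_two_two]
  simp only [AlternatingMap.curryLeft_apply_apply]
  ring

theorem wedge_two_four (α : V [⋀^Fin 2]→ₗ[ℝ] ℝ) (β : V [⋀^Fin 4]→ₗ[ℝ] ℝ) (a b c d e f : V) :
    wedge α β (![a, b, c, d, e, f] : Fin 6 → V) =
      α ![a, b] * β ![c, d, e, f] - α ![a, c] * β ![b, d, e, f] + α ![a, d] * β ![b, c, e, f]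
      - α ![a, e] * β ![b, c, d, f] + α ![a, f] * β ![b, c, d, e] + α ![b, c] * β ![a, d, e, f]
      - α ![b, d] * β ![a, c, e, f] + α ![b, e] * β ![a, c, d, f] - α ![b, f] * β ![a, c, d, e]
      + α ![c, d] * β ![a, b, e, f] - α ![c, e] * β ![a, b, d, f] + α ![c, f] * β ![a, b, d, e]
      + α ![d, e] * β ![a, b, c, f] - α ![d, f] * β ![a, b, c, e] + α ![e, f] * β ![a, b, c, d] := by
  rw [wedge_eq_add (p := 1) (q := 3) (x := a) (v := ![b, c, d, e, f]) (w' := ![b, c, d, e, f]) (by simp)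
    (by simp)]
  rw [wedge_one_four, wedge_two_three]
  simp only [AlternatingMap.curryLeft_apply_apply]
  ring

theorem wedge_three_one (α : V [⋀^Fin 3]→ₗ[ℝ] ℝ) (β : V [⋀^Fin 1]→ₗ[ℝ] ℝ) (a b c d : V) :
    wedge α β (![a, b, c, d] : Fin 4 → V) =
      α ![a, b, c] * β ![d] - α ![a, b, d] * β ![c] + α ![a, c, d] * β ![b]
      - α ![b, c, d] * β ![a] := by
  rw [wedge_eq_add (p := 2) (q := 0) (x := a) (v := ![b, c, d]) (w' := ![b, c, d]) (by simp)
    (by simp)]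
  rw [wedge_two_one, wedge_zero_right α (β.curryLeft a)]
  simp only [AlternatingMap.curryLeft_apply_apply]
  ring

theorem wedge_three_two (α : V [⋀^Fin 3]→ₗ[ℝ] ℝ) (β : V [⋀^Fin 2]→ₗ[ℝ] ℝ) (a b c d e : V) :
    wedge α β (![a, b, c, d, e] : Fin 5 → V) =
      α ![a, b, c] * β ![d, e] - α ![a, b, d] * β ![c, e] + α ![a, b, e] * β ![c, d]
      + α ![a, c, d] * β ![b, e] - α ![a, c, e] * β ![b, d] + α ![a, d, e] * β ![b, c]
      - α ![b, c, d] * β ![a, e] + α ![b, c, e] * β ![a, d] - α ![b, d, e] * β ![a, c]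
      + α ![c, d, e] * β ![a, b] := by
  rw [wedge_eq_add (p := 2) (q := 1) (x := a) (v := ![b, c, d, e]) (w' := ![b, c, d, e]) (by simp)
    (by simp)]
  rw [wedge_two_two, wedge_three_one]
  simp only [AlternatingMap.curryLeft_apply_apply]
  ring

theorem wedge_three_three (α : V [⋀^Fin 3]→ₗ[ℝ] ℝ) (β : V [⋀^Fin 3]→ₗ[ℝ] ℝ) (a b c d e f : V) :
    wedge α β (![a, b, c, d, e, f] : Fin 6 → V) =
      α ![a, b, c] * β ![d, e, f] - α ![a, b, d] * β ![c, e, f] + α ![a, b, e] * β ![c, d, f]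
      - α ![a, b, f] * β ![c, d, e] + α ![a, c, d] * β ![b, e, f] - α ![a, c, e] * β ![b, d, f]
      + α ![a, c, f] * β ![b, d, e] + α ![a, d, e] * β ![b, c, f] - α ![a, d, f] * β ![b, c, e]
      + α ![a, e, f] * β ![b, c, d] - α ![b, c, d] * β ![a, e, f] + α ![b, c, e] * β ![a, d, f]
      - α ![b, c, f] * β ![a, d, e] - α ![b, d, e] * β ![a, c, f] + α ![b, d, f] * β ![a, c, e]
      - α ![b, e, f] * β ![a, c, d] + α ![c, d, e] * β ![a, b, f] - α ![c, d, f] * β ![a, b, e]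
      + α ![c, e, f] * β ![a, b, d] - α ![d, e, f] * β ![a, b, c] := by
  rw [wedge_eq_add (p := 2) (q := 2) (x := a) (v := ![b, c, d, e, f]) (w' := ![b, c, d, e, f]) (by simp)
    (by simp)]
  rw [wedge_two_three, wedge_three_two]
  simp only [AlternatingMap.curryLeft_apply_apply]
  ring

theorem wedge_four_one (α : V [⋀^Fin 4]→ₗ[ℝ] ℝ) (β : V [⋀^Fin 1]→ₗ[ℝ] ℝ) (a b c d e : V) :
    wedge α β (![a, b, c, d, e] : Fin 5 → V) =
      α ![a, b, c, d] * β ![e] - α ![a, b, c, e] * β ![d] + α ![a, b, d, e] * β ![c]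
      - α ![a, c, d, e] * β ![b] + α ![b, c, d, e] * β ![a] := by
  rw [wedge_eq_add (p := 3) (q := 0) (x := a) (v := ![b, c, d, e]) (w' := ![b, c, d, e]) (by simp)
    (by simp)]
  rw [wedge_three_one, wedge_zero_right α (β.curryLeft a)]
  simp only [AlternatingMap.curryLeft_apply_apply]
  ring

theorem wedge_four_two (α : V [⋀^Fin 4]→ₗ[ℝ] ℝ) (β : V [⋀^Fin 2]→ₗ[ℝ] ℝ) (a b c d e f : V) :
    wedge α β (![a, b, c, d, e, f] : Fin 6 → V) =
      α ![a, b, c, d] * β ![e, f] - α ![a, b, c, e] * β ![d, f] + α ![a, b, c, f] * β ![d, e]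
      + α ![a, b, d, e] * β ![c, f] - α ![a, b, d, f] * β ![c, e] + α ![a, b, e, f] * β ![c, d]
      - α ![a, c, d, e] * β ![b, f] + α ![a, c, d, f] * β ![b, e] - α ![a, c, e, f] * β ![b, d]
      + α ![a, d, e, f] * β ![b, c] + α ![b, c, d, e] * β ![a, f] - α ![b, c, d, f] * β ![a, e]
      + α ![b, c, e, f] * β ![a, d] - α ![b, d, e, f] * β ![a, c] + α ![c, d, e, f] * β ![a, b] := by
  rw [wedge_eq_add (p := 3) (q := 1) (x := a) (v := ![b, c, d, e, f]) (w' := ![b, c, d, e, f]) (by simp)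
    (by simp)]
  rw [wedge_three_two, wedge_four_one]
  simp only [AlternatingMap.curryLeft_apply_apply]
  ring

theorem wedge_five_one (α : V [⋀^Fin 5]→ₗ[ℝ] ℝ) (β : V [⋀^Fin 1]→ₗ[ℝ] ℝ) (a b c d e f : V) :
    wedge α β (![a, b, c, d, e, f] : Fin 6 → V) =
      α ![a, b, c, d, e] * β ![f] - α ![a, b, c, d, f] * β ![e] + α ![a, b, c, e, f] * β ![d]
      - α ![a, b, d, e, f] * β ![c] + α ![a, c, d, e, f] * β ![b] - α ![b, c, d, e, f] * β ![a] := by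
  rw [wedge_eq_add (p := 4) (q := 0) (x := a) (v := ![b, c, d, e, f]) (w' := ![b, c, d, e, f]) (by simp)
    (by simp)]
  rw [wedge_four_one, wedge_zero_right α (β.curryLeft a)]
  simp only [AlternatingMap.curryLeft_apply_apply]
  ring

end Wedge

/-! ### Polynomial identities behind S² = P Id -/

section Components

/-- Antisymmetric arrays of components with two indices. -/
def IsAlt2 (w : Fin 6 → Fin 6 → ℝ) : Prop := ∀ i j, w i j = -w j i

/-- Antisymmetric arrays of components with three indices. -/
def IsAlt3 (r : Fin 6 → Fin 6 → Fin 6 → ℝ) : Prop :=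
  (∀ i j k, r i j k = -r j i k) ∧ ∀ i j k, r i j k = -r i k j

theorem IsAlt2.rules {w : Fin 6 → Fin 6 → ℝ} (h : IsAlt2 w) :
    (∀ i, w i i = 0) ∧ w 1 0 = -w 0 1 ∧ w 2 0 = -w 0 2 ∧ w 3 0 = -w 0 3 ∧ w 4 0 = -w 0 4 ∧
    w 5 0 = -w 0 5 ∧ w 2 1 = -w 1 2 ∧ w 3 1 = -w 1 3 ∧ w 4 1 = -w 1 4 ∧ w 5 1 = -w 1 5 ∧
    w 3 2 = -w 2 3 ∧ w 4 2 = -w 2 4 ∧ w 5 2 = -w 2 5 ∧ w 4 3 = -w 3 4 ∧ w 5 3 = -w 3 5 ∧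
    w 5 4 = -w 4 5 :=
  ⟨fun i ↦ by linarith [h i i], h _ _, h _ _, h _ _, h _ _, h _ _, h _ _, h _ _, h _ _, h _ _,
    h _ _, h _ _, h _ _, h _ _, h _ _, h _ _⟩

theorem IsAlt3.rules {r : Fin 6 → Fin 6 → Fin 6 → ℝ} (h : IsAlt3 r) :
    ((∀ i k, r i i k = 0) ∧ (∀ i k, r k i i = 0) ∧ (∀ i k, r i k i = 0)) ∧
    ((∀ k, r 1 0 k = -r 0 1 k) ∧ (∀ k, r 2 0 k = -r 0 2 k) ∧ (∀ k, r 3 0 k = -r 0 3 k) ∧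
    (∀ k, r 4 0 k = -r 0 4 k) ∧ (∀ k, r 5 0 k = -r 0 5 k) ∧ (∀ k, r 2 1 k = -r 1 2 k) ∧
    (∀ k, r 3 1 k = -r 1 3 k) ∧ (∀ k, r 4 1 k = -r 1 4 k) ∧ (∀ k, r 5 1 k = -r 1 5 k) ∧
    (∀ k, r 3 2 k = -r 2 3 k) ∧ (∀ k, r 4 2 k = -r 2 4 k) ∧ (∀ k, r 5 2 k = -r 2 5 k) ∧
    (∀ k, r 4 3 k = -r 3 4 k) ∧ (∀ k, r 5 3 k = -r 3 5 k) ∧ (∀ k, r 5 4 k = -r 4 5 k)) ∧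
    ((∀ k, r k 1 0 = -r k 0 1) ∧ (∀ k, r k 2 0 = -r k 0 2) ∧ (∀ k, r k 3 0 = -r k 0 3) ∧
    (∀ k, r k 4 0 = -r k 0 4) ∧ (∀ k, r k 5 0 = -r k 0 5) ∧ (∀ k, r k 2 1 = -r k 1 2) ∧
    (∀ k, r k 3 1 = -r k 1 3) ∧ (∀ k, r k 4 1 = -r k 1 4) ∧ (∀ k, r k 5 1 = -r k 1 5) ∧
    (∀ k, r k 3 2 = -r k 2 3) ∧ (∀ k, r k 4 2 = -r k 2 4) ∧ (∀ k, r k 5 2 = -r k 2 5) ∧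
    (∀ k, r k 4 3 = -r k 3 4) ∧ (∀ k, r k 5 3 = -r k 3 5) ∧ (∀ k, r k 5 4 = -r k 4 5)) := by
  have d12 : ∀ i k, r i i k = 0 := fun i k ↦ by linarith [h.1 i i k]
  refine ⟨⟨d12, fun i k ↦ by linarith [h.2 k i i], fun i k ↦ by rw [h.2, d12, neg_zero]⟩, ?_, ?_⟩
  · exact ⟨h.1 _ _, h.1 _ _, h.1 _ _, h.1 _ _, h.1 _ _, h.1 _ _, h.1 _ _, h.1 _ _, h.1 _ _,
      h.1 _ _, h.1 _ _, h.1 _ _, h.1 _ _, h.1 _ _, h.1 _ _⟩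
  · exact ⟨fun k ↦ h.2 k _ _, fun k ↦ h.2 k _ _, fun k ↦ h.2 k _ _, fun k ↦ h.2 k _ _,
      fun k ↦ h.2 k _ _, fun k ↦ h.2 k _ _, fun k ↦ h.2 k _ _, fun k ↦ h.2 k _ _,
      fun k ↦ h.2 k _ _, fun k ↦ h.2 k _ _, fun k ↦ h.2 k _ _, fun k ↦ h.2 k _ _,
      fun k ↦ h.2 k _ _, fun k ↦ h.2 k _ _, fun k ↦ h.2 k _ _⟩

/-- The components of `r(i, ·, ·) ∧ r`. -/
def wedgeTwoThree (r : Fin 6 → Fin 6 → Fin 6 → ℝ) (i a b c d e : Fin 6) : ℝ :=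
  r i a b * r c d e - r i a c * r b d e + r i a d * r b c e - r i a e * r b c d
  + r i b c * r a d e - r i b d * r a c e + r i b e * r a c d + r i c d * r a b e
  - r i c e * r a b d + r i d e * r a b c

/-- The components of the endomorphism attached to a `3`-form with components `r`. -/
def endoComp (r : Fin 6 → Fin 6 → Fin 6 → ℝ) (i : Fin 6) : Fin 6 → ℝ :=
  ![-wedgeTwoThree r i 1 2 3 4 5, wedgeTwoThree r i 0 2 3 4 5, -wedgeTwoThree r i 0 1 3 4 5,
    wedgeTwoThree r i 0 1 2 4 5, -wedgeTwoThree r i 0 1 2 3 5, wedgeTwoThree r i 0 1 2 3 4]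

/-- The off-diagonal part of S² on the first basis vector vanishes identically in the components of
ρ. The first vector suffices, since any nonzero vector can be completed to a basis starting with it;
`endoComp_contract` and `endoComp_symm` are used in the same way. -/
theorem endoComp_sq {r : Fin 6 → Fin 6 → Fin 6 → ℝ} (h : IsAlt3 r) (j : Fin 6) (hj : j ≠ 0) :
    ∑ k, endoComp r k j * endoComp r 0 k = 0 := by
  fin_cases j
  · simp at hj
  all_goals
    simp [Fin.sum_univ_six, endoComp, wedgeTwoThree, h.rules]
    ring

theorem endoComp_contract {r : Fin 6 → Fin 6 → Fin 6 → ℝ} (h : IsAlt3 r) (j : Fin 6) :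
    ∑ k, endoComp r 0 k * r 0 k j = 0 := by
  fin_cases j
  all_goals simp [Fin.sum_univ_six, endoComp, wedgeTwoThree, h.rules]
  all_goals ring

/-- The components of `w ∧ r` for a `2`-form `w` and a `3`-form `r`. -/
def wedgeComp (w : Fin 6 → Fin 6 → ℝ) (r : Fin 6 → Fin 6 → Fin 6 → ℝ) (a b c d e : Fin 6) : ℝ :=
  w a b * r c d e - w a c * r b d e + w a d * r b c e - w a e * r b c d
  + w b c * r a d e - w b d * r a c e + w b e * r a c d + w c d * r a b e
  - w c e * r a b d + w d e * r a b c

/-- The failure of symmetry of ω(·, S·) lies in the ideal generated by the components of ω ∧ ρ; the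
coefficients are components of ρ. -/
theorem endoComp_symm {w : Fin 6 → Fin 6 → ℝ} (hw : IsAlt2 w) {r : Fin 6 → Fin 6 → Fin 6 → ℝ}
    (h : IsAlt3 r) (h0 : ∀ a b c d e, wedgeComp w r a b c d e = 0) (j : Fin 6) :
    ∑ k, w 0 k * endoComp r j k = ∑ k, w j k * endoComp r 0 k := by
  have e1 := h0 0 2 3 4 5
  have e2 := h0 0 1 3 4 5
  have e3 := h0 0 1 2 4 5
  have e4 := h0 0 1 2 3 5
  have e5 := h0 0 1 2 3 4
  have e0 := h0 1 2 3 4 5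
  fin_cases j
  · rfl
  all_goals
    simp [Fin.sum_univ_six, endoComp, wedgeTwoThree, wedgeComp, h.rules, hw.rules] at *
  · linear_combination 2 * (-r 0 1 2 * e2 + r 0 1 3 * e3 - r 0 1 4 * e4 + r 0 1 5 * e5)
  · linear_combination 2 * (-r 0 1 2 * e1 + r 0 2 3 * e3 - r 0 2 4 * e4 + r 0 2 5 * e5)
  · linear_combination 2 * (-r 0 1 3 * e1 + r 0 2 3 * e2 - r 0 3 4 * e4 + r 0 3 5 * e5)
  · linear_combination 2 * (-r 0 1 4 * e1 + r 0 2 4 * e2 - r 0 3 4 * e3 + r 0 4 5 * e5)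
  · linear_combination 2 * (-r 0 1 5 * e1 + r 0 2 5 * e2 - r 0 3 5 * e3 + r 0 4 5 * e4)


end Components

/-! ### The standard model and the endomorphism S in arbitrary bases -/

section Pointwise

set_option maxRecDepth 4000

/-- The components of the standard symplectic form. -/
def omZ : Fin 6 → Fin 6 → ℤ :=
  ![![0, 1, 0, 0, 0, 0],
    ![-1, 0, 0, 0, 0, 0],
    ![0, 0, 0, 1, 0, 0],
    ![0, 0, -1, 0, 0, 0],
    ![0, 0, 0, 0, 0, 1],
    ![0, 0, 0, 0, -1, 0]]

/-- The components of the real part of the standard complex volume form. -/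
def psZ : Fin 6 → Fin 6 → Fin 6 → ℤ :=
  ![![![0, 0, 0, 0, 0, 0], ![0, 0, 0, 0, 0, 0], ![0, 0, 0, 0, 1, 0], ![0, 0, 0, 0, 0, -1],
    ![0, 0, -1, 0, 0, 0], ![0, 0, 0, 1, 0, 0]],
  ![![0, 0, 0, 0, 0, 0], ![0, 0, 0, 0, 0, 0], ![0, 0, 0, 0, 0, -1], ![0, 0, 0, 0, -1, 0],
    ![0, 0, 0, 1, 0, 0], ![0, 0, 1, 0, 0, 0]],
  ![![0, 0, 0, 0, -1, 0], ![0, 0, 0, 0, 0, 1], ![0, 0, 0, 0, 0, 0], ![0, 0, 0, 0, 0, 0],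
    ![1, 0, 0, 0, 0, 0], ![0, -1, 0, 0, 0, 0]],
  ![![0, 0, 0, 0, 0, 1], ![0, 0, 0, 0, 1, 0], ![0, 0, 0, 0, 0, 0], ![0, 0, 0, 0, 0, 0],
    ![0, -1, 0, 0, 0, 0], ![-1, 0, 0, 0, 0, 0]],
  ![![0, 0, 1, 0, 0, 0], ![0, 0, 0, -1, 0, 0], ![-1, 0, 0, 0, 0, 0], ![0, 1, 0, 0, 0, 0],
    ![0, 0, 0, 0, 0, 0], ![0, 0, 0, 0, 0, 0]],
  ![![0, 0, 0, -1, 0, 0], ![0, 0, -1, 0, 0, 0], ![0, 1, 0, 0, 0, 0], ![1, 0, 0, 0, 0, 0],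
    ![0, 0, 0, 0, 0, 0], ![0, 0, 0, 0, 0, 0]]]

/-- The components of the imaginary part of the standard complex volume form. -/
def qsZ : Fin 6 → Fin 6 → Fin 6 → ℤ :=
  ![![![0, 0, 0, 0, 0, 0], ![0, 0, 0, 0, 0, 0], ![0, 0, 0, 0, 0, 1], ![0, 0, 0, 0, 1, 0],
    ![0, 0, 0, -1, 0, 0], ![0, 0, -1, 0, 0, 0]],
  ![![0, 0, 0, 0, 0, 0], ![0, 0, 0, 0, 0, 0], ![0, 0, 0, 0, 1, 0], ![0, 0, 0, 0, 0, -1],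
    ![0, 0, -1, 0, 0, 0], ![0, 0, 0, 1, 0, 0]],
  ![![0, 0, 0, 0, 0, -1], ![0, 0, 0, 0, -1, 0], ![0, 0, 0, 0, 0, 0], ![0, 0, 0, 0, 0, 0],
    ![0, 1, 0, 0, 0, 0], ![1, 0, 0, 0, 0, 0]],
  ![![0, 0, 0, 0, -1, 0], ![0, 0, 0, 0, 0, 1], ![0, 0, 0, 0, 0, 0], ![0, 0, 0, 0, 0, 0],
    ![1, 0, 0, 0, 0, 0], ![0, -1, 0, 0, 0, 0]],
  ![![0, 0, 0, 1, 0, 0], ![0, 0, 1, 0, 0, 0], ![0, -1, 0, 0, 0, 0], ![-1, 0, 0, 0, 0, 0],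
    ![0, 0, 0, 0, 0, 0], ![0, 0, 0, 0, 0, 0]],
  ![![0, 0, 1, 0, 0, 0], ![0, 0, 0, -1, 0, 0], ![-1, 0, 0, 0, 0, 0], ![0, 1, 0, 0, 0, 0],
    ![0, 0, 0, 0, 0, 0], ![0, 0, 0, 0, 0, 0]]]

/-- The index of the basis vector `± J f_i`. -/
def mJ : Fin 6 → Fin 6 := ![1, 0, 3, 2, 5, 4]

/-- The sign in `J f_i = ± f_{mJ i}`. -/
def sZ : Fin 6 → ℤ := ![1, -1, 1, -1, 1, -1]

/-- The components of the standard symplectic form, as real numbers. -/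
def omC (i j : Fin 6) : ℝ := omZ i j

/-- The components of the real part of the standard complex volume form, as real numbers. -/
def psC (i j k : Fin 6) : ℝ := psZ i j k

/-- The components of the imaginary part of the standard complex volume form, as real numbers. -/
def qsC (i j k : Fin 6) : ℝ := qsZ i j k

/-- The sign in `J f_i = ± f_{mJ i}`, as a real number. -/
def sJ (i : Fin 6) : ℝ := sZ i

/-- The tables are integral so that identities between them can be decided by finite enumeration and
then cast to ℝ. -/
theorem isAlt2_omC : IsAlt2 omC := by
  have : ∀ i j, omZ i j = -omZ j i := by decide
  exact fun i j ↦ by simp only [omC]; exact_mod_cast this i j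

theorem isAlt3_psC : IsAlt3 psC := by
  have h1 : ∀ i j k, psZ i j k = -psZ j i k := by decide
  have h2 : ∀ i j k, psZ i j k = -psZ i k j := by decide
  exact ⟨fun i j k ↦ by simp only [psC]; exact_mod_cast h1 i j k,
    fun i j k ↦ by simp only [psC]; exact_mod_cast h2 i j k⟩

theorem isAlt3_qsC : IsAlt3 qsC := by
  have h1 : ∀ i j k, qsZ i j k = -qsZ j i k := by decide
  have h2 : ∀ i j k, qsZ i j k = -qsZ i k j := by decide
  exact ⟨fun i j k ↦ by simp only [qsC]; exact_mod_cast h1 i j k,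
    fun i j k ↦ by simp only [qsC]; exact_mod_cast h2 i j k⟩

/-- Complex linearity of Ω = ψ + iψ̂ in one slot: the imaginary part of Ω(J·, ·, ·) = iΩ. -/
theorem qsC_contract (m j k : Fin 6) : sJ m * qsC (mJ m) j k = psC m j k := by
  have : ∀ m j k, sZ m * qsZ (mJ m) j k = psZ m j k := by decide
  simp only [sJ, psC, qsC]; exact_mod_cast this m j k

/-- The real part of Ω(J·, J·, J·) = i³Ω = -iΩ. -/
theorem psC_cplx (i j k : Fin 6) :
    sJ i * (sJ j * (sJ k * psC (mJ i) (mJ j) (mJ k))) = qsC i j k := by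
  have : ∀ i j k, sZ i * (sZ j * (sZ k * psZ (mJ i) (mJ j) (mJ k))) = qsZ i j k := by decide
  simp only [sJ, psC, qsC]; exact_mod_cast this i j k

theorem qsC_cplx (i j k : Fin 6) :
    sJ i * (sJ j * (sJ k * qsC (mJ i) (mJ j) (mJ k))) = -psC i j k := by
  have : ∀ i j k, sZ i * (sZ j * (sZ k * qsZ (mJ i) (mJ j) (mJ k))) = -psZ i j k := by decide
  simp only [sJ, psC, qsC]; exact_mod_cast this i j k

theorem sJ_mJ (i : Fin 6) : sJ (mJ i) = -sJ i := by
  have : ∀ i, sZ (mJ i) = -sZ i := by decide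
  simp only [sJ]; exact_mod_cast this i

theorem sJ_sq (i : Fin 6) : sJ i * sJ i = 1 := by
  have : ∀ i, sZ i * sZ i = 1 := by decide
  simp only [sJ]; exact_mod_cast this i

theorem mJ_mJ : ∀ i : Fin 6, mJ (mJ i) = i := by decide

theorem psC_sorted :
    psC 0 1 2 = 0 ∧ psC 0 1 3 = 0 ∧ psC 0 1 4 = 0 ∧ psC 0 1 5 = 0 ∧ psC 0 2 3 = 0 ∧
    psC 0 2 4 = 1 ∧ psC 0 2 5 = 0 ∧ psC 0 3 4 = 0 ∧ psC 0 3 5 = -1 ∧ psC 0 4 5 = 0 ∧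
    psC 1 2 3 = 0 ∧ psC 1 2 4 = 0 ∧ psC 1 2 5 = -1 ∧ psC 1 3 4 = -1 ∧ psC 1 3 5 = 0 ∧
    psC 1 4 5 = 0 ∧ psC 2 3 4 = 0 ∧ psC 2 3 5 = 0 ∧ psC 2 4 5 = 0 ∧ psC 3 4 5 = 0 := by
  simp [psC, psZ]

theorem qsC_sorted :
    qsC 0 1 2 = 0 ∧ qsC 0 1 3 = 0 ∧ qsC 0 1 4 = 0 ∧ qsC 0 1 5 = 0 ∧ qsC 0 2 3 = 0 ∧
    qsC 0 2 4 = 0 ∧ qsC 0 2 5 = 1 ∧ qsC 0 3 4 = 1 ∧ qsC 0 3 5 = 0 ∧ qsC 0 4 5 = 0 ∧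
    qsC 1 2 3 = 0 ∧ qsC 1 2 4 = 1 ∧ qsC 1 2 5 = 0 ∧ qsC 1 3 4 = 0 ∧ qsC 1 3 5 = -1 ∧
    qsC 1 4 5 = 0 ∧ qsC 2 3 4 = 0 ∧ qsC 2 3 5 = 0 ∧ qsC 2 4 5 = 0 ∧ qsC 3 4 5 = 0 := by
  simp [qsC, qsZ]

theorem omC_sorted :
    omC 0 1 = 1 ∧ omC 0 2 = 0 ∧ omC 0 3 = 0 ∧ omC 0 4 = 0 ∧ omC 0 5 = 0 ∧ omC 1 2 = 0 ∧
    omC 1 3 = 0 ∧ omC 1 4 = 0 ∧ omC 1 5 = 0 ∧ omC 2 3 = 1 ∧ omC 2 4 = 0 ∧ omC 2 5 = 0 ∧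
    omC 3 4 = 0 ∧ omC 3 5 = 0 ∧ omC 4 5 = 1 := by
  simp [omC, omZ]

theorem sJ_values : sJ 0 = 1 ∧ sJ 1 = -1 ∧ sJ 2 = 1 ∧ sJ 3 = -1 ∧ sJ 4 = 1 ∧ sJ 5 = -1 := by
  simp [sJ, sZ]

theorem mJ_values : mJ 0 = 1 ∧ mJ 1 = 0 ∧ mJ 2 = 3 ∧ mJ 3 = 2 ∧ mJ 4 = 5 ∧ mJ 5 = 4 :=
  ⟨rfl, rfl, rfl, rfl, rfl, rfl⟩

theorem IsAlt3.ext {a b : Fin 6 → Fin 6 → Fin 6 → ℝ} (ha : IsAlt3 a) (hb : IsAlt3 b)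
    (h : ∀ i j k, i < j → j < k → a i j k = b i j k) (i j k : Fin 6) : a i j k = b i j k := by
  rcases eq_or_ne i j with rfl | hij
  · rw [ha.rules.1.1, hb.rules.1.1]
  rcases eq_or_ne j k with rfl | hjk
  · rw [ha.rules.1.2.1, hb.rules.1.2.1]
  rcases eq_or_ne i k with rfl | hik
  · rw [ha.rules.1.2.2, hb.rules.1.2.2]
  rcases hij.lt_or_gt with h1 | h1 <;> rcases hjk.lt_or_gt with h2 | h2 <;>
    rcases hik.lt_or_gt with h3 | h3
  · exact h _ _ _ h1 h2
  · exact absurd (h1.trans h2) h3.not_gt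
  · rw [ha.2, hb.2, h _ _ _ h3 h2]
  · rw [ha.2, hb.2, ha.1, hb.1, h _ _ _ h3 h1]
  · rw [ha.1, hb.1, h _ _ _ h1 h3]
  · rw [ha.1, hb.1, ha.2, hb.2, h _ _ _ h2 h3]
  · exact absurd (h2.trans h1) h3.not_gt
  · rw [ha.1, hb.1, ha.2, hb.2, ha.1, hb.1, h _ _ _ h2 h1]

theorem IsAlt3.ext_sorted {a b : Fin 6 → Fin 6 → Fin 6 → ℝ} (ha : IsAlt3 a) (hb : IsAlt3 b)
    (h : a 0 1 2 = b 0 1 2 ∧ a 0 1 3 = b 0 1 3 ∧ a 0 1 4 = b 0 1 4 ∧ a 0 1 5 = b 0 1 5 ∧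
      a 0 2 3 = b 0 2 3 ∧ a 0 2 4 = b 0 2 4 ∧ a 0 2 5 = b 0 2 5 ∧ a 0 3 4 = b 0 3 4 ∧
      a 0 3 5 = b 0 3 5 ∧ a 0 4 5 = b 0 4 5 ∧ a 1 2 3 = b 1 2 3 ∧ a 1 2 4 = b 1 2 4 ∧
      a 1 2 5 = b 1 2 5 ∧ a 1 3 4 = b 1 3 4 ∧ a 1 3 5 = b 1 3 5 ∧ a 1 4 5 = b 1 4 5 ∧
      a 2 3 4 = b 2 3 4 ∧ a 2 3 5 = b 2 3 5 ∧ a 2 4 5 = b 2 4 5 ∧ a 3 4 5 = b 3 4 5)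
    (i j k : Fin 6) : a i j k = b i j k := by
  obtain ⟨h1, h2, h3, h4, h5, h6, h7, h8, h9, h10, h11, h12, h13, h14, h15, h16, h17, h18, h19,
    h20⟩ := h
  refine ha.ext hb (fun i j k hij hjk ↦ ?_) i j k
  fin_cases i <;> fin_cases j <;> first | exact absurd hij (by decide) | skip
  all_goals fin_cases k <;> first | exact absurd hjk (by decide) | assumption

/-- A `3`-form of type `(3, 0) + (0, 3)` is a combination of `Re` and `Im` of the complex volume
form. -/
theorem IsAlt3.eq_of_type {r : Fin 6 → Fin 6 → Fin 6 → ℝ} (h : IsAlt3 r)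
    (hJ : ∀ i j k, sJ i * r (mJ i) j k = sJ j * r i (mJ j) k) (i j k : Fin 6) :
    r i j k = r 0 2 4 * psC i j k + r 1 2 4 * qsC i j k := by
  -- Taking both slots in one complex line shows that every component containing a pair f, Jf
  -- vanishes. Eight components remain, and the relations below reduce them to two.
  have z1 (k : Fin 6) : r 0 1 k = 0 := by
    have := hJ 0 0 k; simp [sJ, sZ, mJ, h.rules] at this; linarith
  have z2 (k : Fin 6) : r k 2 3 = 0 := by
    have := hJ 2 2 k; simp [sJ, sZ, mJ] at this
    have e1 : r k 2 3 = r 2 3 k := by rw [h.1, h.2]; simp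
    have e2 : r k 2 3 = -r 3 2 k := by rw [h.2, h.1, h.2]; simp
    linarith
  have z3 (k : Fin 6) : r k 4 5 = 0 := by
    have := hJ 4 4 k; simp [sJ, sZ, mJ] at this
    have e1 : r k 4 5 = r 4 5 k := by rw [h.1, h.2]; simp
    have e2 : r k 4 5 = -r 5 4 k := by rw [h.2, h.1, h.2]; simp
    linarith
  have z4 (k : Fin 6) : r 2 3 k = 0 := by
    rw [h.2, h.1, z2]; simp
  have h1 := hJ 0 2 4
  have h2 := hJ 0 3 4
  have h3 := hJ 0 4 2
  have h4 := hJ 0 5 2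
  have h5 := hJ 2 4 0
  have h6 := hJ 0 2 5
  have h7 := hJ 0 3 5
  simp [sJ, sZ, mJ, h.rules] at h1 h2 h3 h4 h5 h6 h7
  have a1 : r 0 3 4 = r 1 2 4 := by linarith
  have a2 : r 0 2 5 = r 1 2 4 := by linarith
  have a3 : r 1 3 4 = -r 0 2 4 := by linarith
  have a4 : r 1 2 5 = -r 0 2 4 := by linarith
  have a5 : r 0 3 5 = -r 0 2 4 := by linarith
  have a6 : r 1 3 5 = -r 1 2 4 := by linarith
  refine h.ext_sorted (b := fun i j k ↦ r 0 2 4 * psC i j k + r 1 2 4 * qsC i j k)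
    ⟨fun i j k ↦ ?_, fun i j k ↦ ?_⟩ ?_ i j k
  · linear_combination r 0 2 4 * isAlt3_psC.1 i j k + r 1 2 4 * isAlt3_qsC.1 i j k
  · linear_combination r 0 2 4 * isAlt3_psC.2 i j k + r 1 2 4 * isAlt3_qsC.2 i j k
  · simp [psC_sorted, qsC_sorted, z1, z2, z3, z4, a1, a2, a3, a4, a5, a6]

variable {V : Type*} [AddCommGroup V] [Module ℝ V]

/-- A `2`-form as a bilinear map. -/
def bil (α : V [⋀^Fin 2]→ₗ[ℝ] ℝ) : V →ₗ[ℝ] V →ₗ[ℝ] ℝ where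
  toFun x :=
    { toFun := fun y ↦ α ![x, y]
      map_add' := fun y z ↦
        congrArg (fun F ↦ F ![]) ((α.curryLeft x).curryLeft.map_add y z)
      map_smul' := fun c y ↦
        congrArg (fun F ↦ F ![]) ((α.curryLeft x).curryLeft.map_smul c y) }
  map_add' x y := LinearMap.ext fun z ↦ congrArg (fun F ↦ F ![z]) (α.curryLeft.map_add x y)
  map_smul' c x := LinearMap.ext fun z ↦ congrArg (fun F ↦ F ![z]) (α.curryLeft.map_smul c x)

@[simp]
theorem bil_apply (α : V [⋀^Fin 2]→ₗ[ℝ] ℝ) (x y : V) : bil α x y = α ![x, y] := rfl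

/-- A `3`-form as a trilinear map. -/
def tril (α : V [⋀^Fin 3]→ₗ[ℝ] ℝ) : V →ₗ[ℝ] V →ₗ[ℝ] V →ₗ[ℝ] ℝ where
  toFun x := bil (α.curryLeft x)
  map_add' x y := LinearMap.ext₂ fun z w ↦
    congrArg (fun F ↦ F ![z, w]) (α.curryLeft.map_add x y)
  map_smul' c x := LinearMap.ext₂ fun z w ↦
    congrArg (fun F ↦ F ![z, w]) (α.curryLeft.map_smul c x)

@[simp]
theorem tril_apply (α : V [⋀^Fin 3]→ₗ[ℝ] ℝ) (x y z : V) : tril α x y z = α ![x, y, z] := rfl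

theorem two_swap (α : V [⋀^Fin 2]→ₗ[ℝ] ℝ) (x y : V) : α ![x, y] = -α ![y, x] := by
  have := α.map_swap ![y, x] (i := 0) (j := 1) (by decide)
  rw [← this]
  congr 1; ext i; fin_cases i <;> rfl

theorem three_swap_left (α : V [⋀^Fin 3]→ₗ[ℝ] ℝ) (x y z : V) :
    α ![x, y, z] = -α ![y, x, z] := by
  have := α.map_swap ![y, x, z] (i := 0) (j := 1) (by decide)
  rw [← this]
  congr 1; ext i; fin_cases i <;> rfl

theorem three_swap_right (α : V [⋀^Fin 3]→ₗ[ℝ] ℝ) (x y z : V) :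
    α ![x, y, z] = -α ![x, z, y] := by
  have := α.map_swap ![x, z, y] (i := 1) (j := 2) (by decide)
  rw [← this]
  congr 1; ext i; fin_cases i <;> rfl

theorem two_self (α : V [⋀^Fin 2]→ₗ[ℝ] ℝ) (x : V) : α ![x, x] = 0 := by
  linarith [two_swap α x x]

theorem isAlt2_form (α : V [⋀^Fin 2]→ₗ[ℝ] ℝ) (c : Fin 6 → V) :
    IsAlt2 fun i j ↦ α ![c i, c j] :=
  fun _ _ ↦ two_swap _ _ _

theorem isAlt3_form (α : V [⋀^Fin 3]→ₗ[ℝ] ℝ) (c : Fin 6 → V) :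
    IsAlt3 fun i j k ↦ α ![c i, c j, c k] :=
  ⟨fun _ _ _ ↦ three_swap_left _ _ _ _, fun _ _ _ ↦ three_swap_right _ _ _ _⟩

theorem apply_six (α : V [⋀^Fin 6]→ₗ[ℝ] ℝ) (c : Fin 6 → V) :
    α c = α ![c 0, c 1, c 2, c 3, c 4, c 5] := by
  congr 1; ext i; fin_cases i <;> rfl

theorem exists_basis_zero_eq (b : Module.Basis (Fin 6) ℝ V) {v : V} (hv : v ≠ 0) :
    ∃ c : Module.Basis (Fin 6) ℝ V, c 0 = v := by
  have hs : LinearIndepOn ℝ id ({v} : Set V) := LinearIndepOn.singleton hv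
  let B := Module.Basis.extend hs
  let e₀ := B.indexEquiv b
  have hmem : v ∈ hs.extend (Set.subset_univ _) := hs.subset_extend _ rfl
  let e := e₀.trans (Equiv.swap (e₀ ⟨v, hmem⟩) 0)
  refine ⟨B.reindex e, ?_⟩
  have : e.symm 0 = ⟨v, hmem⟩ := by
    rw [Equiv.symm_apply_eq]; simp [e]
  rw [Module.Basis.reindex_apply, this]
  exact Module.Basis.extend_apply_self hs _

variable (b : Module.Basis (Fin 6) ℝ V)

theorem apply_basis_ne_zero {vol : V [⋀^Fin 6]→ₗ[ℝ] ℝ} (hvol : vol ≠ 0) : vol b ≠ 0 := by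
  intro h
  apply hvol
  rw [AlternatingMap.eq_smul_basis_det b vol, h, zero_smul]

theorem coord_endo {vol : V [⋀^Fin 6]→ₗ[ℝ] ℝ} (hvol : vol ≠ 0) (ρ : V [⋀^Fin 3]→ₗ[ℝ] ℝ)
    (c : Module.Basis (Fin 6) ℝ V) (i j : Fin 6) :
    c.coord j (endo b vol ρ (c i)) =
      (vol c)⁻¹ * endoComp (fun i j k ↦ ρ ![c i, c j, c k]) i j := by
  have h := congrArg (fun F ↦ F c) (endo_spec b vol hvol ρ (c i) (c.coord j))
  have h0 := apply_basis_ne_zero c hvol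
  simp only [AlternatingMap.smul_apply, smul_eq_mul] at h
  rw [eq_inv_mul_iff_mul_eq₀ h0, mul_comm, ← h, contractWedge, apply_six, wedge_five_one]
  simp only [wedge_two_three, oneForm, AlternatingMap.ofSubsingleton_apply_apply,
    AlternatingMap.curryLeft_apply_apply, Module.Basis.coord_apply, Module.Basis.repr_self]
  fin_cases j <;> simp [endoComp, wedgeTwoThree, Finsupp.single_apply]

theorem endo_apply_basis {vol : V [⋀^Fin 6]→ₗ[ℝ] ℝ} (hvol : vol ≠ 0) (ρ : V [⋀^Fin 3]→ₗ[ℝ] ℝ)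
    (c : Module.Basis (Fin 6) ℝ V) (i : Fin 6) :
    endo b vol ρ (c i) =
      ∑ j, ((vol c)⁻¹ * endoComp (fun i j k ↦ ρ ![c i, c j, c k]) i j) • c j := by
  rw [← c.sum_repr (endo b vol ρ (c i))]
  exact Finset.sum_congr rfl fun j _ ↦ by rw [← coord_endo b hvol ρ c i j]; rfl

/-- `S_ρ² = P(ρ) Id`. -/
theorem endo_endo {vol : V [⋀^Fin 6]→ₗ[ℝ] ℝ} (hvol : vol ≠ 0) (ρ : V [⋀^Fin 3]→ₗ[ℝ] ℝ) (v : V) :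
    endo b vol ρ (endo b vol ρ v) = quartic b vol ρ • v := by
  -- An endomorphism for which every v is linearly dependent with its image is scalar. The trace
  -- divided by the dimension 6 then identifies the scalar as `quartic`.
  have : ∃ a : ℝ, endo b vol ρ ∘ₗ endo b vol ρ = a • LinearMap.id := by
    refine LinearMap.exists_eq_smul_id_of_forall_notLinearIndependent fun v ↦ ?_
    rcases eq_or_ne v 0 with rfl | hv
    · exact fun h ↦ h.ne_zero 0 rfl
    obtain ⟨c, rfl⟩ := exists_basis_zero_eq b hv
    have hr := isAlt3_form ρ c
    have : endo b vol ρ (endo b vol ρ (c 0)) =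
        (c.coord 0 (endo b vol ρ (endo b vol ρ (c 0)))) • c 0 := by
      refine c.ext_elem fun j ↦ ?_
      rcases eq_or_ne j 0 with rfl | hj
      · simp
      have e : c.coord j (endo b vol ρ (endo b vol ρ (c 0))) = 0 := by
        rw [endo_apply_basis b hvol ρ c 0, map_sum, map_sum]
        simp only [map_smul, coord_endo b hvol ρ c, smul_eq_mul]
        have := endoComp_sq hr j hj
        calc _ = (vol c)⁻¹ * (vol c)⁻¹ * ∑ k, endoComp (fun i j k ↦ ρ ![c i, c j, c k]) k j *
              endoComp (fun i j k ↦ ρ ![c i, c j, c k]) 0 k := by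
              rw [Finset.mul_sum]
              exact Finset.sum_congr rfl fun k _ ↦ by ring
          _ = 0 := by rw [this, mul_zero]
      rw [Module.Basis.coord_apply] at e
      rw [e]
      simp [Finsupp.single_apply, hj.symm]
    intro hli
    rw [LinearIndependent.pair_iff] at hli
    have h2 := hli (c.coord 0 (endo b vol ρ (endo b vol ρ (c 0)))) (-1) (by
      rw [LinearMap.comp_apply, neg_one_smul, ← this, add_neg_cancel])
    norm_num at h2
  obtain ⟨a, ha⟩ := this
  have hq : quartic b vol ρ = a := by
    have := Module.Finite.of_basis b
    rw [quartic, ha, map_smul, LinearMap.trace_id, Module.finrank_eq_card_basis b]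
    simp
  rw [hq]
  exact LinearMap.congr_fun ha v

theorem form_endo_self {vol : V [⋀^Fin 6]→ₗ[ℝ] ℝ} (hvol : vol ≠ 0) (ρ : V [⋀^Fin 3]→ₗ[ℝ] ℝ)
    (v w : V) : ρ ![v, endo b vol ρ v, w] = 0 := by
  rcases eq_or_ne v 0 with rfl | hv
  · exact congrArg (fun F ↦ F ![endo b vol ρ 0, w]) (ρ.curryLeft.map_zero)
  obtain ⟨c, rfl⟩ := exists_basis_zero_eq b hv
  rw [← tril_apply]
  have : tril ρ (c 0) (endo b vol ρ (c 0)) = 0 := by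
    refine c.ext fun j ↦ ?_
    rw [endo_apply_basis b hvol ρ c 0]
    have := endoComp_contract (isAlt3_form ρ c) j
    simp only [map_sum, map_smul, LinearMap.sum_apply, LinearMap.smul_apply, tril_apply,
      smul_eq_mul, LinearMap.zero_apply]
    simp only [mul_assoc, ← Finset.mul_sum, this, mul_zero]
  rw [this, LinearMap.zero_apply]

/-- Polarisation of `form_endo_self`. -/
theorem form_endo_left {vol : V [⋀^Fin 6]→ₗ[ℝ] ℝ} (hvol : vol ≠ 0) (ρ : V [⋀^Fin 3]→ₗ[ℝ] ℝ)
    (u v w : V) : ρ ![endo b vol ρ u, v, w] = ρ ![u, endo b vol ρ v, w] := by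
  have h := form_endo_self b hvol ρ (u + v) w
  have h1 := form_endo_self b hvol ρ u w
  have h2 := form_endo_self b hvol ρ v w
  have h3 := three_swap_left ρ v (endo b vol ρ u) w
  rw [← tril_apply] at h h1 h2 h3 ⊢
  simp only [map_add, LinearMap.add_apply] at h
  simp only [tril_apply] at *
  linarith

theorem form_endo_symm {vol : V [⋀^Fin 6]→ₗ[ℝ] ℝ} (hvol : vol ≠ 0) {ω : V [⋀^Fin 2]→ₗ[ℝ] ℝ}
    {ρ : V [⋀^Fin 3]→ₗ[ℝ] ℝ} (h : wedge ω ρ = 0) (v w : V) :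
    ω ![v, endo b vol ρ w] = ω ![w, endo b vol ρ v] := by
  rcases eq_or_ne v 0 with rfl | hv
  · simp only [← bil_apply, map_zero, LinearMap.zero_apply]
  obtain ⟨c, rfl⟩ := exists_basis_zero_eq b hv
  have h0 : ∀ i j k l m, wedgeComp (fun i j ↦ ω ![c i, c j]) (fun i j k ↦ ρ ![c i, c j, c k])
      i j k l m = 0 := fun i j k l m ↦ by
    have := congrArg (fun F ↦ F (![c i, c j, c k, c l, c m] : Fin 5 → V)) h
    rw [wedge_two_three] at this
    exact this
  have : bil ω (c 0) ∘ₗ endo b vol ρ = (bil ω).flip (endo b vol ρ (c 0)) := by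
    refine c.ext fun j ↦ ?_
    have := endoComp_symm (isAlt2_form ω c) (isAlt3_form ρ c) h0 j
    rw [LinearMap.comp_apply, LinearMap.flip_apply, endo_apply_basis b hvol ρ c 0,
      endo_apply_basis b hvol ρ c j]
    simp only [map_sum, map_smul, LinearMap.smul_apply, bil_apply, smul_eq_mul]
    calc _ = (vol c)⁻¹ * ∑ k, ω ![c 0, c k] *
          endoComp (fun i j k ↦ ρ ![c i, c j, c k]) j k := by
          rw [Finset.mul_sum]; exact Finset.sum_congr rfl fun k _ ↦ by ring
      _ = _ := by
          rw [this, Finset.mul_sum]; exact Finset.sum_congr rfl fun k _ ↦ by ring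
  exact LinearMap.congr_fun this w

end Pointwise

/-! ### Existence of adapted bases -/

section Adapted

variable {V : Type*} [AddCommGroup V] [Module ℝ V]

/-- The basis `f` is adapted to `(ω, ψ, J)`: it is unitary and `ψ` is the real part of the standard
complex volume form. -/
structure IsAdapted (f : Module.Basis (Fin 6) ℝ V) (ω : V [⋀^Fin 2]→ₗ[ℝ] ℝ)
    (ψ : V [⋀^Fin 3]→ₗ[ℝ] ℝ) (J : V →ₗ[ℝ] V) : Prop where
  cplx : ∀ i, J (f i) = sJ i • f (mJ i)
  omega : ∀ i j, ω ![f i, f j] = omC i j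
  psi : ∀ i j k, ψ ![f i, f j, f k] = psC i j k

theorem metric_eq (b : Module.Basis (Fin 6) ℝ V) (ω : V [⋀^Fin 2]→ₗ[ℝ] ℝ)
    (ψ : V [⋀^Fin 3]→ₗ[ℝ] ℝ) (v w : V) :
    metric b ω ψ v w = (bil ω).compl₂ (cplx b ω ψ) v w := rfl

namespace IsSU3

variable {b : Module.Basis (Fin 6) ℝ V} {ω : V [⋀^Fin 2]→ₗ[ℝ] ℝ} {ψ : V [⋀^Fin 3]→ₗ[ℝ] ℝ}

theorem volForm_ne_zero (h : IsSU3 b ω ψ) : volForm ω ≠ 0 := by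
  intro h0
  have := h.stable
  rw [quartic, endo, h0] at this
  -- Division by zero gives zero, so a vanishing volume form would make S, and with it P, vanish,
  -- against P < 0.
  have hz : (Matrix.of fun j i ↦ contractWedge ψ (b i) (b.coord j) b /
      (0 : V [⋀^Fin 6]→ₗ[ℝ] ℝ) b) = (0 : Matrix (Fin 6) (Fin 6) ℝ) := by
    ext; simp
  rw [hz] at this
  simp at this

theorem sqrt_pos (h : IsSU3 b ω ψ) : 0 < √(-quartic b (volForm ω) ψ) :=
  Real.sqrt_pos.2 (neg_pos.2 h.stable)

theorem cplx_cplx (h : IsSU3 b ω ψ) (v : V) : cplx b ω ψ (cplx b ω ψ v) = -v := by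
  have h0 := h.sqrt_pos
  have h1 : √(-quartic b (volForm ω) ψ) * √(-quartic b (volForm ω) ψ) =
      -quartic b (volForm ω) ψ := Real.mul_self_sqrt (neg_pos.2 h.stable).le
  simp only [cplx, LinearMap.smul_apply, map_smul, endo_endo b h.volForm_ne_zero, smul_smul]
  rw [show quartic b (volForm ω) ψ = -(√(-quartic b (volForm ω) ψ) *
    √(-quartic b (volForm ω) ψ)) by rw [h1, neg_neg]]
  rw [h1, neg_neg]
  rw [← neg_one_smul ℝ v]
  congr 1
  rw [neg_neg, ← mul_assoc, ← mul_inv, h1]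
  have := h.stable.ne
  field_simp

theorem psi_cplx (h : IsSU3 b ω ψ) (u v w : V) : ψ ![cplx b ω ψ u, v, w] = ψ ![u, cplx b ω ψ v, w] := by
  have := form_endo_left b h.volForm_ne_zero ψ u v w
  simp only [← tril_apply, cplx, LinearMap.smul_apply, map_smul] at this ⊢
  rw [this]

theorem omega_cplx (h : IsSU3 b ω ψ) (v w : V) : ω ![v, cplx b ω ψ w] = ω ![w, cplx b ω ψ v] := by
  have := form_endo_symm b h.volForm_ne_zero h.compatible v w
  simp only [← bil_apply, cplx, LinearMap.smul_apply, map_smul] at this ⊢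
  rw [this]

theorem metric_symm (h : IsSU3 b ω ψ) (v w : V) : metric b ω ψ v w = metric b ω ψ w v := h.omega_cplx v w

theorem metric_cplx (h : IsSU3 b ω ψ) (v w : V) :
    metric b ω ψ (cplx b ω ψ v) (cplx b ω ψ w) = metric b ω ψ v w := by
  rw [metric, h.omega_cplx, metric, h.cplx_cplx, h.omega_cplx]
  rw [two_swap]
  simp only [← bil_apply, map_neg, LinearMap.neg_apply, neg_neg]
  exact h.omega_cplx v w

theorem metric_cplx_right (h : IsSU3 b ω ψ) (v w : V) : metric b ω ψ v (cplx b ω ψ w) = -ω ![v, w] := by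
  rw [metric, h.cplx_cplx]
  simp [← bil_apply]

theorem metric_self_cplx (h : IsSU3 b ω ψ) (v : V) : metric b ω ψ v (cplx b ω ψ v) = 0 := by
  rw [h.metric_cplx_right, two_self, neg_zero]

/-- Fewer than six linear conditions have a nonzero common solution, which is then normalised. This
is one step of the Gram–Schmidt process. -/
theorem exists_unit (h : IsSU3 b ω ψ) {n : ℕ} (hn : n < 6) (u : Fin n → V) :
    ∃ v, metric b ω ψ v v = 1 ∧ ∀ i, metric b ω ψ (u i) v = 0 := by
  have := Module.Finite.of_basis b
  let L : V →ₗ[ℝ] (Fin n → ℝ) := LinearMap.pi fun i ↦ (bil ω).compl₂ (cplx b ω ψ) (u i)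
  have hL : LinearMap.ker L ≠ ⊥ := by
    apply LinearMap.ker_ne_bot_of_finrank_lt
    rw [Module.finrank_eq_card_basis b]
    simpa using hn
  obtain ⟨v, hv, hv0⟩ := Submodule.exists_mem_ne_zero_of_ne_bot hL
  have hpos := h.posDef v hv0
  have hs : 0 < √(metric b ω ψ v v) := Real.sqrt_pos.2 hpos
  refine ⟨(√(metric b ω ψ v v))⁻¹ • v, ?_, fun i ↦ ?_⟩
  · have : √(metric b ω ψ v v) * √(metric b ω ψ v v) = metric b ω ψ v v :=
      Real.mul_self_sqrt hpos.le
    rw [metric_eq, map_smul, map_smul, LinearMap.smul_apply, ← metric_eq]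
    rw [smul_eq_mul, smul_eq_mul]
    field_simp
    rw [sq, this]
  · have := congrFun (LinearMap.mem_ker.1 hv) i
    rw [metric_eq, map_smul]
    rw [show ((bil ω).compl₂ (cplx b ω ψ)) (u i) v = 0 from this, smul_zero]

/-- Complex Gram–Schmidt: each new unit vector is taken orthogonal to the earlier vectors and to
their images under J. As J is a g-isometry with v ⊥ Jv, the image of the new vector is orthogonal to
all of them as well. -/
theorem exists_unitary_basis (h : IsSU3 b ω ψ) : ∃ f : Module.Basis (Fin 6) ℝ V,
    (∀ i, cplx b ω ψ (f i) = sJ i • f (mJ i)) ∧ ∀ i j, metric b ω ψ (f i) (f j) =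
      if i = j then 1 else 0 := by
  obtain ⟨e₀, h00, -⟩ := h.exists_unit (n := 0) (by norm_num) ![]
  obtain ⟨e₂, h22, h2⟩ := h.exists_unit (n := 2) (by norm_num) ![e₀, cplx b ω ψ e₀]
  obtain ⟨e₄, h44, h4⟩ := h.exists_unit (n := 4) (by norm_num)
    ![e₀, cplx b ω ψ e₀, e₂, cplx b ω ψ e₂]
  have a1 := h2 0; have a2 := h2 1
  have a3 := h4 0; have a4 := h4 1; have a5 := h4 2; have a6 := h4 3
  simp only [Matrix.cons_val] at a1 a2 a3 a4 a5 a6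
  have hJr (v w : V) : metric b ω ψ v (cplx b ω ψ w) = -metric b ω ψ (cplx b ω ψ v) w := by
    rw [← h.metric_cplx, h.cplx_cplx, metric_eq, map_neg, ← metric_eq]
  have a1' := h.metric_symm e₂ e₀
  have a3' := h.metric_symm e₄ e₀
  have a5' := h.metric_symm e₄ e₂
  have a2' := h.metric_symm e₂ (cplx b ω ψ e₀)
  have a4' := h.metric_symm e₄ (cplx b ω ψ e₀)
  have a6' := h.metric_symm e₄ (cplx b ω ψ e₂)
  have n (v : V) : metric b ω ψ (cplx b ω ψ v) v = 0 := by
    rw [h.metric_symm, h.metric_self_cplx]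
  have a2'' := h.metric_symm (cplx b ω ψ e₂) e₀
  have a4'' := h.metric_symm (cplx b ω ψ e₄) e₀
  have a6'' := h.metric_symm (cplx b ω ψ e₄) e₂
  let F : Fin 6 → V := ![e₀, cplx b ω ψ e₀, e₂, cplx b ω ψ e₂, e₄, cplx b ω ψ e₄]
  have hF : ∀ i j, metric b ω ψ (F i) (F j) = if i = j then 1 else 0 := by
    intro i j
    fin_cases i <;> fin_cases j <;>
      simp [F, h.metric_cplx, h.metric_self_cplx, n, hJr, h00, h22, h44, a1, a2, a3, a4, a5, a6,
        a1', a2', a3', a4', a5', a6', a2'', a4'', a6'']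
  have hli : LinearIndependent ℝ F := by
    rw [Fintype.linearIndependent_iff]
    intro c hc i
    have := congrArg ((bil ω).compl₂ (cplx b ω ψ) (F i)) hc
    simp only [map_sum, map_smul, ← metric_eq, hF, map_zero] at this
    simpa using this
  let f := basisOfLinearIndependentOfCardEqFinrank hli (by
    rw [Module.finrank_eq_card_basis b])
  have hfF (i : Fin 6) : f i = F i := by simp [f]
  refine ⟨f, fun i ↦ ?_, fun i j ↦ by rw [hfF, hfF, hF]⟩
  rw [hfF, hfF]
  fin_cases i <;> simp [F, sJ, sZ, mJ, h.cplx_cplx]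

/-- Rotating the last complex direction of a unitary basis by a phase. -/
theorem exists_rotated_basis {J : V →ₗ[ℝ] V} (f : Module.Basis (Fin 6) ℝ V)
    (hf : ∀ i, J (f i) = sJ i • f (mJ i)) {p q : ℝ} (hpq : p ^ 2 + q ^ 2 = 1) :
    ∃ e : Module.Basis (Fin 6) ℝ V, (∀ i, J (e i) = sJ i • e (mJ i)) ∧
      ⇑e = ![f 0, f 1, f 2, f 3, p • f 4 + q • f 5, -q • f 4 + p • f 5] := by
  have := Module.Finite.of_basis f
  have hli : LinearIndependent ℝ
      ![f 0, f 1, f 2, f 3, p • f 4 + q • f 5, -q • f 4 + p • f 5] := by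
    rw [Fintype.linearIndependent_iff]
    intro c hc
    have hc' (j : Fin 6) := congrArg (f.coord j) hc
    have k0 := hc' 0; have k1 := hc' 1; have k2 := hc' 2
    have k3 := hc' 3; have k4 := hc' 4; have k5 := hc' 5
    simp [Fin.sum_univ_six, Finsupp.single_apply] at k0 k1 k2 k3 k4 k5
    have c4 : c 4 = 0 := by linear_combination p * k4 + q * k5 - c 4 * hpq
    have c5 : c 5 = 0 := by linear_combination p * k5 - q * k4 - c 5 * hpq
    intro i
    fin_cases i <;> assumption
  let e := basisOfLinearIndependentOfCardEqFinrank hli (by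
    rw [Module.finrank_eq_card_basis f])
  have he : ⇑e = ![f 0, f 1, f 2, f 3, p • f 4 + q • f 5, -q • f 4 + p • f 5] := by simp [e]
  refine ⟨e, fun i ↦ ?_, he⟩
  rw [he]
  fin_cases i <;> simp [sJ, sZ, mJ, hf] <;> abel

end IsSU3

theorem wedge_apply_of_eq_smul {α β : V [⋀^Fin 3]→ₗ[ℝ] ℝ} {γ : V [⋀^Fin 6]→ₗ[ℝ] ℝ} {c : ℝ}
    (h : wedge α β = c • γ) (v : Fin 6 → V) : wedge α β v = c * γ v := by
  rw [h]; rfl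

theorem compLinearMap_three {W : Type*} [AddCommGroup W] [Module ℝ W] (ψ : W [⋀^Fin 3]→ₗ[ℝ] ℝ) (J : V →ₗ[ℝ] W)
    (x y z : V) :
    ψ.compLinearMap J ![x, y, z] = ψ ![J x, J y, J z] := by
  have : (fun i ↦ J (![x, y, z] i)) = ![J x, J y, J z] := by
    ext l; fin_cases l <;> rfl
  rw [AlternatingMap.compLinearMap_apply, this]

theorem compLinearMap_two {W : Type*} [AddCommGroup W] [Module ℝ W] (α : W [⋀^Fin 2]→ₗ[ℝ] ℝ) (J : V →ₗ[ℝ] W)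
    (x y : V) :
    α.compLinearMap J ![x, y] = α ![J x, J y] := by
  have : (fun i ↦ J (![x, y] i)) = ![J x, J y] := by
    ext l; fin_cases l <;> rfl
  rw [AlternatingMap.compLinearMap_apply, this]

theorem cube_apply {f : Fin 6 → V} {ω : V [⋀^Fin 2]→ₗ[ℝ] ℝ} (hf : ∀ i j, ω ![f i, f j] = omC i j) :
    cube ω ![f 0, f 1, f 2, f 3, f 4, f 5] = 6 := by
  rw [cube, wedge_four_two]
  simp only [wedge_two_two, hf]
  simp [omC, omZ]
  norm_num

theorem IsAdapted.hat {f : Module.Basis (Fin 6) ℝ V} {ω : V [⋀^Fin 2]→ₗ[ℝ] ℝ}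
    {ψ : V [⋀^Fin 3]→ₗ[ℝ] ℝ} {J : V →ₗ[ℝ] V} (hf : IsAdapted f ω ψ J) (i j k : Fin 6) :
    ψ.compLinearMap J ![f i, f j, f k] = qsC i j k := by
  rw [compLinearMap_three, ← tril_apply]
  simp only [hf.cplx, map_smul, LinearMap.smul_apply, tril_apply, hf.psi, smul_eq_mul]
  linear_combination psC_cplx i j k

/-- Every `SU(3)`-structure on a vector space has an adapted basis. -/
theorem IsSU3.exists_adapted {b : Module.Basis (Fin 6) ℝ V} {ω : V [⋀^Fin 2]→ₗ[ℝ] ℝ}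
    {ψ : V [⋀^Fin 3]→ₗ[ℝ] ℝ} (h : IsSU3 b ω ψ) :
    ∃ f : Module.Basis (Fin 6) ℝ V, IsAdapted f ω ψ (SHF.cplx b ω ψ) := by
  obtain ⟨f, hJ, hg⟩ := h.exists_unitary_basis
  have hom (f : Module.Basis (Fin 6) ℝ V) (hJ : ∀ i, SHF.cplx b ω ψ (f i) = sJ i • f (mJ i))
      (hg : ∀ i j, metric b ω ψ (f i) (f j) = if i = j then 1 else 0) (i j : Fin 6) :
      ω ![f i, f j] = omC i j := by
    have := h.metric_cplx_right (f i) (f j)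
    rw [hJ, metric_eq, map_smul, ← metric_eq, hg] at this
    rw [← neg_eq_iff_eq_neg] at this
    rw [← this]
    fin_cases i <;> fin_cases j <;> simp [omC, omZ, mJ, sJ, sZ]
  have hψ (f : Module.Basis (Fin 6) ℝ V) (hJ : ∀ i, SHF.cplx b ω ψ (f i) = sJ i • f (mJ i)) :=
    (isAlt3_form ψ f).eq_of_type (fun i j k ↦ by
      have := h.psi_cplx (f i) (f j) (f k)
      simp only [← tril_apply, hJ, map_smul, LinearMap.smul_apply] at this
      exact this)
  -- In a unitary frame ψ has type (3,0)+(0,3), so it is p Re Ω + q Im Ω and differs from Re Ω by a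
  -- phase.
  set p := ψ ![f 0, f 2, f 4] with hp
  set q := ψ ![f 1, f 2, f 4] with hq
  have hψf (i j k : Fin 6) : ψ ![f i, f j, f k] = p * psC i j k + q * qsC i j k := hψ f hJ i j k
  have hhat (i j k : Fin 6) : SHF.hat b ω ψ ![f i, f j, f k] = p * qsC i j k - q * psC i j k := by
    rw [SHF.hat, compLinearMap_three, ← tril_apply]
    simp only [hJ, map_smul, LinearMap.smul_apply, tril_apply, hψf, smul_eq_mul]
    linear_combination p * psC_cplx i j k + q * qsC_cplx i j k
  -- On this frame ω³ equals 6, so the normalisation asks for 4, while ψ ∧ ψ̂ evaluates to 4(p² +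
  -- q²).
  have hpq : p ^ 2 + q ^ 2 = 1 := by
    have := wedge_apply_of_eq_smul h.normalized ![f 0, f 1, f 2, f 3, f 4, f 5]
    rw [cube_apply (hom f hJ hg), wedge_three_three] at this
    simp only [hψf, hhat] at this
    simp [psC, psZ, qsC, qsZ] at this
    linarith
  -- Rotating the last complex direction by the phase (p, q) makes ψ equal to 1 on (e₀, e₂, e₄) and
  -- 0 on (e₁, e₂, e₄); these two values determine a form of this type.
  obtain ⟨e, heJ, he⟩ := exists_rotated_basis f hJ hpq
  have e0 : e 0 = f 0 := by rw [he]; rfl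
  have e1 : e 1 = f 1 := by rw [he]; rfl
  have e2 : e 2 = f 2 := by rw [he]; rfl
  have e4 : e 4 = p • f 4 + q • f 5 := by rw [he]; rfl
  have heg (i j : Fin 6) : metric b ω ψ (e i) (e j) = if i = j then 1 else 0 := by
    have hg' : ∀ i j, (bil ω).compl₂ (SHF.cplx b ω ψ) (f i) (f j) = if i = j then 1 else 0 := hg
    rw [metric_eq, he]
    generalize (bil ω).compl₂ (SHF.cplx b ω ψ) = G at hg'
    fin_cases i <;> fin_cases j <;> simp [hg'] <;> first | linear_combination hpq | ring1
  refine ⟨e, heJ, hom e heJ heg, fun i j k ↦ ?_⟩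
  have h1 : ψ ![e 0, e 2, e 4] = 1 := by
    rw [← tril_apply, e0, e2, e4]
    simp only [map_add, map_smul, tril_apply, hψf]
    simp [psC, psZ, qsC, qsZ]
    linear_combination hpq
  have h2 : ψ ![e 1, e 2, e 4] = 0 := by
    rw [← tril_apply, e1, e2, e4]
    simp only [map_add, map_smul, tril_apply, hψf]
    simp [psC, psZ, qsC, qsZ]
    ring
  have := hψ e heJ i j k
  rw [h1, h2, one_mul, zero_mul, add_zero] at this
  exact this

end Adapted

/-! ### Curvature of a connection form and the Ricci identities -/

section Connection

variable {E : Type*} [NormedAddCommGroup E] [NormedSpace ℝ E]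
  {D : Type*} [NormedAddCommGroup D] [NormedSpace ℝ D]

theorem tril_apply_continuous (α : E [⋀^Fin 3]→L[ℝ] ℝ) (u v w : E) :
    tril α.toAlternatingMap u v w = α ![u, v, w] := rfl

theorem bil_apply_continuous (α : E [⋀^Fin 2]→L[ℝ] ℝ) (u v : E) :
    bil α.toAlternatingMap u v = α ![u, v] := rfl

theorem hasFDerivAt_three {α : D → E [⋀^Fin 3]→L[ℝ] ℝ} {y : D} (hα : DifferentiableAt ℝ α y)
    {V W X : D → E} {V' W' X' : D →L[ℝ] E} (hV : HasFDerivAt V V' y) (hW : HasFDerivAt W W' y)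
    (hX : HasFDerivAt X X' y) :
    DifferentiableAt ℝ (fun z ↦ α z ![V z, W z, X z]) y ∧
    ∀ u, fderiv ℝ (fun z ↦ α z ![V z, W z, X z]) y u =
      fderiv ℝ α y u ![V y, W y, X y] + α y ![V' u, W y, X y] + α y ![V y, W' u, X y]
        + α y ![V y, W y, X' u] := by
  have hd : ∀ i : Fin 3, DifferentiableAt ℝ (fun z ↦ ![V z, W z, X z] i) y := fun i ↦ by
    fin_cases i
    exacts [hV.differentiableAt, hW.differentiableAt, hX.differentiableAt]
  have e0 (u : D) : fderiv ℝ (fun z ↦ ![V z, W z, X z] 0) y u = V' u := by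
    rw [← hV.fderiv]; rfl
  have e1 (u : D) : fderiv ℝ (fun z ↦ ![V z, W z, X z] 1) y u = W' u := by
    rw [← hW.fderiv]; rfl
  have e2 (u : D) : fderiv ℝ (fun z ↦ ![V z, W z, X z] 2) y u = X' u := by
    rw [← hX.fderiv]; rfl
  refine ⟨hα.continuousAlternatingMap_apply hd, fun u ↦ ?_⟩
  refine (fderiv_continuousAlternatingMap_apply_apply hα hd u).trans ?_
  rw [Fin.sum_univ_three, e0, e1, e2, ← add_assoc, ← add_assoc]
  congr 5
  all_goals ext i; fin_cases i <;> rfl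

theorem hasFDerivAt_two {α : D → E [⋀^Fin 2]→L[ℝ] ℝ} {y : D} (hα : DifferentiableAt ℝ α y)
    {V W : D → E} {V' W' : D →L[ℝ] E} (hV : HasFDerivAt V V' y) (hW : HasFDerivAt W W' y) :
    DifferentiableAt ℝ (fun z ↦ α z ![V z, W z]) y ∧
    ∀ u, fderiv ℝ (fun z ↦ α z ![V z, W z]) y u =
      fderiv ℝ α y u ![V y, W y] + α y ![V' u, W y] + α y ![V y, W' u] := by
  have hd : ∀ i : Fin 2, DifferentiableAt ℝ (fun z ↦ ![V z, W z] i) y := fun i ↦ by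
    fin_cases i
    exacts [hV.differentiableAt, hW.differentiableAt]
  have e0 (u : D) : fderiv ℝ (fun z ↦ ![V z, W z] 0) y u = V' u := by
    rw [← hV.fderiv]; rfl
  have e1 (u : D) : fderiv ℝ (fun z ↦ ![V z, W z] 1) y u = W' u := by
    rw [← hW.fderiv]; rfl
  refine ⟨hα.continuousAlternatingMap_apply hd, fun u ↦ ?_⟩
  refine (fderiv_continuousAlternatingMap_apply_apply hα hd u).trans ?_
  rw [Fin.sum_univ_two, e0, e1, ← add_assoc]
  congr 4
  all_goals ext i; fin_cases i <;> rfl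

theorem hasFDerivAt_bilin {g : E → E →L[ℝ] E →L[ℝ] ℝ} {y : E} (hg : DifferentiableAt ℝ g y)
    {V W : E → E} {V' W' : E →L[ℝ] E} (hV : HasFDerivAt V V' y) (hW : HasFDerivAt W W' y) :
    DifferentiableAt ℝ (fun z ↦ g z (V z) (W z)) y ∧
    ∀ u, fderiv ℝ (fun z ↦ g z (V z) (W z)) y u =
      fderiv ℝ g y u (V y) (W y) + g y (V' u) (W y) + g y (V y) (W' u) := by
  have h := (hg.hasFDerivAt.clm_apply hV).clm_apply hW
  refine ⟨h.differentiableAt, fun u ↦ ?_⟩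
  rw [h.fderiv]
  simp
  ring

theorem hasFDerivAt_endo {A : E → E →L[ℝ] E} {y : E} (hA : DifferentiableAt ℝ A y)
    {V : E → E} {V' : E →L[ℝ] E} (hV : HasFDerivAt V V' y) :
    HasFDerivAt (fun z ↦ A z (V z)) (A y ∘SL V' + (fderiv ℝ A y).flip (V y)) y :=
  hA.hasFDerivAt.clm_apply hV

/-- The curvature of the connection with connection form `Γ`. -/
def riem (Γ : E → E →L[ℝ] E →L[ℝ] E) (y u v w : E) : E :=
  fderiv ℝ Γ y u v w - fderiv ℝ Γ y v u w + Γ y u (Γ y v w) - Γ y v (Γ y u w)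

theorem riem_swap (Γ : E → E →L[ℝ] E →L[ℝ] E) (y u v w : E) :
    riem Γ y u v w = -riem Γ y v u w := by
  simp only [riem]; abel

theorem riem_bianchi {Γ : E → E →L[ℝ] E →L[ℝ] E} {y : E} (hΓ : DifferentiableAt ℝ Γ y)
    (hs : ∀ᶠ z in 𝓝 y, ∀ u v, Γ z u v = Γ z v u) (u v w : E) :
    riem Γ y u v w + riem Γ y v w u + riem Γ y w u v = 0 := by
  have hd (u v w : E) : fderiv ℝ Γ y u v w = fderiv ℝ Γ y u w v := by
    have h1 (a b : E) : fderiv ℝ (fun z ↦ Γ z a b) y u = fderiv ℝ Γ y u a b := by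
      have := ((hΓ.hasFDerivAt.clm_apply (hasFDerivAt_const a y)).clm_apply
        (hasFDerivAt_const b y)).fderiv
      rw [this]; simp
    rw [← h1, ← h1]
    congr 1
    exact Filter.EventuallyEq.fderiv_eq (hs.mono fun z hz ↦ hz v w)
  have h0 := hs.self_of_nhds
  simp only [riem]
  rw [hd u v w, hd v w u, hd w u v, h0 v w, h0 w u, h0 u v, h0 u w, h0 v u, h0 w v]
  abel

set_option maxSynthPendingDepth 3

/-- The Ricci identity for a `2`-tensor `β` with covariant derivative `N`. -/
theorem ricci_identity_bilin {β : E → E →L[ℝ] E →L[ℝ] ℝ} {Γ : E → E →L[ℝ] E →L[ℝ] E} {y : E}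
    (hβ : ContDiffAt ℝ 2 β y) (hΓ : DifferentiableAt ℝ Γ y) {N : E → E → E → E → ℝ}
    (hN : ∀ᶠ z in 𝓝 y, ∀ u a b, fderiv ℝ β z u a b = N z u a b + β z (Γ z u a) b + β z a (Γ z u b))
    (u v a b : E) :
    (fderiv ℝ (fun z ↦ N z v a b) y u - N y v (Γ y u a) b - N y v a (Γ y u b)) -
      (fderiv ℝ (fun z ↦ N z u a b) y v - N y u (Γ y v a) b - N y u a (Γ y v b)) =
      -β y (riem Γ y u v a) b - β y a (riem Γ y u v b) := by
  have hβd : DifferentiableAt ℝ β y := hβ.differentiableAt (by norm_num)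
  have hβ' : DifferentiableAt ℝ (fderiv ℝ β) y :=
    (hβ.fderiv_right (m := 1) (by norm_num)).differentiableAt (by norm_num)
  have hsymm := (hβ.isSymmSndFDerivAt (by simp)).eq u v
  have hG (v a : E) := (hΓ.hasFDerivAt.clm_apply (hasFDerivAt_const v y)).clm_apply
    (hasFDerivAt_const a y)
  -- `N` is any expression that equals the covariant derivative near y, so a formula for ∇β in terms
  -- of the torsion may be differentiated directly. The second derivative of β produced here is
  -- symmetric in u and v and cancels in the commutator.
  have key (u v : E) : fderiv ℝ (fun z ↦ N z v a b) y u =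
      fderiv ℝ (fderiv ℝ β) y u v a b
        - (fderiv ℝ β y u (Γ y v a) b + β y (fderiv ℝ Γ y u v a) b)
        - (fderiv ℝ β y u a (Γ y v b) + β y a (fderiv ℝ Γ y u v b)) := by
    have e : (fun z ↦ N z v a b) =ᶠ[𝓝 y] fun z ↦
        fderiv ℝ β z v a b - β z (Γ z v a) b - β z a (Γ z v b) :=
      hN.mono fun z hz ↦ by simp only [hz]; ring
    rw [e.fderiv_eq]
    have h1 := ((hβ'.hasFDerivAt.clm_apply (hasFDerivAt_const v y)).clm_apply
      (hasFDerivAt_const a y)).clm_apply (hasFDerivAt_const b y)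
    have h2 := (hβd.hasFDerivAt.clm_apply (hG v a)).clm_apply (hasFDerivAt_const b y)
    have h3 := (hβd.hasFDerivAt.clm_apply (hasFDerivAt_const a y)).clm_apply (hG v b)
    rw [((h1.fun_sub h2).fun_sub h3).fderiv]
    simp
    ring
  have h0 := hN.self_of_nhds
  rw [key, key, hsymm, h0, h0, h0, h0]
  simp only [riem, map_add, map_sub, add_apply, sub_apply]
  ring

/-- The Ricci identity for a `3`-form `α` with covariant derivative `N`. -/
theorem ricci_identity_three {α : E → E [⋀^Fin 3]→L[ℝ] ℝ} {Γ : E → E →L[ℝ] E →L[ℝ] E} {y : E}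
    (hα : ContDiffAt ℝ 2 α y) (hΓ : DifferentiableAt ℝ Γ y) {N : E → E → E → E → E → ℝ}
    (hN : ∀ᶠ z in 𝓝 y, ∀ u a b c, fderiv ℝ α z u ![a, b, c] = N z u a b c
      + α z ![Γ z u a, b, c] + α z ![a, Γ z u b, c] + α z ![a, b, Γ z u c])
    (u v a b c : E) :
    (fderiv ℝ (fun z ↦ N z v a b c) y u - N y v (Γ y u a) b c - N y v a (Γ y u b) c
        - N y v a b (Γ y u c)) -
      (fderiv ℝ (fun z ↦ N z u a b c) y v - N y u (Γ y v a) b c - N y u a (Γ y v b) c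
        - N y u a b (Γ y v c)) =
      -α y ![riem Γ y u v a, b, c] - α y ![a, riem Γ y u v b, c]
        - α y ![a, b, riem Γ y u v c] := by
  have hαd : DifferentiableAt ℝ α y := hα.differentiableAt (by norm_num)
  have hα' : DifferentiableAt ℝ (fderiv ℝ α) y :=
    (hα.fderiv_right (m := 1) (by norm_num)).differentiableAt (by norm_num)
  have hsymm := (hα.isSymmSndFDerivAt (by simp)).eq u v
  have hc (a : E) := hasFDerivAt_const (𝕜 := ℝ) a y
  have hG (v a : E) := (hΓ.hasFDerivAt.clm_apply (hc v)).clm_apply (hc a)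
  have key (u v : E) : fderiv ℝ (fun z ↦ N z v a b c) y u =
      fderiv ℝ (fderiv ℝ α) y u v ![a, b, c]
        - (fderiv ℝ α y u ![Γ y v a, b, c] + α y ![fderiv ℝ Γ y u v a, b, c])
        - (fderiv ℝ α y u ![a, Γ y v b, c] + α y ![a, fderiv ℝ Γ y u v b, c])
        - (fderiv ℝ α y u ![a, b, Γ y v c] + α y ![a, b, fderiv ℝ Γ y u v c]) := by
    have e : (fun z ↦ N z v a b c) =ᶠ[𝓝 y] fun z ↦
        fderiv ℝ α z v ![a, b, c] - α z ![Γ z v a, b, c] - α z ![a, Γ z v b, c]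
          - α z ![a, b, Γ z v c] :=
      hN.mono fun z hz ↦ by simp only [hz]; ring
    rw [e.fderiv_eq]
    have h0 := hα'.hasFDerivAt.clm_apply (hc v)
    have h1 := hasFDerivAt_three h0.differentiableAt (hc a) (hc b) (hc c)
    have h2 := hasFDerivAt_three hαd (hG v a) (hc b) (hc c)
    have h3 := hasFDerivAt_three hαd (hc a) (hG v b) (hc c)
    have h4 := hasFDerivAt_three hαd (hc a) (hc b) (hG v c)
    rw [fderiv_fun_sub ((h1.1.fun_sub h2.1).fun_sub h3.1) h4.1,
      fderiv_fun_sub (h1.1.fun_sub h2.1) h3.1,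
      fderiv_fun_sub h1.1 h2.1]
    simp only [sub_apply]
    rw [h1.2, h2.2, h3.2, h4.2, h0.fderiv]
    have z1 (L : E [⋀^Fin 3]→L[ℝ] ℝ) (b c : E) : L ![0, b, c] = 0 := by
      rw [← tril_apply_continuous, map_zero]; rfl
    have z2 (L : E [⋀^Fin 3]→L[ℝ] ℝ) (b c : E) : L ![b, 0, c] = 0 := by
      rw [← tril_apply_continuous, map_zero]; rfl
    have z3 (L : E [⋀^Fin 3]→L[ℝ] ℝ) (b c : E) : L ![b, c, 0] = 0 := by
      rw [← tril_apply_continuous, map_zero]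
    simp [z1, z2, z3]
  have h0 := hN.self_of_nhds
  rw [key, key, hsymm, h0, h0, h0, h0, h0, h0]
  simp only [riem, ← tril_apply_continuous, map_add, map_sub, LinearMap.add_apply,
    LinearMap.sub_apply]
  ring

section Symmetries

variable {g : E → E →L[ℝ] E →L[ℝ] ℝ} {Γ : E → E →L[ℝ] E →L[ℝ] E} {y : E}

/-- The Ricci identity for the parallel tensor g, with `N = 0`. -/
theorem riem_skew (hg : ContDiffAt ℝ 2 g y) (hΓ : DifferentiableAt ℝ Γ y)
    (hN : ∀ᶠ z in 𝓝 y, ∀ u a b, fderiv ℝ g z u a b = g z (Γ z u a) b + g z a (Γ z u b))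
    (u v a b : E) : g y (riem Γ y u v a) b = -g y a (riem Γ y u v b) := by
  have := ricci_identity_bilin hg hΓ (N := fun _ _ _ _ ↦ 0)
    (hN.mono fun z hz u a b ↦ by rw [hz]; ring) u v a b
  simp at this
  linarith

/-- The classical octahedron argument: four instances of the Bianchi identity combine with skewness
in each pair. -/
theorem riem_pair_symm (hg : ContDiffAt ℝ 2 g y) (hΓ : DifferentiableAt ℝ Γ y)
    (hs : ∀ᶠ z in 𝓝 y, ∀ u v, Γ z u v = Γ z v u) (hgs : ∀ u v, g y u v = g y v u)
    (hN : ∀ᶠ z in 𝓝 y, ∀ u a b, fderiv ℝ g z u a b = g z (Γ z u a) b + g z a (Γ z u b))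
    (u v a b : E) : g y (riem Γ y u v a) b = g y (riem Γ y a b u) v := by
  have sk (u v a b : E) : g y (riem Γ y u v a) b = -g y (riem Γ y u v b) a := by
    rw [riem_skew hg hΓ hN, hgs]
  have sw (u v a b : E) : g y (riem Γ y u v a) b = -g y (riem Γ y v u a) b := by
    rw [riem_swap]; simp
  have bi (u v a b : E) : g y (riem Γ y u v a) b + g y (riem Γ y v a u) b
      + g y (riem Γ y a u v) b = 0 := by
    have := congrArg (fun x ↦ g y x b) (riem_bianchi hΓ hs u v a)
    simpa using this
  have b1 := bi u v a b
  have b2 := bi v a b u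
  have b3 := bi a b u v
  have b4 := bi b u v a
  have s1 := sk u v a b
  linarith [sk v a u b, sk a u v b, sk v a b u, sk a b v u, sk b v a u, sk a b u v, sk b u a v,
    sk u a b v, sk b u v a, sk u v b a, sk v b u a, sw u v a b, sw v a u b, sw a u v b, sw a b u v,
    sw b u a v, sw v b u a, sw b v a u, sw u a b v, sw a b v u]

end Symmetries

end Connection

set_option maxSynthPendingDepth 3

/-! ### The Levi-Civita connection in coordinates -/

section LeviCivita

local notation "E₆" => EuclideanSpace ℝ (Fin 6)

theorem contDiffAt_det {F : Type*} [NormedAddCommGroup F] [NormedSpace ℝ F] {n : WithTop ℕ∞} {m : ℕ}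
    {A : F → Matrix (Fin m) (Fin m) ℝ} {y : F} (hA : ∀ i j, ContDiffAt ℝ n (fun z ↦ A z i j) y) :
    ContDiffAt ℝ n (fun z ↦ (A z).det) y := by
  simp only [Matrix.det_apply']
  refine ContDiffAt.sum fun σ _ ↦ ?_
  exact contDiffAt_const.mul (contDiffAt_prod fun i _ ↦ hA _ _)

theorem contDiffAt_matrix_inv {F : Type*} [NormedAddCommGroup F] [NormedSpace ℝ F]
    {n : WithTop ℕ∞} {m : ℕ}
    {A : F → Matrix (Fin m) (Fin m) ℝ} {y : F} (hA : ∀ i j, ContDiffAt ℝ n (fun z ↦ A z i j) y)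
    (h0 : (A y).det ≠ 0) (i j : Fin m) : ContDiffAt ℝ n (fun z ↦ (A z)⁻¹ i j) y := by
  have e : (fun z ↦ (A z)⁻¹ i j) = fun z ↦ (A z).det⁻¹ * (A z).adjugate i j := by
    ext z
    rw [Matrix.inv_def, Ring.inverse_eq_inv', Matrix.smul_apply, smul_eq_mul]
  rw [e]
  refine ((contDiffAt_det hA).inv h0).mul ?_
  simp only [Matrix.adjugate_apply]
  refine contDiffAt_det fun k l ↦ ?_
  by_cases hk : k = j
  · subst hk
    simpa using contDiffAt_const
  · simpa [Matrix.updateRow_ne hk] using hA k l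

theorem euclidean_sum_single (v : E₆) : v = ∑ i, v i • EuclideanSpace.single i (1 : ℝ) := by
  have := (EuclideanSpace.basisFun (Fin 6) ℝ).sum_repr v
  simpa using this.symm

/-- Entries of a bilinear form in the standard basis of `ℝ⁶`. -/
def entries (g : E₆ → E₆ →L[ℝ] E₆ →L[ℝ] ℝ) (z : E₆) : Matrix (Fin 6) (Fin 6) ℝ :=
  Matrix.of fun i j ↦ g z (EuclideanSpace.single i 1) (EuclideanSpace.single j 1)

theorem entries_det_ne_zero {g : E₆ → E₆ →L[ℝ] E₆ →L[ℝ] ℝ} {z : E₆}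
    (hnd : ∀ v, (∀ w, g z v w = 0) → v = 0) : (entries g z).det ≠ 0 := by
  intro h
  obtain ⟨c, hc, hcz⟩ := Matrix.exists_vecMul_eq_zero_iff.2 h
  apply hc
  have hv := hnd (∑ i, c i • EuclideanSpace.single i (1 : ℝ)) (fun w ↦ by
    rw [euclidean_sum_single w]
    simp only [map_sum, map_smul, sum_apply, smul_apply]
    refine Finset.sum_eq_zero fun j _ ↦ ?_
    have := congrFun hcz j
    simp only [Matrix.vecMul, dotProduct, entries, Matrix.of_apply, Pi.zero_apply] at this
    simp only [smul_eq_mul, this, mul_zero])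
  ext i
  have := congrArg (fun v : E₆ ↦ v i) hv
  simpa [Pi.single_apply] using this

variable {g : E₆ → E₆ →L[ℝ] E₆ →L[ℝ] ℝ} {U : Set E₆}

/-- The connection form of the Levi-Civita connection. -/
def leviCivita (g : E₆ → E₆ →L[ℝ] E₆ →L[ℝ] ℝ) (z : E₆) : E₆ →L[ℝ] E₆ →L[ℝ] E₆ :=
  ∑ i, ∑ j, ∑ k, christoffel (entries g) k i j z •
    (EuclideanSpace.proj i : E₆ →L[ℝ] ℝ).smulRight
      ((EuclideanSpace.proj j : E₆ →L[ℝ] ℝ).smulRight (EuclideanSpace.single k (1 : ℝ)))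

theorem leviCivita_single (z : E₆) (i j k : Fin 6) :
    leviCivita g z (EuclideanSpace.single i 1) (EuclideanSpace.single j 1) k =
      christoffel (entries g) k i j z := by
  simp [leviCivita, sum_apply, Pi.single_apply, Finset.sum_ite_eq]

theorem contDiffAt_christoffel {z : E₆} (hg : ContDiffAt ℝ ((⊤ : ℕ∞) : WithTop ℕ∞) g z)
    (hnd : ∀ v, (∀ w, g z v w = 0) → v = 0) (k i j : Fin 6) :
    ContDiffAt ℝ ((⊤ : ℕ∞) : WithTop ℕ∞) (christoffel (entries g) k i j) z := by
  have he (i j : Fin 6) : ContDiffAt ℝ ((⊤ : ℕ∞) : WithTop ℕ∞) (fun z ↦ entries g z i j) z :=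
    (hg.clm_apply contDiffAt_const).clm_apply contDiffAt_const
  have hd (l i j : Fin 6) : ContDiffAt ℝ ((⊤ : ℕ∞) : WithTop ℕ∞)
      (partialDeriv l (fun z ↦ entries g z i j)) z :=
    ((he i j).fderiv_right (by simp)).clm_apply contDiffAt_const
  unfold christoffel
  exact contDiffAt_const.mul (ContDiffAt.sum fun l _ ↦
    (contDiffAt_matrix_inv he (entries_det_ne_zero hnd) k l).mul
      (((hd _ _ _).add (hd _ _ _)).sub (hd _ _ _)))

theorem contDiffAt_leviCivita {z : E₆} (hg : ContDiffAt ℝ ((⊤ : ℕ∞) : WithTop ℕ∞) g z)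
    (hnd : ∀ v, (∀ w, g z v w = 0) → v = 0) :
    ContDiffAt ℝ ((⊤ : ℕ∞) : WithTop ℕ∞) (leviCivita g) z := by
  unfold leviCivita
  exact ContDiffAt.sum fun i _ ↦ ContDiffAt.sum fun j _ ↦ ContDiffAt.sum fun k _ ↦
    (contDiffAt_christoffel hg hnd k i j).smul contDiffAt_const

theorem ext_single₂ {F : Type*} [AddCommGroup F] [Module ℝ F] [TopologicalSpace F]
    [IsTopologicalAddGroup F] [ContinuousSMul ℝ F] {A B : E₆ →L[ℝ] E₆ →L[ℝ] F} 
    (h : ∀ i j, A (EuclideanSpace.single i 1) (EuclideanSpace.single j 1) =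
      B (EuclideanSpace.single i 1) (EuclideanSpace.single j 1)) : A = B := by
  ext u v
  rw [euclidean_sum_single u, euclidean_sum_single v]
  simp only [map_sum, map_smul, sum_apply, smul_apply, h]

theorem entries_symm (hU : IsOpen U) (hgs : ∀ z ∈ U, ∀ u v, g z u v = g z v u) {z : E₆} (hz : z ∈ U)
    (l i j : Fin 6) : partialDeriv l (fun z ↦ entries g z i j) z =
      partialDeriv l (fun z ↦ entries g z j i) z := by
  simp only [partialDeriv]
  congr 1
  exact Filter.EventuallyEq.fderiv_eq (Filter.mem_of_superset (hU.mem_nhds hz)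
    fun x hx ↦ hgs x hx _ _)

theorem leviCivita_symm (hU : IsOpen U) (hgs : ∀ z ∈ U, ∀ u v, g z u v = g z v u) {z : E₆}
    (hz : z ∈ U) (u v : E₆) : leviCivita g z u v = leviCivita g z v u := by
  have : leviCivita g z = (leviCivita g z).flip := ext_single₂ fun i j ↦ by
    ext k
    rw [ContinuousLinearMap.flip_apply, leviCivita_single, leviCivita_single]
    simp only [christoffel]
    congr 1
    refine Finset.sum_congr rfl fun l _ ↦ ?_
    rw [entries_symm hU hgs hz l i j]
    ring
  exact congrArg (fun L ↦ L u v) this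

/-- Metric compatibility by the Koszul formula. By linearity it is enough to treat coordinate
vectors, where the three derivatives of the metric in the two Christoffel terms cancel in pairs. -/
theorem leviCivita_metric (hU : IsOpen U) (hg : ∀ z ∈ U, ContDiffAt ℝ ((⊤ : ℕ∞) : WithTop ℕ∞) g z)
    (hnd : ∀ z ∈ U, ∀ v, (∀ w, g z v w = 0) → v = 0)
    (hgs : ∀ z ∈ U, ∀ u v, g z u v = g z v u) {z : E₆} (hz : z ∈ U) (u v w : E₆) :
    fderiv ℝ g z u v w = g z (leviCivita g z u v) w + g z v (leviCivita g z u w) := by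
  have hd (l i j : Fin 6) : fderiv ℝ g z (EuclideanSpace.single l 1) (EuclideanSpace.single i 1)
      (EuclideanSpace.single j 1) = partialDeriv l (fun z ↦ entries g z i j) z := by
    have := (((hg z hz).differentiableAt (by simp)).hasFDerivAt.clm_apply
      (hasFDerivAt_const (EuclideanSpace.single i (1 : ℝ)) z)).clm_apply
      (hasFDerivAt_const (EuclideanSpace.single j (1 : ℝ)) z)
    simp only [partialDeriv, entries, Matrix.of_apply]
    rw [this.fderiv]
    simp
  -- Lowering the upper index of the Christoffel symbol cancels the inverse Gram matrix.
  have hl (i j m : Fin 6) : g z (leviCivita g z (EuclideanSpace.single i 1)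
      (EuclideanSpace.single j 1)) (EuclideanSpace.single m 1) = (1 / 2) *
      (partialDeriv i (fun z ↦ entries g z j m) z + partialDeriv j (fun z ↦ entries g z i m) z
      - partialDeriv m (fun z ↦ entries g z i j) z) := by
    have hinv : entries g z * (entries g z)⁻¹ = 1 :=
      Matrix.mul_nonsing_inv _ (isUnit_iff_ne_zero.2 (entries_det_ne_zero (hnd z hz)))
    rw [euclidean_sum_single (leviCivita g z (EuclideanSpace.single i 1)
      (EuclideanSpace.single j 1))]
    simp only [leviCivita_single, map_sum, map_smul, sum_apply, smul_apply,
      christoffel, smul_eq_mul]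
    set c : Fin 6 → ℝ := fun l ↦ partialDeriv i (fun z ↦ entries g z j l) z
      + partialDeriv j (fun z ↦ entries g z i l) z - partialDeriv l (fun z ↦ entries g z i j) z
    have h1 (k : Fin 6) : g z (EuclideanSpace.single k 1) (EuclideanSpace.single m 1) =
        entries g z m k := hgs z hz _ _
    simp only [h1]
    have h2 : ∑ k, (∑ l, (entries g z)⁻¹ k l * c l) * entries g z m k = c m := by
      calc _ = ((entries g z).mulVec ((entries g z)⁻¹.mulVec c)) m := by
            simp only [Matrix.mulVec, dotProduct]
            exact Finset.sum_congr rfl fun k _ ↦ mul_comm _ _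
        _ = c m := by rw [Matrix.mulVec_mulVec, hinv, Matrix.one_mulVec]
    refine Eq.trans ?_ (congrArg ((1 / 2 : ℝ) * ·) h2)
    simp only [Finset.mul_sum (s := Finset.univ) (a := (1 / 2 : ℝ))
      (f := fun k ↦ (∑ l, (entries g z)⁻¹ k l * c l) * entries g z m k)]
    refine Finset.sum_congr rfl fun k _ ↦ ?_
    ring
  have key (u : E₆) : fderiv ℝ g z u = (g z).bilinearComp (leviCivita g z u) (.id ℝ E₆) +
      (g z).bilinearComp (.id ℝ E₆) (leviCivita g z u) := by
    rw [euclidean_sum_single u]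
    refine ext_single₂ fun i j ↦ ?_
    simp only [map_sum, map_smul, sum_apply, smul_apply, add_apply,
      ContinuousLinearMap.bilinearComp_apply, ContinuousLinearMap.id_apply]
    rw [← Finset.sum_add_distrib]
    refine Finset.sum_congr rfl fun l _ ↦ ?_
    rw [hd, hl, hgs z hz (EuclideanSpace.single i 1), hl, ← smul_add]
    congr 1
    rw [entries_symm hU hgs hz l j i, entries_symm hU hgs hz i l j, entries_symm hU hgs hz j l i]
    ring
  exact congrArg (fun L ↦ L v w) (key u)

/-- Fixes the convention: the coordinate formula is the trace over x of R(x, e_j) e_i. The order of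
the lower indices is reconciled by the symmetry of the Christoffel symbols. -/
theorem ricciCoord_eq (hU : IsOpen U) (hg : ∀ z ∈ U, ContDiffAt ℝ ((⊤ : ℕ∞) : WithTop ℕ∞) g z)
    (hnd : ∀ z ∈ U, ∀ v, (∀ w, g z v w = 0) → v = 0)
    (hgs : ∀ z ∈ U, ∀ u v, g z u v = g z v u) {z : E₆} (hz : z ∈ U) (i j : Fin 6) :
    ricciCoord (entries g) i j z = ∑ k, riem (leviCivita g) z (EuclideanSpace.single k 1)
      (EuclideanSpace.single j 1) (EuclideanSpace.single i 1) k := by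
  have hΓ := (contDiffAt_leviCivita (hg z hz) (hnd z hz)).differentiableAt (by simp)
  have hd (l i j k : Fin 6) : fderiv ℝ (leviCivita g) z (EuclideanSpace.single l 1)
      (EuclideanSpace.single i 1) (EuclideanSpace.single j 1) k =
      partialDeriv l (christoffel (entries g) k i j) z := by
    have := (((EuclideanSpace.proj k : E₆ →L[ℝ] ℝ).hasFDerivAt).comp z
      ((hΓ.hasFDerivAt.clm_apply (hasFDerivAt_const (EuclideanSpace.single i (1 : ℝ)) z)).clm_apply
      (hasFDerivAt_const (EuclideanSpace.single j (1 : ℝ)) z))).fderiv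
    have e : christoffel (entries g) k i j = (EuclideanSpace.proj k : E₆ →L[ℝ] ℝ) ∘ fun z ↦
        leviCivita g z (EuclideanSpace.single i 1) (EuclideanSpace.single j 1) := by
      ext z
      simp [leviCivita_single]
    rw [partialDeriv, e, this]
    simp
  have hc (x : E₆) (l k : Fin 6) : leviCivita g z (EuclideanSpace.single l 1) x k =
      ∑ m, christoffel (entries g) k l m z * x m := by
    conv_lhs => rw [euclidean_sum_single x]
    simp [leviCivita_single, mul_comm]
  have hs (k i j : Fin 6) : christoffel (entries g) k i j z = christoffel (entries g) k j i z := by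
    rw [← leviCivita_single, ← leviCivita_single, leviCivita_symm hU hgs hz]
  have hs' (k i j l : Fin 6) : partialDeriv l (christoffel (entries g) k i j) z =
      partialDeriv l (christoffel (entries g) k j i) z := by
    simp only [partialDeriv]
    congr 1
    refine Filter.EventuallyEq.fderiv_eq (Filter.mem_of_superset (hU.mem_nhds hz) fun x hx ↦ ?_)
    show christoffel _ _ _ _ _ = christoffel _ _ _ _ _
    rw [← leviCivita_single, ← leviCivita_single, leviCivita_symm hU hgs hx]
  simp only [ricciCoord, riem, PiLp.sub_apply, PiLp.add_apply, hd, hc, leviCivita_single]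
  refine Finset.sum_congr rfl fun k _ ↦ ?_
  rw [Finset.sum_sub_distrib, hs' k i j, hs' k i k, ← add_sub_assoc]
  simp [hs _ i j, hs _ i k, Pi.single_apply]

end LeviCivita

/-! ### Smooth dependence of J, ψ̂ and g on ω and ψ -/

section Smooth

local notation "E₆" => EuclideanSpace ℝ (Fin 6)

/-- The standard basis of `ℝ⁶`. -/
def stdBasis : Module.Basis (Fin 6) ℝ E₆ := (EuclideanSpace.basisFun (Fin 6) ℝ).toBasis

@[simp]
theorem stdBasis_apply (i : Fin 6) : stdBasis i = EuclideanSpace.single i (1 : ℝ) := by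
  simp [stdBasis]

instance finiteDimensional_form (k : ℕ) : FiniteDimensional ℝ (E₆ [⋀^Fin k]→L[ℝ] ℝ) := by
  let L : (E₆ [⋀^Fin k]→L[ℝ] ℝ) →ₗ[ℝ] MultilinearMap ℝ (fun _ : Fin k ↦ E₆) ℝ :=
    { toFun := fun α ↦ α.toMultilinearMap
      map_add' := fun _ _ ↦ rfl
      map_smul' := fun _ _ ↦ rfl }
  refine FiniteDimensional.of_injective L fun α β h ↦ ?_
  ext v
  exact congrArg (fun F ↦ F v) h

variable {D : Type*} [NormedAddCommGroup D] [NormedSpace ℝ D] {n : WithTop ℕ∞} {z : D}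

/-- Evaluation on basis tuples is an injective linear map of finite-dimensional spaces, so it has a
linear, hence smooth, left inverse. -/
theorem contDiffAt_form_of_basis {k : ℕ} {α : D → E₆ [⋀^Fin k]→L[ℝ] ℝ}
    (h : ∀ r : Fin k → Fin 6, ContDiffAt ℝ n (fun y ↦ α y fun i ↦ stdBasis (r i)) z) :
    ContDiffAt ℝ n α z := by
  let L : (E₆ [⋀^Fin k]→L[ℝ] ℝ) →ₗ[ℝ] ((Fin k → Fin 6) → ℝ) :=
    { toFun := fun α r ↦ α fun i ↦ stdBasis (r i)
      map_add' := fun _ _ ↦ rfl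
      map_smul' := fun _ _ ↦ rfl }
  have hL : LinearMap.ker L = ⊥ := by
    rw [LinearMap.ker_eq_bot]
    intro α β h
    apply ContinuousAlternatingMap.toAlternatingMap_injective
    exact stdBasis.ext_alternating fun r _ ↦ congrFun h r
  obtain ⟨P, hP⟩ := LinearMap.exists_leftInverse_of_injective L hL
  have e : α = fun y ↦ LinearMap.toContinuousLinearMap P (L (α y)) := by
    ext1 y
    exact (congrArg (fun F ↦ F (α y)) hP).symm
  rw [e]
  exact (LinearMap.toContinuousLinearMap P).contDiff.contDiffAt.comp z (contDiffAt_pi.2 h)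

theorem contDiffAt_form_apply {k : ℕ} {α : D → E₆ [⋀^Fin k]→L[ℝ] ℝ} {V : Fin k → D → E₆}
    (hα : ContDiffAt ℝ n α z) (hV : ∀ i, ContDiffAt ℝ n (V i) z) :
    ContDiffAt ℝ n (fun y ↦ α y fun i ↦ V i y) z := by
  have hc (c : Fin k → E₆) : ContDiffAt ℝ n (fun y ↦ α y c) z := by
    let L : (E₆ [⋀^Fin k]→L[ℝ] ℝ) →ₗ[ℝ] ℝ :=
      { toFun := fun α ↦ α c
        map_add' := fun _ _ ↦ rfl
        map_smul' := fun _ _ ↦ rfl }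
    exact (LinearMap.toContinuousLinearMap L).contDiff.contDiffAt.comp z hα
  have e : (fun y ↦ α y fun i ↦ V i y) = fun y ↦ ∑ r : Fin k → Fin 6,
      (∏ i, V i y (r i)) * α y fun i ↦ stdBasis (r i) := by
    ext y
    have h1 : (fun i ↦ V i y) = fun i ↦ ∑ j, V i y j • stdBasis j := by
      ext1 i
      conv_lhs => rw [euclidean_sum_single (V i y)]
      simp
    rw [h1]
    refine ((α y).toMultilinearMap.map_sum _).trans (Finset.sum_congr rfl fun r _ ↦ ?_)
    exact (α y).toMultilinearMap.map_smul_univ _ _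
  rw [e]
  refine ContDiffAt.sum fun r _ ↦ (contDiffAt_prod fun i _ ↦ ?_).mul (hc _)
  exact contDiffAt_euclidean.1 (hV i) (r i)

theorem contDiffAt_two_apply {α : D → E₆ [⋀^Fin 2]→L[ℝ] ℝ} {V W : D → E₆}
    (hα : ContDiffAt ℝ n α z) (hV : ContDiffAt ℝ n V z) (hW : ContDiffAt ℝ n W z) :
    ContDiffAt ℝ n (fun y ↦ α y ![V y, W y]) z := by
  have := contDiffAt_form_apply (V := ![V, W]) hα (fun i ↦ by fin_cases i <;> assumption)
  convert! this using 3 with y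
  ext i : 1; fin_cases i <;> rfl

theorem contDiffAt_three_apply {α : D → E₆ [⋀^Fin 3]→L[ℝ] ℝ} {V W X : D → E₆}
    (hα : ContDiffAt ℝ n α z) (hV : ContDiffAt ℝ n V z) (hW : ContDiffAt ℝ n W z)
    (hX : ContDiffAt ℝ n X z) :
    ContDiffAt ℝ n (fun y ↦ α y ![V y, W y, X y]) z := by
  have := contDiffAt_form_apply (V := ![V, W, X]) hα (fun i ↦ by fin_cases i <;> assumption)
  convert! this using 3 with y
  ext i : 1; fin_cases i <;> rfl

theorem contDiffAt_clm_of_apply {F : Type*} [NormedAddCommGroup F] [NormedSpace ℝ F]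
    {A : D → E₆ →L[ℝ] F} (h : ∀ v, ContDiffAt ℝ n (fun y ↦ A y v) z) : ContDiffAt ℝ n A z := by
  have e : A = fun y ↦ ∑ i, (EuclideanSpace.proj i : E₆ →L[ℝ] ℝ).smulRight (A y (stdBasis i)) := by
    ext y v
    conv_lhs => rw [euclidean_sum_single v]
    simp [sum_apply]
  rw [e]
  refine ContDiffAt.sum fun i _ ↦ ?_
  exact ((ContinuousLinearMap.smulRightL ℝ E₆ F (EuclideanSpace.proj i)).contDiff).contDiffAt.comp z
    (h (stdBasis i))

/-- The complex structure of an `SU(3)`-structure on `ℝ⁶`, as a continuous linear map. -/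
def cplxL (ω : E₆ [⋀^Fin 2]→L[ℝ] ℝ) (ψ : E₆ [⋀^Fin 3]→L[ℝ] ℝ) : E₆ →L[ℝ] E₆ :=
  LinearMap.toContinuousLinearMap (cplx stdBasis ω.toAlternatingMap ψ.toAlternatingMap)

/-- The `3`-form `ψ̂`, as a continuous form. -/
def hatL (ω : E₆ [⋀^Fin 2]→L[ℝ] ℝ) (ψ : E₆ [⋀^Fin 3]→L[ℝ] ℝ) : E₆ [⋀^Fin 3]→L[ℝ] ℝ :=
  ψ.compContinuousLinearMap (cplxL ω ψ)

theorem hatL_apply (ω : E₆ [⋀^Fin 2]→L[ℝ] ℝ) (ψ : E₆ [⋀^Fin 3]→L[ℝ] ℝ) (u v w : E₆) :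
    hatL ω ψ ![u, v, w] = ψ ![cplxL ω ψ u, cplxL ω ψ v, cplxL ω ψ w] :=
  compLinearMap_three ψ.toAlternatingMap (cplxL ω ψ).toLinearMap u v w

/-- The metric of an `SU(3)`-structure on `ℝ⁶`, as a continuous bilinear map. -/
def metricL (ω : E₆ [⋀^Fin 2]→L[ℝ] ℝ) (ψ : E₆ [⋀^Fin 3]→L[ℝ] ℝ) : E₆ →L[ℝ] E₆ →L[ℝ] ℝ :=
  LinearMap.toContinuousLinearMap (LinearMap.toContinuousLinearMap.toLinearMap ∘ₗ
    (bil ω.toAlternatingMap).compl₂ (cplxL ω ψ).toLinearMap)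

theorem metricL_apply (ω : E₆ [⋀^Fin 2]→L[ℝ] ℝ) (ψ : E₆ [⋀^Fin 3]→L[ℝ] ℝ) (v w : E₆) :
    metricL ω ψ v w = ω ![v, cplxL ω ψ w] := rfl

/-- ω³ is six times a Pfaffian, an explicit polynomial. This gives both the smoothness of the volume
form and its derivative. -/
theorem cube_eq_pfaffian {V : Type*} [AddCommGroup V] [Module ℝ V] (ω : V [⋀^Fin 2]→ₗ[ℝ] ℝ)
    (a b c d e f : V) : cube ω ![a, b, c, d, e, f] =
      6 * (ω ![a, b] * (ω ![c, d] * ω ![e, f] - ω ![c, e] * ω ![d, f] + ω ![c, f] * ω ![d, e])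
      - ω ![a, c] * (ω ![b, d] * ω ![e, f] - ω ![b, e] * ω ![d, f] + ω ![b, f] * ω ![d, e])
      + ω ![a, d] * (ω ![b, c] * ω ![e, f] - ω ![b, e] * ω ![c, f] + ω ![b, f] * ω ![c, e])
      - ω ![a, e] * (ω ![b, c] * ω ![d, f] - ω ![b, d] * ω ![c, f] + ω ![b, f] * ω ![c, d])
      + ω ![a, f] * (ω ![b, c] * ω ![d, e] - ω ![b, d] * ω ![c, e] + ω ![b, e] * ω ![c, d])) := by
  rw [cube, wedge_four_two]
  simp only [wedge_two_two]
  ring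

theorem contDiffAt_endoComp {r : D → Fin 6 → Fin 6 → Fin 6 → ℝ}
    (h : ∀ i j k, ContDiffAt ℝ n (fun y ↦ r y i j k) z) (i j : Fin 6) :
    ContDiffAt ℝ n (fun y ↦ endoComp (r y) i j) z := by
  have hw (a b c d e f : Fin 6) : ContDiffAt ℝ n (fun y ↦ wedgeTwoThree (r y) a b c d e f) z := by
    unfold wedgeTwoThree
    fun_prop
  fin_cases j <;> simp only [endoComp] <;> first | exact hw _ _ _ _ _ _ | exact (hw _ _ _ _ _ _).neg

variable {ω : D → E₆ [⋀^Fin 2]→L[ℝ] ℝ} {ψ : D → E₆ [⋀^Fin 3]→L[ℝ] ℝ}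

theorem contDiffAt_volForm (hω : ContDiffAt ℝ n ω z) :
    ContDiffAt ℝ n (fun y ↦ volForm (ω y).toAlternatingMap stdBasis) z := by
  have h (u v : E₆) : ContDiffAt ℝ n (fun y ↦ (ω y).toAlternatingMap ![u, v]) z :=
    contDiffAt_two_apply hω contDiffAt_const contDiffAt_const
  simp only [volForm, AlternatingMap.smul_apply, apply_six _ stdBasis, cube_eq_pfaffian, smul_eq_mul]
  fun_prop

theorem contDiffAt_endo (hω : ContDiffAt ℝ n ω z) (hψ : ContDiffAt ℝ n ψ z)
    (h : ∀ᶠ y in 𝓝 z, IsSU3 stdBasis (ω y).toAlternatingMap (ψ y).toAlternatingMap) :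
    ContDiffAt ℝ n (fun y ↦ LinearMap.toContinuousLinearMap
      (endo stdBasis (volForm (ω y).toAlternatingMap) (ψ y).toAlternatingMap)) z := by
  have hψ' (u v w : E₆) : ContDiffAt ℝ n (fun y ↦ (ψ y).toAlternatingMap ![u, v, w]) z :=
    contDiffAt_three_apply hψ contDiffAt_const contDiffAt_const contDiffAt_const
  have hv : volForm (ω z).toAlternatingMap stdBasis ≠ 0 :=
    apply_basis_ne_zero _ h.self_of_nhds.volForm_ne_zero
  have hb (i : Fin 6) : ContDiffAt ℝ n (fun y ↦ 
      endo stdBasis (volForm (ω y).toAlternatingMap) (ψ y).toAlternatingMap (stdBasis i)) z := by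
    refine ContDiffAt.congr_of_eventuallyEq (f := fun y ↦ ∑ j,
      ((volForm (ω y).toAlternatingMap stdBasis)⁻¹ * endoComp (fun i j k ↦
        (ψ y).toAlternatingMap ![stdBasis i, stdBasis j, stdBasis k]) i j) • stdBasis j) ?_
      (h.mono fun y hy ↦ endo_apply_basis _ hy.volForm_ne_zero _ _ _)
    exact ContDiffAt.sum fun j _ ↦ (((contDiffAt_volForm hω).inv hv).mul
      (contDiffAt_endoComp (fun _ _ _ ↦ hψ' _ _ _) i j)).smul contDiffAt_const
  refine contDiffAt_clm_of_apply fun v ↦ ?_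
  rw [euclidean_sum_single v]
  simp only [map_sum, map_smul, ← stdBasis_apply]
  exact ContDiffAt.sum fun j _ ↦ (contDiffAt_const (c := v j)).smul (hb j)

theorem contDiffAt_cplxL (hω : ContDiffAt ℝ n ω z) (hψ : ContDiffAt ℝ n ψ z)
    (h : ∀ᶠ y in 𝓝 z, IsSU3 stdBasis (ω y).toAlternatingMap (ψ y).toAlternatingMap) :
    ContDiffAt ℝ n (fun y ↦ cplxL (ω y) (ψ y)) z := by
  have hS := contDiffAt_endo hω hψ h
  have hq : ContDiffAt ℝ n (fun y ↦ quartic stdBasis (volForm (ω y).toAlternatingMap)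
      (ψ y).toAlternatingMap) z := by
    -- Since S² = P Id, the invariant P is the first coordinate of S²e₀, which is visibly smooth.
    refine ContDiffAt.congr_of_eventuallyEq ?_ (h.mono fun y hy ↦ ?_)
      (f := fun y ↦ (LinearMap.toContinuousLinearMap
      (endo stdBasis (volForm (ω y).toAlternatingMap) (ψ y).toAlternatingMap)
        (LinearMap.toContinuousLinearMap
      (endo stdBasis (volForm (ω y).toAlternatingMap) (ψ y).toAlternatingMap) (stdBasis 0))) 0)
    · exact contDiffAt_euclidean.1 (hS.clm_apply (hS.clm_apply contDiffAt_const)) 0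
    · have := congrArg (fun v : E₆ ↦ v 0)
        (endo_endo stdBasis hy.volForm_ne_zero (ψ y).toAlternatingMap (stdBasis 0))
      simpa using this.symm
  have h0 := h.self_of_nhds
  have : ContDiffAt ℝ n (fun y ↦ (√(-quartic stdBasis (volForm (ω y).toAlternatingMap)
      (ψ y).toAlternatingMap))⁻¹ • LinearMap.toContinuousLinearMap
      (endo stdBasis (volForm (ω y).toAlternatingMap) (ψ y).toAlternatingMap)) z :=
    ((hq.neg.sqrt (neg_ne_zero.2 h0.stable.ne)).inv h0.sqrt_pos.ne').smul hS
  convert! this using 2 with y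

theorem contDiffAt_hatL (hω : ContDiffAt ℝ n ω z) (hψ : ContDiffAt ℝ n ψ z)
    (h : ∀ᶠ y in 𝓝 z, IsSU3 stdBasis (ω y).toAlternatingMap (ψ y).toAlternatingMap) :
    ContDiffAt ℝ n (fun y ↦ hatL (ω y) (ψ y)) z := by
  have hJ := contDiffAt_cplxL hω hψ h
  refine contDiffAt_form_of_basis fun r ↦ ?_
  exact contDiffAt_form_apply (V := fun i y ↦ cplxL (ω y) (ψ y) (stdBasis (r i))) hψ
    fun i ↦ hJ.clm_apply contDiffAt_const

theorem contDiffAt_metricL (hω : ContDiffAt ℝ n ω z) (hψ : ContDiffAt ℝ n ψ z)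
    (h : ∀ᶠ y in 𝓝 z, IsSU3 stdBasis (ω y).toAlternatingMap (ψ y).toAlternatingMap) :
    ContDiffAt ℝ n (fun y ↦ metricL (ω y) (ψ y)) z := by
  have hJ := contDiffAt_cplxL hω hψ h
  exact contDiffAt_clm_of_apply fun v ↦ contDiffAt_clm_of_apply fun w ↦
    contDiffAt_two_apply hω contDiffAt_const (hJ.clm_apply contDiffAt_const)

end Smooth

/-! ### Linear algebra of the first-order equations -/

section FirstOrderAlgebra

theorem IsAlt2.ext_sorted {a b : Fin 6 → Fin 6 → ℝ} (ha : IsAlt2 a) (hb : IsAlt2 b)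
    (h : a 0 1 = b 0 1 ∧ a 0 2 = b 0 2 ∧ a 0 3 = b 0 3 ∧ a 0 4 = b 0 4 ∧ a 0 5 = b 0 5 ∧
      a 1 2 = b 1 2 ∧ a 1 3 = b 1 3 ∧ a 1 4 = b 1 4 ∧ a 1 5 = b 1 5 ∧ a 2 3 = b 2 3 ∧
      a 2 4 = b 2 4 ∧ a 2 5 = b 2 5 ∧ a 3 4 = b 3 4 ∧ a 3 5 = b 3 5 ∧ a 4 5 = b 4 5)
    (i j : Fin 6) : a i j = b i j := by
  obtain ⟨h1, h2, h3, h4, h5, h6, h7, h8, h9, h10, h11, h12, h13, h14, h15⟩ := h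
  have key (i j : Fin 6) (hij : i < j) : a i j = b i j := by
    fin_cases i <;> fin_cases j <;> first | exact absurd hij (by decide) | assumption
  rcases lt_trichotomy i j with hij | rfl | hij
  · exact key i j hij
  · rw [ha.rules.1, hb.rules.1]
  · rw [ha, hb, key j i hij]

/-- A `2`-form anticommuting with the complex structure is the contraction of the imaginary part of
the complex volume form with a vector. -/
theorem IsAlt2.eq_contraction {e : Fin 6 → Fin 6 → ℝ} (h : IsAlt2 e)
    (hJ : ∀ i j, sJ i * e (mJ i) j = sJ j * e i (mJ j)) :
    ∃ s : Fin 6 → ℝ, ∀ i j, e i j = -(1 / 2) * ∑ m, s m * qsC m i j := by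
  have a1 : e 0 1 = 0 := by have := hJ 0 0; simp [sJ_values, mJ_values, h.rules] at this; linarith
  have a2 : e 2 3 = 0 := by have := hJ 2 2; simp [sJ_values, mJ_values, h.rules] at this; linarith
  have a3 : e 4 5 = 0 := by have := hJ 4 4; simp [sJ_values, mJ_values, h.rules] at this; linarith
  have b1 := hJ 0 2; have b2 := hJ 0 3; have b3 := hJ 0 4; have b4 := hJ 0 5
  have b5 := hJ 2 4; have b6 := hJ 2 5
  simp [sJ_values, mJ_values, h.rules] at b1 b2 b3 b4 b5 b6
  -- Contraction with ψ̂ identifies vectors with real forms of type (2,0)+(0,2), both spaces of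
  -- dimension six; `s` inverts this map. The factor -1/2 is chosen so that s becomes the torsion
  -- form itself.
  set s : Fin 6 → ℝ := ![-2 * e 2 5, -2 * e 2 4, 2 * e 0 5, 2 * e 0 4, -2 * e 0 3, -2 * e 0 2] with hs
  refine ⟨s, fun i j ↦ ?_⟩
  refine h.ext_sorted (b := fun i j ↦ -(1 / 2) * ∑ m, s m * qsC m i j) (fun i j ↦ ?_) ?_ i j
  · simp only [isAlt3_qsC.2 _ i j, mul_neg, Finset.sum_neg_distrib]
  simp only [Fin.sum_univ_six, isAlt3_qsC.rules, qsC_sorted]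
  refine ⟨?_, ?_, ?_, ?_, ?_, ?_, ?_, ?_, ?_, ?_, ?_, ?_, ?_, ?_, ?_⟩ <;> simp [hs] <;> linarith

/-- The components of the covariant derivative of `ψ` in terms of the torsion. -/
def dPsiComp (s : Fin 6 → ℝ) (q : ℝ) (i j k : Fin 6) : ℝ :=
  q * qsC i j k + 1 / 2 * (sJ i * s (mJ i) * omC j k + sJ j * s (mJ j) * omC k i
    + sJ k * s (mJ k) * omC i j)

/-- The components of the covariant derivative of `ψ̂` in terms of the torsion. -/
def dHatComp (s : Fin 6 → ℝ) (q : ℝ) (i j k : Fin 6) : ℝ :=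
  -q * psC i j k + 1 / 2 * (s i * omC j k + s j * omC k i + s k * omC i j)

/-- The components of `ψ ∧ φ + χ ∧ ψ̂` in dimension six. -/
def wedgeThreeThree (a b : Fin 6 → Fin 6 → Fin 6 → ℝ) : ℝ :=
  a 0 1 2 * b 3 4 5 - a 0 1 3 * b 2 4 5 + a 0 1 4 * b 2 3 5 - a 0 1 5 * b 2 3 4
  + a 0 2 3 * b 1 4 5 - a 0 2 4 * b 1 3 5 + a 0 2 5 * b 1 3 4 + a 0 3 4 * b 1 2 5
  - a 0 3 5 * b 1 2 4 + a 0 4 5 * b 1 2 3 - a 1 2 3 * b 0 4 5 + a 1 2 4 * b 0 3 5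
  - a 1 2 5 * b 0 3 4 - a 1 3 4 * b 0 2 5 + a 1 3 5 * b 0 2 4 - a 1 4 5 * b 0 2 3
  + a 2 3 4 * b 0 1 5 - a 2 3 5 * b 0 1 4 + a 2 4 5 * b 0 1 3 - a 3 4 5 * b 0 1 2

theorem isAlt3_cyclic (s : Fin 6 → ℝ) : IsAlt3 fun i j k ↦
    s i * omC j k + s j * omC k i + s k * omC i j := by
  have h := isAlt2_omC
  constructor <;> intro i j k
  · linear_combination s i * h j k + s j * h k i + s k * h i j
  · linear_combination s i * h j k + s j * h k i + s k * h i j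

theorem isAlt3_action (e : Fin 6 → Fin 6 → ℝ) : IsAlt3 fun i j k ↦
    ∑ m, (e i m * qsC m j k + e j m * qsC i m k + e k m * qsC i j m) := by
  have h := isAlt3_qsC
  constructor <;> intro i j k <;> rw [← Finset.sum_neg_distrib] <;>
    refine Finset.sum_congr rfl fun m _ ↦ ?_
  · linear_combination e i m * h.1 m j k + e j m * h.1 i m k + e k m * h.1 i j m
  · linear_combination e i m * h.2 m j k + e j m * h.2 i m k + e k m * h.2 i j m

/-- The contraction identity for Im Ω with itself: the endomorphism e, acting on ψ̂ as a derivation,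
gives the wedge of the covector s(J·) with ω. -/
theorem action_eq_cyclic {e : Fin 6 → Fin 6 → ℝ} {s : Fin 6 → ℝ}
    (he : ∀ i j, e i j = -(1 / 2) * ∑ m, s m * qsC m i j) (i j k : Fin 6) :
    ∑ m, (e i m * qsC m j k + e j m * qsC i m k + e k m * qsC i j m) =
      sJ i * s (mJ i) * omC j k + sJ j * s (mJ j) * omC k i + sJ k * s (mJ k) * omC i j := by
  refine (isAlt3_action e).ext_sorted (isAlt3_cyclic fun i ↦ sJ i * s (mJ i)) ?_ i j k
  simp only [Fin.sum_univ_six, he]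
  simp only [isAlt3_qsC.rules, qsC_sorted, isAlt2_omC.rules, omC_sorted, sJ_values, mJ_values]
  refine ⟨?_, ?_, ?_, ?_, ?_, ?_, ?_, ?_, ?_, ?_, ?_, ?_, ?_, ?_, ?_, ?_, ?_, ?_, ?_, ?_⟩ <;> ring

theorem sum_mJ (F : Fin 6 → ℝ) : ∑ m, F (mJ m) = ∑ m, F m := by
  simp [Fin.sum_univ_six, mJ_values]; ring

/-- Here e, X, Y stand for ∇_u ω, ∇_u ψ, ∇_u ψ̂. The differentiated relation ψ(J·, ·, ·) = ψ(·, J·,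
·) says that the failure of X to have type (3,0)+(0,3) is determined by e. Subtracting half the
derivation action of e on ψ̂ removes this failure and leaves pψ + qψ̂. The differentiated
normalisation gives p = 0, while q, the rotation of the phase, stays free. -/
theorem dPsiComp_of_type {e : Fin 6 → Fin 6 → ℝ} {s : Fin 6 → ℝ}
    (he : ∀ i j, e i j = -(1 / 2) * ∑ m, s m * qsC m i j)
    (heJ : ∀ i j, sJ i * e (mJ i) j = sJ j * e i (mJ j))
    {X : Fin 6 → Fin 6 → Fin 6 → ℝ} (hX : IsAlt3 X)
    (hXJ : ∀ i j k, sJ i * X (mJ i) j k + ∑ m, e i m * psC m j k =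
      sJ j * X i (mJ j) k + ∑ m, e j m * psC i m k)
    {Y : Fin 6 → Fin 6 → Fin 6 → ℝ} (hY : IsAlt3 Y)
    (hXY : ∀ i j k, Y i j k = -(sJ i * X (mJ i) j k) - ∑ m, e i m * psC m j k)
    (hn : wedgeThreeThree X qsC + wedgeThreeThree psC Y = 0) :
    ∃ q : ℝ, (∀ i j k, X i j k = dPsiComp s q i j k) ∧ ∀ i j k, Y i j k = dHatComp s q i j k := by
  set Z : Fin 6 → Fin 6 → Fin 6 → ℝ := fun i j k ↦
    ∑ m, (e i m * qsC m j k + e j m * qsC i m k + e k m * qsC i j m) with hZ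
  have hqr (i j k : Fin 6) : sJ j * qsC i (mJ j) k = psC i j k := by
    rw [isAlt3_qsC.1, mul_neg, qsC_contract, ← isAlt3_psC.1]
  have hZa : IsAlt3 Z := isAlt3_action e
  have hW : IsAlt3 fun i j k ↦ X i j k - 1 / 2 * Z i j k :=
    ⟨fun i j k ↦ by linear_combination hX.1 i j k - 1 / 2 * hZa.1 i j k,
      fun i j k ↦ by linear_combination hX.2 i j k - 1 / 2 * hZa.2 i j k⟩
  -- Moving J across the contracted index, by reindexing the sum along `mJ`, turns ψ̂ into ψ.
  have r1 (i j k : Fin 6) : ∑ m, sJ i * (e (mJ i) m * qsC m j k) = -∑ m, e i m * psC m j k := by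
    calc _ = ∑ m, (fun m ↦ -(e i m * psC m j k)) (mJ m) := by
          refine Finset.sum_congr rfl fun m _ ↦ ?_
          have := qsC_contract (mJ m) j k
          rw [mJ_mJ, sJ_mJ] at this
          simp only [← this]
          linear_combination qsC m j k * heJ i m
      _ = _ := (sum_mJ fun m ↦ -(e i m * psC m j k)).trans (by rw [Finset.sum_neg_distrib])
  have r2 (i j k : Fin 6) : ∑ m, sJ j * (e (mJ j) m * qsC i m k) = -∑ m, e j m * psC i m k := by
    calc _ = -∑ m, sJ j * (e (mJ j) m * qsC m i k) := by
          rw [← Finset.sum_neg_distrib]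
          refine Finset.sum_congr rfl fun m _ ↦ ?_
          linear_combination sJ j * e (mJ j) m * isAlt3_qsC.1 i m k
      _ = ∑ m, e j m * psC m i k := by rw [r1, neg_neg]
      _ = _ := by
          rw [← Finset.sum_neg_distrib]
          refine Finset.sum_congr rfl fun m _ ↦ ?_
          linear_combination e j m * isAlt3_psC.1 m i k
  have hT := hW.eq_of_type fun i j k ↦ by
    have e1 : sJ i * Z (mJ i) j k - sJ j * Z i (mJ j) k =
        2 * ∑ m, e j m * psC i m k - 2 * ∑ m, e i m * psC m j k := by
      have t1 := r1 i j k
      have t2 := r2 i j k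
      have t3 : sJ i * Z (mJ i) j k - sJ j * Z i (mJ j) k =
          ∑ m, sJ i * (e (mJ i) m * qsC m j k) - ∑ m, sJ j * (e (mJ j) m * qsC i m k)
          + ∑ m, e j m * psC i m k - ∑ m, e i m * psC m j k := by
        simp only [hZ, Finset.mul_sum, ← Finset.sum_sub_distrib, ← Finset.sum_add_distrib]
        refine Finset.sum_congr rfl fun m _ ↦ ?_
        linear_combination e j m * qsC_contract i m k + e k m * qsC_contract i j m
          - e i m * hqr m j k - e k m * hqr i j m
      rw [t3, t1, t2]; ring
    linear_combination hXJ i j k - 1 / 2 * e1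
  set p := X 0 2 4 - 1 / 2 * Z 0 2 4
  set q := X 1 2 4 - 1 / 2 * Z 1 2 4
  have hX' (i j k : Fin 6) : X i j k = p * psC i j k + dPsiComp s q i j k := by
    rw [dPsiComp, ← action_eq_cyclic he]
    linear_combination hT i j k
  have hY' (i j k : Fin 6) : Y i j k = p * qsC i j k + dHatComp s q i j k := by
    refine hY.ext_sorted (b := fun i j k ↦ p * qsC i j k + dHatComp s q i j k) ?_ ?_ i j k
    · have h1 := isAlt3_qsC; have h2 := isAlt3_psC; have h3 := isAlt3_cyclic s
      constructor <;> intro i j k <;> simp only [dHatComp]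
      · linear_combination p * h1.1 i j k - q * h2.1 i j k + 1 / 2 * h3.1 i j k
      · linear_combination p * h1.2 i j k - q * h2.2 i j k + 1 / 2 * h3.2 i j k
    simp only [hXY, hX', Fin.sum_univ_six, he, dPsiComp, dHatComp]
    simp only [isAlt3_qsC.rules, qsC_sorted, isAlt3_psC.rules, psC_sorted, isAlt2_omC.rules,
      omC_sorted, sJ_values, mJ_values]
    refine ⟨?_, ?_, ?_, ?_, ?_, ?_, ?_, ?_, ?_, ?_, ?_, ?_, ?_, ?_, ?_, ?_, ?_, ?_, ?_, ?_⟩ <;> ring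
  have hp : p = 0 := by
    simp only [wedgeThreeThree, hX', hY', dPsiComp, dHatComp] at hn
    simp only [isAlt3_qsC.rules, qsC_sorted, isAlt3_psC.rules, psC_sorted, isAlt2_omC.rules,
      omC_sorted, sJ_values, mJ_values] at hn
    ring_nf at hn
    linarith
  refine ⟨q, fun i j k ↦ ?_, fun i j k ↦ ?_⟩
  · rw [hX', hp]; ring
  · rw [hY', hp]; ring

/-- The first-order consequences of `dω = 0` and `dψ = 0` in an adapted frame. -/
theorem torsion_symmetries {e : Fin 6 → Fin 6 → Fin 6 → ℝ} {s : Fin 6 → Fin 6 → ℝ}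
    {q : Fin 6 → ℝ} (he : ∀ u i j, e u i j = -(1 / 2) * ∑ m, s u m * qsC m i j)
    (h1 : ∀ i j k, e i j k + e j k i + e k i j = 0)
    (h2 : ∀ i j k l, dPsiComp (s i) (q i) j k l - dPsiComp (s j) (q j) i k l
      + dPsiComp (s k) (q k) i j l - dPsiComp (s l) (q l) i j k = 0) :
    (∀ i, q i = 0) ∧ IsAlt2 s ∧ (∀ i j, sJ i * s (mJ i) j = -(sJ j * s i (mJ j))) ∧
      s 0 1 + s 2 3 + s 4 5 = 0 := by
  -- The 20 components of dω = 0 and the 15 components of dψ = 0 are linear equations in the 36 + 6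
  -- unknowns s and q. Each claim below is a linear consequence of a few of them; what survives is
  -- su(3), of dimension eight.
  have w012 := h1 0 1 2
  have w013 := h1 0 1 3
  have w014 := h1 0 1 4
  have w015 := h1 0 1 5
  have w023 := h1 0 2 3
  have w024 := h1 0 2 4
  have w025 := h1 0 2 5
  have w034 := h1 0 3 4
  have w035 := h1 0 3 5
  have w045 := h1 0 4 5
  have w123 := h1 1 2 3
  have w124 := h1 1 2 4
  have w125 := h1 1 2 5
  have w134 := h1 1 3 4
  have w135 := h1 1 3 5
  have w145 := h1 1 4 5
  have w234 := h1 2 3 4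
  have w235 := h1 2 3 5
  have w245 := h1 2 4 5
  have w345 := h1 3 4 5
  simp only [he, Fin.sum_univ_six] at w012 w013 w014 w015 w023 w024 w025 w034 w035 w045 w123 w124 w125 w134 w135 w145 w234 w235 w245 w345
  simp only [isAlt3_qsC.rules, qsC_sorted, mul_zero, add_zero, zero_add, neg_zero, neg_neg, mul_neg,
    mul_one] at w012 w013 w014 w015 w023 w024 w025 w034 w035 w045 w123 w124 w125 w134 w135 w145 w234 w235 w245 w345
  have p0123 := h2 0 1 2 3
  have p0124 := h2 0 1 2 4
  have p0125 := h2 0 1 2 5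
  have p0134 := h2 0 1 3 4
  have p0135 := h2 0 1 3 5
  have p0145 := h2 0 1 4 5
  have p0234 := h2 0 2 3 4
  have p0235 := h2 0 2 3 5
  have p0245 := h2 0 2 4 5
  have p0345 := h2 0 3 4 5
  have p1234 := h2 1 2 3 4
  have p1235 := h2 1 2 3 5
  have p1245 := h2 1 2 4 5
  have p1345 := h2 1 3 4 5
  have p2345 := h2 2 3 4 5
  simp only [dPsiComp, isAlt3_qsC.rules, qsC_sorted, isAlt2_omC.rules, omC_sorted, sJ_values,
    mJ_values, mul_zero, add_zero, zero_add, neg_zero, neg_neg, mul_neg, mul_one, one_mul, neg_mul] at p0123 p0124 p0125 p0134 p0135 p0145 p0234 p0235 p0245 p0345 p1234 p1235 p1245 p1345 p2345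
  have q0 : q 0 = 0 := by linarith only [w123, w145, p0124, p0135]
  have q1 : q 1 = 0 := by linarith only [w023, w045, p0125, p0134]
  have q2 : q 2 = 0 := by linarith only [w013, w345, p0234, p1235]
  have q3 : q 3 = 0 := by linarith only [w012, w245, p0235, p1234]
  have q4 : q 4 = 0 := by linarith only [w015, w235, p0245, p1345]
  have q5 : q 5 = 0 := by linarith only [w014, w234, p0345, p1245]
  have hs : IsAlt2 s := by
    intro i j
    wlog hij : i ≤ j generalizing i j
    · rw [this j i (not_le.1 hij).le, neg_neg]
    fin_cases i <;> fin_cases j <;> first | exact absurd hij (by decide) | skip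
    · change s 0 0 = -s 0 0; linarith only [w124, w135, p0123, p0145]
    · change s 0 1 = -s 1 0; linarith only [w024, w035, w125, w134]
    · change s 0 2 = -s 2 0; linarith only [w014, w234, p0345, p1245]
    · change s 0 3 = -s 3 0; linarith only [w015, w235, p0245, p1345]
    · change s 0 4 = -s 4 0; linarith only [w012, w245, p0235, p1234]
    · change s 0 5 = -s 5 0; linarith only [w013, w345, p0234, p1235]
    · change s 1 1 = -s 1 1; linarith only [w025, w034, p0123, p0145]
    · change s 1 2 = -s 2 1; linarith only [w015, w235, p0245, p1345]
    · change s 1 3 = -s 3 1; linarith only [w014, w234, p0345, p1245]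
    · change s 1 4 = -s 4 1; linarith only [w013, w345, p0234, p1235]
    · change s 1 5 = -s 5 1; linarith only [w012, w245, p0235, p1234]
    · change s 2 2 = -s 2 2; linarith only [w025, w124, p0145]
    · change s 2 3 = -s 3 2; linarith only [w024, w035, w125, w134]
    · change s 2 4 = -s 4 2; linarith only [w023, w045, p0125, p0134]
    · change s 2 5 = -s 5 2; linarith only [w123, w145, p0124, p0135]
    · change s 3 3 = -s 3 3; linarith only [w034, w135, p0145]
    · change s 3 4 = -s 4 3; linarith only [w123, w145, p0124, p0135]
    · change s 3 5 = -s 5 3; linarith only [w023, w045, p0125, p0134]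
    · change s 4 4 = -s 4 4; linarith only [w034, w124, p0123]
    · change s 4 5 = -s 5 4; linarith only [w024, w035, w125, w134]
    · change s 5 5 = -s 5 5; linarith only [w025, w135, p0123]
  have t02 : s 1 2 = -s 0 3 := by linarith only [w015]
  have t03 : s 1 3 = s 0 2 := by linarith only [w014]
  have t04 : s 1 4 = -s 0 5 := by linarith only [w013]
  have t05 : s 1 5 = s 0 4 := by linarith only [w012]
  have t24 : s 3 4 = -s 2 5 := by linarith only [w123]
  have t25 : s 3 5 = s 2 4 := by linarith only [w023]
  refine ⟨?_, ?_, ?_, ?_⟩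
  · intro i; fin_cases i <;> assumption
  · exact hs
  · intro i j
    fin_cases i <;> fin_cases j <;>
      simp [sJ_values, mJ_values, hs.rules, t02, t03, t04, t05, t24, t25]
  · linarith only [w024]

end FirstOrderAlgebra

/-! ### Covariant derivatives of forms and endomorphisms -/

section Covariant

variable {E : Type*} [NormedAddCommGroup E] [NormedSpace ℝ E]

/-- The covariant derivative of a `2`-form. -/
def covTwo (Γ : E → E →L[ℝ] E →L[ℝ] E) (α : E → E [⋀^Fin 2]→L[ℝ] ℝ) (y : E) :
    E →ₗ[ℝ] E →ₗ[ℝ] E →ₗ[ℝ] ℝ where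
  toFun u := bil (fderiv ℝ α y u).toAlternatingMap
    - (bil (α y).toAlternatingMap).comp (Γ y u).toLinearMap
    - (bil (α y).toAlternatingMap).compl₂ (Γ y u).toLinearMap
  map_add' u v := by ext a b; simp [-bil_apply]; simp; ring
  map_smul' c u := by ext a b; simp [-bil_apply]; simp; ring

theorem covTwo_apply (Γ : E → E →L[ℝ] E →L[ℝ] E) (α : E → E [⋀^Fin 2]→L[ℝ] ℝ) (y u a b : E) :
    covTwo Γ α y u a b = fderiv ℝ α y u ![a, b] - α y ![Γ y u a, b] - α y ![a, Γ y u b] := rfl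

/-- The covariant derivative of a `3`-form. -/
def covThree (Γ : E → E →L[ℝ] E →L[ℝ] E) (α : E → E [⋀^Fin 3]→L[ℝ] ℝ) (y : E) :
    E →ₗ[ℝ] E →ₗ[ℝ] E →ₗ[ℝ] E →ₗ[ℝ] ℝ where
  toFun u := tril (fderiv ℝ α y u).toAlternatingMap
    - (tril (α y).toAlternatingMap).comp (Γ y u).toLinearMap
    - (tril (α y).toAlternatingMap).compl₂ (Γ y u).toLinearMap
    - (tril (α y).toAlternatingMap).compr₂ (LinearMap.lcomp ℝ ℝ (Γ y u).toLinearMap)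
  map_add' u v := by ext a b c; simp [-tril_apply]; simp; ring
  map_smul' c u := by ext a b c; simp [-tril_apply]; simp; ring

theorem covThree_apply (Γ : E → E →L[ℝ] E →L[ℝ] E) (α : E → E [⋀^Fin 3]→L[ℝ] ℝ) (y u a b c : E) :
    covThree Γ α y u a b c = fderiv ℝ α y u ![a, b, c] - α y ![Γ y u a, b, c]
      - α y ![a, Γ y u b, c] - α y ![a, b, Γ y u c] := rfl

/-- The covariant derivative of an endomorphism. -/
def covEndo (Γ : E → E →L[ℝ] E →L[ℝ] E) (A : E → E →L[ℝ] E) (y u v : E) : E :=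
  fderiv ℝ A y u v + Γ y u (A y v) - A y (Γ y u v)

theorem extDeriv_two_apply {α : E → E [⋀^Fin 2]→L[ℝ] ℝ} {y : E} (hα : DifferentiableAt ℝ α y)
    (a b c : E) : extDeriv α y ![a, b, c] =
      fderiv ℝ α y a ![b, c] - fderiv ℝ α y b ![a, c] + fderiv ℝ α y c ![a, b] := by
  have h0 (v : Fin 2 → E) (u : E) : fderiv ℝ (fun x ↦ α x v) y u = fderiv ℝ α y u v := by
    rw [fderiv_continuousAlternatingMap_apply_const_apply hα]
  rw [extDeriv_apply hα, Fin.sum_univ_three, h0, h0, h0]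
  have e0 : (0 : Fin 3).removeNth ![a, b, c] = ![b, c] := by ext i; fin_cases i <;> rfl
  have e1 : (1 : Fin 3).removeNth ![a, b, c] = ![a, c] := by ext i; fin_cases i <;> rfl
  have e2 : (2 : Fin 3).removeNth ![a, b, c] = ![a, b] := by ext i; fin_cases i <;> rfl
  rw [e0, e1, e2]
  simp
  ring

theorem extDeriv_three_apply {α : E → E [⋀^Fin 3]→L[ℝ] ℝ} {y : E} (hα : DifferentiableAt ℝ α y)
    (a b c d : E) : extDeriv α y ![a, b, c, d] =
      fderiv ℝ α y a ![b, c, d] - fderiv ℝ α y b ![a, c, d] + fderiv ℝ α y c ![a, b, d]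
        - fderiv ℝ α y d ![a, b, c] := by
  have h0 (v : Fin 3 → E) (u : E) : fderiv ℝ (fun x ↦ α x v) y u = fderiv ℝ α y u v := by
    rw [fderiv_continuousAlternatingMap_apply_const_apply hα]
  rw [extDeriv_apply hα, Fin.sum_univ_four, h0, h0, h0, h0]
  have e0 : (0 : Fin 4).removeNth ![a, b, c, d] = ![b, c, d] := by ext i; fin_cases i <;> rfl
  have e1 : (1 : Fin 4).removeNth ![a, b, c, d] = ![a, c, d] := by ext i; fin_cases i <;> rfl
  have e2 : (2 : Fin 4).removeNth ![a, b, c, d] = ![a, b, d] := by ext i; fin_cases i <;> rfl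
  have e3 : (3 : Fin 4).removeNth ![a, b, c, d] = ![a, b, c] := by ext i; fin_cases i <;> rfl
  rw [e0, e1, e2, e3]
  simp
  ring

variable {Γ : E → E →L[ℝ] E →L[ℝ] E} {y : E}

/-- The exterior derivative is the alternation of the covariant derivative: for a symmetric
connection form the Christoffel terms cancel in pairs. -/
theorem extDeriv_two_eq_cov {α : E → E [⋀^Fin 2]→L[ℝ] ℝ} (hα : DifferentiableAt ℝ α y)
    (hs : ∀ u v, Γ y u v = Γ y v u) (a b c : E) : extDeriv α y ![a, b, c] =
      covTwo Γ α y a b c + covTwo Γ α y b c a + covTwo Γ α y c a b := by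
  rw [extDeriv_two_apply hα]
  simp only [covTwo_apply]
  have sw (L : E [⋀^Fin 2]→L[ℝ] ℝ) (u v : E) : L ![u, v] = -L ![v, u] :=
    two_swap L.toAlternatingMap u v
  rw [hs b a, hs c b, hs a c, sw _ (Γ y c a), sw _ (Γ y a b), sw _ (Γ y b c), sw _ a c]
  ring

theorem extDeriv_three_eq_cov {α : E → E [⋀^Fin 3]→L[ℝ] ℝ} (hα : DifferentiableAt ℝ α y)
    (hs : ∀ u v, Γ y u v = Γ y v u) (a b c d : E) : extDeriv α y ![a, b, c, d] =
      covThree Γ α y a b c d - covThree Γ α y b a c d + covThree Γ α y c a b d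
        - covThree Γ α y d a b c := by
  rw [extDeriv_three_apply hα]
  simp only [covThree_apply]
  have sl (L : E [⋀^Fin 3]→L[ℝ] ℝ) (u v w : E) : L ![u, v, w] = -L ![v, u, w] :=
    three_swap_left L.toAlternatingMap u v w
  have sr (L : E [⋀^Fin 3]→L[ℝ] ℝ) (u v w : E) : L ![u, v, w] = -L ![u, w, v] :=
    three_swap_right L.toAlternatingMap u v w
  rw [hs b a, hs c a, hs c b, hs d a, hs d b, hs d c, sl _ b (Γ y a c) d, sr _ b c (Γ y a d),
    sl _ b (Γ y a d) c, sr _ a c (Γ y b d), sl _ a (Γ y b c) d, sl _ a (Γ y b d) c,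
    sr _ a b (Γ y c d), sl _ a (Γ y c d) b]
  ring

theorem covThree_swap_left (α : E → E [⋀^Fin 3]→L[ℝ] ℝ) (u a b c : E) :
    covThree Γ α y u a b c = -covThree Γ α y u b a c := by
  have sl (L : E [⋀^Fin 3]→L[ℝ] ℝ) (u v w : E) : L ![u, v, w] = -L ![v, u, w] :=
    three_swap_left L.toAlternatingMap u v w
  simp only [covThree_apply]
  rw [sl _ a b c, sl _ _ b c, sl _ a _ c, sl _ a b]
  ring

theorem covThree_swap_right (α : E → E [⋀^Fin 3]→L[ℝ] ℝ) (u a b c : E) :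
    covThree Γ α y u a b c = -covThree Γ α y u a c b := by
  have sr (L : E [⋀^Fin 3]→L[ℝ] ℝ) (u v w : E) : L ![u, v, w] = -L ![u, w, v] :=
    three_swap_right L.toAlternatingMap u v w
  simp only [covThree_apply]
  rw [sr _ a b c, sr _ _ b c, sr _ a _ c, sr _ a b]
  ring

theorem covTwo_swap (α : E → E [⋀^Fin 2]→L[ℝ] ℝ) (u a b : E) :
    covTwo Γ α y u a b = -covTwo Γ α y u b a := by
  have sw (L : E [⋀^Fin 2]→L[ℝ] ℝ) (u v : E) : L ![u, v] = -L ![v, u] :=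
    two_swap L.toAlternatingMap u v
  simp only [covTwo_apply]
  rw [sw _ a b, sw _ _ b, sw _ a]
  ring

/-- The covariant derivative as the derivative along a line in a frame that is parallel to first
order. -/
theorem hasDerivAt_covThree {α : E → E [⋀^Fin 3]→L[ℝ] ℝ} (hα : DifferentiableAt ℝ α y)
    (u a b c : E) : HasDerivAt (fun t : ℝ ↦ α (y + t • u)
      ![a - t • Γ y u a, b - t • Γ y u b, c - t • Γ y u c]) (covThree Γ α y u a b c) 0 := by
  have hl : HasFDerivAt (fun t : ℝ ↦ y + t • u) ((ContinuousLinearMap.id ℝ ℝ).smulRight u) 0 := by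
    simpa using ((hasFDerivAt_id (𝕜 := ℝ) (0 : ℝ)).smul_const u).const_add y
  have hv (a : E) : HasFDerivAt (fun t : ℝ ↦ a - t • Γ y u a)
      (-((ContinuousLinearMap.id ℝ ℝ).smulRight (Γ y u a))) 0 := by
    simpa using ((hasFDerivAt_id (𝕜 := ℝ) (0 : ℝ)).smul_const (Γ y u a)).const_sub a
  have hα' : HasFDerivAt α (fderiv ℝ α y) (y + (0 : ℝ) • u) := by simpa using hα.hasFDerivAt
  have hc := HasFDerivAt.comp (0 : ℝ) hα' hl
  have h := hasFDerivAt_three hc.differentiableAt (hv a) (hv b) (hv c)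
  have h2 := h.1.hasFDerivAt.hasDerivAt
  refine h2.congr_deriv ?_
  rw [h.2, hc.fderiv]
  simp [covThree_apply, ← tril_apply_continuous, -tril_apply]
  simp only [tril_apply_continuous]
  ring

theorem hasDerivAt_covTwo {α : E → E [⋀^Fin 2]→L[ℝ] ℝ} (hα : DifferentiableAt ℝ α y)
    (u a b : E) : HasDerivAt (fun t : ℝ ↦ α (y + t • u)
      ![a - t • Γ y u a, b - t • Γ y u b]) (covTwo Γ α y u a b) 0 := by
  have hl : HasFDerivAt (fun t : ℝ ↦ y + t • u) ((ContinuousLinearMap.id ℝ ℝ).smulRight u) 0 := by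
    simpa using ((hasFDerivAt_id (𝕜 := ℝ) (0 : ℝ)).smul_const u).const_add y
  have hv (a : E) : HasFDerivAt (fun t : ℝ ↦ a - t • Γ y u a)
      (-((ContinuousLinearMap.id ℝ ℝ).smulRight (Γ y u a))) 0 := by
    simpa using ((hasFDerivAt_id (𝕜 := ℝ) (0 : ℝ)).smul_const (Γ y u a)).const_sub a
  have hα' : HasFDerivAt α (fderiv ℝ α y) (y + (0 : ℝ) • u) := by simpa using hα.hasFDerivAt
  have hc := HasFDerivAt.comp (0 : ℝ) hα' hl
  have h := hasFDerivAt_two hc.differentiableAt (hv a) (hv b)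
  have h2 := h.1.hasFDerivAt.hasDerivAt
  refine h2.congr_deriv ?_
  rw [h.2, hc.fderiv]
  simp [covTwo_apply, ← bil_apply_continuous, -bil_apply]
  simp only [bil_apply_continuous]
  ring

end Covariant

/-! ### The torsion of a symplectic half-flat structure on an open set -/

section FirstOrder

local notation "E₆" => EuclideanSpace ℝ (Fin 6)

/-- A symplectic half-flat structure on an open subset of `ℝ⁶`. -/
structure IsLocalSHF (U : Set E₆) (ω : E₆ → E₆ [⋀^Fin 2]→L[ℝ] ℝ) (ψ : E₆ → E₆ [⋀^Fin 3]→L[ℝ] ℝ) :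
    Prop where
  isOpen : IsOpen U
  smooth_omega : ∀ z ∈ U, ContDiffAt ℝ ((⊤ : ℕ∞) : WithTop ℕ∞) ω z
  smooth_psi : ∀ z ∈ U, ContDiffAt ℝ ((⊤ : ℕ∞) : WithTop ℕ∞) ψ z
  isSU3 : ∀ z ∈ U, IsSU3 stdBasis (ω z).toAlternatingMap (ψ z).toAlternatingMap
  closed_omega : ∀ z ∈ U, extDeriv ω z = 0
  closed_psi : ∀ z ∈ U, extDeriv ψ z = 0

variable {U : Set E₆} {ω : E₆ → E₆ [⋀^Fin 2]→L[ℝ] ℝ} {ψ : E₆ → E₆ [⋀^Fin 3]→L[ℝ] ℝ} {z : E₆}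

/-- The Levi-Civita connection of an `SU(3)`-structure. -/
def conn (ω : E₆ → E₆ [⋀^Fin 2]→L[ℝ] ℝ) (ψ : E₆ → E₆ [⋀^Fin 3]→L[ℝ] ℝ) :
    E₆ → E₆ →L[ℝ] E₆ →L[ℝ] E₆ :=
  leviCivita fun z ↦ metricL (ω z) (ψ z)

/-- A basis adapted to an `SU(3)`-structure on `ℝ⁶`. -/
def Adapted (f : Module.Basis (Fin 6) ℝ E₆) (ω : E₆ [⋀^Fin 2]→L[ℝ] ℝ)
    (ψ : E₆ [⋀^Fin 3]→L[ℝ] ℝ) : Prop :=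
  IsAdapted f ω.toAlternatingMap ψ.toAlternatingMap
    (cplx stdBasis ω.toAlternatingMap ψ.toAlternatingMap)

namespace IsLocalSHF

theorem eventually (h : IsLocalSHF U ω ψ) (hz : z ∈ U) {p : E₆ → Prop} (hp : ∀ z ∈ U, p z) :
    ∀ᶠ y in 𝓝 z, p y := Filter.mem_of_superset (h.isOpen.mem_nhds hz) hp

theorem smooth_cplx (h : IsLocalSHF U ω ψ) (hz : z ∈ U) :
    ContDiffAt ℝ ((⊤ : ℕ∞) : WithTop ℕ∞) (fun z ↦ cplxL (ω z) (ψ z)) z :=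
  contDiffAt_cplxL (h.smooth_omega z hz) (h.smooth_psi z hz) (h.eventually hz h.isSU3)

theorem smooth_hat (h : IsLocalSHF U ω ψ) (hz : z ∈ U) :
    ContDiffAt ℝ ((⊤ : ℕ∞) : WithTop ℕ∞) (fun z ↦ hatL (ω z) (ψ z)) z :=
  contDiffAt_hatL (h.smooth_omega z hz) (h.smooth_psi z hz) (h.eventually hz h.isSU3)

theorem smooth_metric (h : IsLocalSHF U ω ψ) (hz : z ∈ U) :
    ContDiffAt ℝ ((⊤ : ℕ∞) : WithTop ℕ∞) (fun z ↦ metricL (ω z) (ψ z)) z :=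
  contDiffAt_metricL (h.smooth_omega z hz) (h.smooth_psi z hz) (h.eventually hz h.isSU3)

theorem metric_symm (h : IsLocalSHF U ω ψ) (hz : z ∈ U) (u v : E₆) :
    metricL (ω z) (ψ z) u v = metricL (ω z) (ψ z) v u := (h.isSU3 z hz).metric_symm u v

theorem metric_nondeg (h : IsLocalSHF U ω ψ) (hz : z ∈ U) (v : E₆)
    (hv : ∀ w, metricL (ω z) (ψ z) v w = 0) : v = 0 := by
  by_contra h0
  exact ((h.isSU3 z hz).posDef v h0).ne' (hv v)

theorem conn_symm (h : IsLocalSHF U ω ψ) (hz : z ∈ U) (u v : E₆) :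
    conn ω ψ z u v = conn ω ψ z v u :=
  leviCivita_symm h.isOpen (fun _ hz ↦ h.metric_symm hz) hz u v

theorem smooth_conn (h : IsLocalSHF U ω ψ) (hz : z ∈ U) :
    ContDiffAt ℝ ((⊤ : ℕ∞) : WithTop ℕ∞) (conn ω ψ) z :=
  contDiffAt_leviCivita (h.smooth_metric hz) (h.metric_nondeg hz)

theorem fderiv_metric (h : IsLocalSHF U ω ψ) (hz : z ∈ U) (u v w : E₆) :
    fderiv ℝ (fun z ↦ metricL (ω z) (ψ z)) z u v w =
      metricL (ω z) (ψ z) (conn ω ψ z u v) w + metricL (ω z) (ψ z) v (conn ω ψ z u w) :=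
  leviCivita_metric h.isOpen (fun _ hz ↦ h.smooth_metric hz) (fun _ hz ↦ h.metric_nondeg hz)
    (fun _ hz ↦ h.metric_symm hz) hz u v w

theorem cplx_cplx (h : IsLocalSHF U ω ψ) (hz : z ∈ U) (v : E₆) :
    cplxL (ω z) (ψ z) (cplxL (ω z) (ψ z) v) = -v := (h.isSU3 z hz).cplx_cplx v

theorem psi_cplx (h : IsLocalSHF U ω ψ) (hz : z ∈ U) (u v w : E₆) :
    ψ z ![cplxL (ω z) (ψ z) u, v, w] = ψ z ![u, cplxL (ω z) (ψ z) v, w] :=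
  (h.isSU3 z hz).psi_cplx u v w

/-- J may be moved from slot to slot of ψ, so J in all three slots is J³ = -J in the first. -/
theorem hat_eq (h : IsLocalSHF U ω ψ) (hz : z ∈ U) (u v w : E₆) :
    hatL (ω z) (ψ z) ![u, v, w] = -ψ z ![cplxL (ω z) (ψ z) u, v, w] := by
  have sr := three_swap_right (ψ z).toAlternatingMap
  have sl := three_swap_left (ψ z).toAlternatingMap
  have hp : ∀ u v w, (ψ z).toAlternatingMap ![cplxL (ω z) (ψ z) u, v, w] =
    (ψ z).toAlternatingMap ![u, cplxL (ω z) (ψ z) v, w] := h.psi_cplx hz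
  rw [hatL_apply]
  change (ψ z).toAlternatingMap _ = -(ψ z).toAlternatingMap _
  rw [hp, h.cplx_cplx hz, sl, ← tril_apply, map_neg, LinearMap.neg_apply, LinearMap.neg_apply,
    tril_apply, sr, sl, sr, hp, sl, sr, sl, sr]
  ring

/-- Differentiate J² = -1, which holds throughout a neighbourhood of z. -/
theorem covEndo_cplx_anticomm (h : IsLocalSHF U ω ψ) (hz : z ∈ U) (u v : E₆) :
    covEndo (conn ω ψ) (fun z ↦ cplxL (ω z) (ψ z)) z u (cplxL (ω z) (ψ z) v) =
      -cplxL (ω z) (ψ z) (covEndo (conn ω ψ) (fun z ↦ cplxL (ω z) (ψ z)) z u v) := by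
  have hJ := (h.smooth_cplx hz).differentiableAt (by simp)
  have h0 := hasFDerivAt_endo hJ (hasFDerivAt_endo hJ (hasFDerivAt_const v z))
  have h1 := h0.congr_of_eventuallyEq (f₁ := fun _ ↦ -v)
    (h.eventually hz fun y hy ↦ (h.cplx_cplx hy v).symm)
  have h2 := congrArg (fun L ↦ L u) (h1.unique (hasFDerivAt_const (-v) z))
  simp at h2
  simp only [covEndo, map_sub, map_add, map_neg, h.cplx_cplx hz]
  rw [← sub_eq_zero, ← h2]
  abel

/-- Differentiate g = ω(·, J·) and use ∇g = 0. -/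
theorem covEndo_cplx_metric (h : IsLocalSHF U ω ψ) (hz : z ∈ U) (u v w : E₆) :
    ω z ![v, covEndo (conn ω ψ) (fun z ↦ cplxL (ω z) (ψ z)) z u w] =
      -covTwo (conn ω ψ) ω z u v (cplxL (ω z) (ψ z) w) := by
  have hJ := (h.smooth_cplx hz).differentiableAt (by simp)
  have hω := (h.smooth_omega z hz).differentiableAt (by simp)
  have hg := (h.smooth_metric hz).differentiableAt (by simp)
  have hc (a : E₆) := hasFDerivAt_const (𝕜 := ℝ) a z
  have h1 := (hasFDerivAt_two hω (hc v) (hasFDerivAt_endo hJ (hc w))).2 u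
  have h2 := (hasFDerivAt_bilin hg (hc v) (hc w)).2 u
  have h3 : (fun y ↦ ω y ![v, cplxL (ω y) (ψ y) w]) = fun y ↦ metricL (ω y) (ψ y) v w := rfl
  rw [h3, h2, h.fderiv_metric hz] at h1
  simp only [metricL_apply, ← bil_apply_continuous] at h1
  simp [-bil_apply] at h1
  simp only [covTwo_apply, covEndo, ← bil_apply_continuous]
  simp only [map_add, map_sub]
  linarith

theorem covThree_psi_cplx (h : IsLocalSHF U ω ψ) (hz : z ∈ U) (u a b c : E₆) :
    covThree (conn ω ψ) ψ z u (cplxL (ω z) (ψ z) a) b c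
      + ψ z ![covEndo (conn ω ψ) (fun z ↦ cplxL (ω z) (ψ z)) z u a, b, c] =
    covThree (conn ω ψ) ψ z u a (cplxL (ω z) (ψ z) b) c
      + ψ z ![a, covEndo (conn ω ψ) (fun z ↦ cplxL (ω z) (ψ z)) z u b, c] := by
  have hJ := (h.smooth_cplx hz).differentiableAt (by simp)
  have hψ := (h.smooth_psi z hz).differentiableAt (by simp)
  have hc (a : E₆) := hasFDerivAt_const (𝕜 := ℝ) a z
  have h1 := (hasFDerivAt_three hψ (hasFDerivAt_endo hJ (hc a)) (hc b) (hc c)).2 u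
  have h2 := (hasFDerivAt_three hψ (hc a) (hasFDerivAt_endo hJ (hc b)) (hc c)).2 u
  rw [Filter.EventuallyEq.fderiv_eq (h.eventually hz fun y hy ↦ h.psi_cplx hy a b c), h2] at h1
  have e := h.psi_cplx hz a b (conn ω ψ z u c)
  have e1 := h.psi_cplx hz (conn ω ψ z u a) b c
  have e2 := h.psi_cplx hz a (conn ω ψ z u b) c
  simp only [covThree_apply, covEndo, ← tril_apply_continuous] at h1 e e1 e2 ⊢
  simp [-tril_apply] at h1 
  simp only [map_add, map_sub, LinearMap.add_apply, LinearMap.sub_apply]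
  linarith

/-- Differentiate ψ̂ = -ψ(J·, ·, ·). -/
theorem covThree_hat (h : IsLocalSHF U ω ψ) (hz : z ∈ U) (u a b c : E₆) :
    covThree (conn ω ψ) (fun z ↦ hatL (ω z) (ψ z)) z u a b c =
    -covThree (conn ω ψ) ψ z u (cplxL (ω z) (ψ z) a) b c
      - ψ z ![covEndo (conn ω ψ) (fun z ↦ cplxL (ω z) (ψ z)) z u a, b, c] := by
  have hJ := (h.smooth_cplx hz).differentiableAt (by simp)
  have hψ := (h.smooth_psi z hz).differentiableAt (by simp)
  have hh := (h.smooth_hat hz).differentiableAt (by simp)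
  have hc (a : E₆) := hasFDerivAt_const (𝕜 := ℝ) a z
  have h1 := (hasFDerivAt_three hψ (hasFDerivAt_endo hJ (hc a)) (hc b) (hc c))
  have h2 := (hasFDerivAt_three hh (hc a) (hc b) (hc c)).2 u
  have h3 := h1.1.hasFDerivAt.neg.fderiv
  rw [Filter.EventuallyEq.fderiv_eq (h.eventually hz fun y hy ↦ h.hat_eq hy a b c)] at h2
  have h4 := (congrArg (fun L ↦ L u) h3).symm.trans h2
  rw [neg_apply, h1.2] at h4
  simp only [covThree_apply, covEndo, h.hat_eq hz]
  simp only [← tril_apply_continuous] at h4 ⊢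
  simp [-tril_apply] at h4 
  simp only [map_add, map_sub, LinearMap.add_apply, LinearMap.sub_apply]
  linarith

theorem metric_cplx_left (h : IsLocalSHF U ω ψ) (hz : z ∈ U) (v w : E₆) :
    metricL (ω z) (ψ z) (cplxL (ω z) (ψ z) v) w =
      -metricL (ω z) (ψ z) v (cplxL (ω z) (ψ z) w) := by
  have h1 : metricL (ω z) (ψ z) (cplxL (ω z) (ψ z) v) (cplxL (ω z) (ψ z) (cplxL (ω z) (ψ z) w)) =
    metricL (ω z) (ψ z) v (cplxL (ω z) (ψ z) w) := (h.isSU3 z hz).metric_cplx _ _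
  rw [h.cplx_cplx hz, map_neg] at h1
  linarith

theorem metric_covEndo (h : IsLocalSHF U ω ψ) (hz : z ∈ U) (u v w : E₆) :
    metricL (ω z) (ψ z) (covEndo (conn ω ψ) (fun z ↦ cplxL (ω z) (ψ z)) z u v) w =
      covTwo (conn ω ψ) ω z u v w := by
  rw [h.metric_symm hz, metricL_apply, covTwo_swap]
  have h1 := h.covEndo_cplx_metric hz u w (cplxL (ω z) (ψ z) v)
  rw [h.covEndo_cplx_anticomm hz, h.cplx_cplx hz, map_neg] at h1
  simp only [← bil_apply_continuous, map_neg] at h1 ⊢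
  linarith

/-- ∇_u J corresponds to ∇_u ω under g and anticommutes with J; hence ∇_u ω has type (2,0)+(0,2). -/
theorem covTwo_cplx (h : IsLocalSHF U ω ψ) (hz : z ∈ U) (u v w : E₆) :
    covTwo (conn ω ψ) ω z u (cplxL (ω z) (ψ z) v) w =
      covTwo (conn ω ψ) ω z u v (cplxL (ω z) (ψ z) w) := by
  rw [← h.metric_covEndo hz, h.covEndo_cplx_anticomm hz, map_neg, neg_apply,
    h.metric_cplx_left hz, neg_neg, h.metric_covEndo hz]

theorem metric_frame {f : Module.Basis (Fin 6) ℝ E₆}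
    (hf : Adapted f (ω z) (ψ z)) (i j : Fin 6) :
    metricL (ω z) (ψ z) (f i) (f j) = if i = j then 1 else 0 := by
  have hJ : cplxL (ω z) (ψ z) (f j) = sJ j • f (mJ j) := hf.cplx j
  have ho : (ω z).toAlternatingMap ![f i, f (mJ j)] = omC i (mJ j) := hf.omega i (mJ j)
  rw [metricL_apply, hJ, ← bil_apply_continuous, map_smul, bil_apply, ho]
  have : ∀ i j, sZ j * omZ i (mJ j) = if i = j then 1 else 0 := by decide
  have := this i j
  simp only [sJ, omC, smul_eq_mul]
  split_ifs at this ⊢ <;> exact_mod_cast this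

theorem eq_sum_metric {f : Module.Basis (Fin 6) ℝ E₆}
    (hf : Adapted f (ω z) (ψ z)) (v : E₆) : v = ∑ i, metricL (ω z) (ψ z) v (f i) • f i := by
  have h1 (i : Fin 6) : metricL (ω z) (ψ z) (∑ j, f.repr v j • f j) (f i) = f.repr v i := by
    simp only [map_sum, map_smul, sum_apply, smul_apply, metric_frame hf]
    simp
  simp only [f.sum_repr] at h1
  simp only [h1, f.sum_repr]

end IsLocalSHF

theorem hasDerivAt_wedgeThreeThree {a b : ℝ → Fin 6 → Fin 6 → Fin 6 → ℝ}
    {a' b' : Fin 6 → Fin 6 → Fin 6 → ℝ} {t : ℝ} (ha : ∀ i j k, HasDerivAt (fun t ↦ a t i j k) (a' i j k) t)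
    (hb : ∀ i j k, HasDerivAt (fun t ↦ b t i j k) (b' i j k) t) :
    HasDerivAt (fun t ↦ wedgeThreeThree (a t) (b t))
      (wedgeThreeThree a' (b t) + wedgeThreeThree (a t) b') t := by
  have h (i j k l m n : Fin 6) := (ha i j k).fun_mul (hb l m n)
  have := ((h 0 1 2 3 4 5).fun_sub (h 0 1 3 2 4 5)).fun_add (h 0 1 4 2 3 5) |>.fun_sub (h 0 1 5 2 3 4)
    |>.fun_add (h 0 2 3 1 4 5) |>.fun_sub (h 0 2 4 1 3 5) |>.fun_add (h 0 2 5 1 3 4)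
    |>.fun_add (h 0 3 4 1 2 5) |>.fun_sub (h 0 3 5 1 2 4) |>.fun_add (h 0 4 5 1 2 3)
    |>.fun_sub (h 1 2 3 0 4 5) |>.fun_add (h 1 2 4 0 3 5) |>.fun_sub (h 1 2 5 0 3 4)
    |>.fun_sub (h 1 3 4 0 2 5) |>.fun_add (h 1 3 5 0 2 4) |>.fun_sub (h 1 4 5 0 2 3)
    |>.fun_add (h 2 3 4 0 1 5) |>.fun_sub (h 2 3 5 0 1 4) |>.fun_add (h 2 4 5 0 1 3)
    |>.fun_sub (h 3 4 5 0 1 2)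
  refine this.congr_deriv ?_
  simp only [wedgeThreeThree]
  ring

/-- The Pfaffian of an antisymmetric `6 × 6` array. -/
def pfaffian (o : Fin 6 → Fin 6 → ℝ) : ℝ :=
  o 0 1 * (o 2 3 * o 4 5 - o 2 4 * o 3 5 + o 2 5 * o 3 4)
  - o 0 2 * (o 1 3 * o 4 5 - o 1 4 * o 3 5 + o 1 5 * o 3 4)
  + o 0 3 * (o 1 2 * o 4 5 - o 1 4 * o 2 5 + o 1 5 * o 2 4)
  - o 0 4 * (o 1 2 * o 3 5 - o 1 3 * o 2 5 + o 1 5 * o 2 3)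
  + o 0 5 * (o 1 2 * o 3 4 - o 1 3 * o 2 4 + o 1 4 * o 2 3)

theorem hasDerivAt_pfaffian {o : ℝ → Fin 6 → Fin 6 → ℝ} {o' : Fin 6 → Fin 6 → ℝ} {t : ℝ}
    (ho : ∀ i j, HasDerivAt (fun t ↦ o t i j) (o' i j) t) (h0 : ∀ i j, o t i j = omC i j) :
    HasDerivAt (fun t ↦ pfaffian (o t)) (o' 0 1 + o' 2 3 + o' 4 5) t := by
  have h (i j k l m n p q r s : Fin 6) := (((ho k l).fun_mul (ho m n)).fun_sub ((ho p q).fun_mul (ho r s)))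
  have T (i j k l m n p q r s x y w v : Fin 6) := (ho i j).fun_mul
    ((((ho k l).fun_mul (ho m n)).fun_sub ((ho p q).fun_mul (ho r s))).fun_add
      ((ho x y).fun_mul (ho w v)))
  have := ((T 0 1 2 3 4 5 2 4 3 5 2 5 3 4).fun_sub (T 0 2 1 3 4 5 1 4 3 5 1 5 3 4)).fun_add
    (T 0 3 1 2 4 5 1 4 2 5 1 5 2 4) |>.fun_sub (T 0 4 1 2 3 5 1 3 2 5 1 5 2 3)
    |>.fun_add (T 0 5 1 2 3 4 1 3 2 4 1 4 2 3)
  refine this.congr_deriv ?_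
  simp only [h0, omC_sorted]
  ring

theorem IsSU3.normalized_apply {V : Type*} [AddCommGroup V] [Module ℝ V]
    {b : Module.Basis (Fin 6) ℝ V} {ω : V [⋀^Fin 2]→ₗ[ℝ] ℝ} {ψ : V [⋀^Fin 3]→ₗ[ℝ] ℝ}
    (h : IsSU3 b ω ψ) (x : Fin 6 → V) :
    wedgeThreeThree (fun i j k ↦ ψ ![x i, x j, x k]) (fun i j k ↦ hat b ω ψ ![x i, x j, x k]) =
      4 * pfaffian fun i j ↦ ω ![x i, x j] := by
  have := wedge_apply_of_eq_smul h.normalized (![x 0, x 1, x 2, x 3, x 4, x 5] : Fin 6 → V)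
  rw [cube_eq_pfaffian, wedge_three_three] at this
  rw [wedgeThreeThree, this, pfaffian]
  ring

theorem eq_of_hasDerivAt_of_eventuallyEq {a b : ℝ → ℝ} {a' b' t : ℝ} (ha : HasDerivAt a a' t)
    (hb : HasDerivAt b b' t) (h : ∀ᶠ s in 𝓝 t, a s = b s) : a' = b' :=
  ha.unique (hb.congr_of_eventuallyEq h)

namespace IsLocalSHF

-- The normalisation ψ ∧ ψ̂ = 4 Pf(ω) holds on every tuple of vectors, so it may be differentiated
-- along a line through z on vectors that are parallel to first order. The derivative of the
-- Pfaffian at the standard form is the trace of ∇_u ω over complex lines.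
set_option maxRecDepth 8000 in
theorem normalized_deriv (h : IsLocalSHF U ω ψ) (hz : z ∈ U) {f : Module.Basis (Fin 6) ℝ E₆}
    (hf : Adapted f (ω z) (ψ z)) (u : E₆) :
    wedgeThreeThree (fun i j k ↦ covThree (conn ω ψ) ψ z u (f i) (f j) (f k)) qsC
      + wedgeThreeThree psC (fun i j k ↦
        covThree (conn ω ψ) (fun z ↦ hatL (ω z) (ψ z)) z u (f i) (f j) (f k)) =
    4 * (covTwo (conn ω ψ) ω z u (f 0) (f 1) + covTwo (conn ω ψ) ω z u (f 2) (f 3)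
      + covTwo (conn ω ψ) ω z u (f 4) (f 5)) := by
  have hψ := (h.smooth_psi z hz).differentiableAt (by simp)
  have hω := (h.smooth_omega z hz).differentiableAt (by simp)
  have hh := (h.smooth_hat hz).differentiableAt (by simp)
  let V (i : Fin 6) (t : ℝ) : E₆ := f i - t • conn ω ψ z u (f i)
  have d1 := hasDerivAt_wedgeThreeThree
    (fun i j k ↦ hasDerivAt_covThree (Γ := conn ω ψ) hψ u (f i) (f j) (f k))
    (fun i j k ↦ hasDerivAt_covThree (Γ := conn ω ψ) hh u (f i) (f j) (f k))
  have d2 := hasDerivAt_pfaffian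
    (fun i j ↦ hasDerivAt_covTwo (Γ := conn ω ψ) hω u (f i) (f j)) (fun i j ↦ by
      simpa using hf.omega i j)
  have hl : Filter.Tendsto (fun t : ℝ ↦ z + t • u) (𝓝 0) (𝓝 z) := by
    have : ContinuousAt (fun t : ℝ ↦ z + t • u) 0 := by fun_prop
    simpa [ContinuousAt] using this
  have e := eq_of_hasDerivAt_of_eventuallyEq d1 (d2.const_mul 4)
  have this := e (by
    filter_upwards [hl.eventually (h.eventually hz fun y hy ↦ h.isSU3 y hy)] with t ht
    exact ht.normalized_apply fun i ↦ V i t)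
  simp only [zero_smul, add_zero, sub_zero] at this
  have q1 (i j k : Fin 6) : hatL (ω z) (ψ z) ![f i, f j, f k] = qsC i j k := hf.hat i j k
  have p1 (i j k : Fin 6) : ψ z ![f i, f j, f k] = psC i j k := hf.psi i j k
  simp only [q1, p1] at this
  exact this

/-- The torsion of a symplectic half-flat structure in an adapted frame. -/
theorem exists_torsion (h : IsLocalSHF U ω ψ) (hz : z ∈ U) {f : Module.Basis (Fin 6) ℝ E₆}
    (hf : Adapted f (ω z) (ψ z)) : ∃ s : Fin 6 → Fin 6 → ℝ, IsAlt2 s ∧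
      (∀ i j, sJ i * s (mJ i) j = -(sJ j * s i (mJ j))) ∧ s 0 1 + s 2 3 + s 4 5 = 0 ∧
      (∀ u i j, covTwo (conn ω ψ) ω z (f u) (f i) (f j) = -(1 / 2) * ∑ m, s u m * qsC m i j) ∧
      ∀ u i j k, covThree (conn ω ψ) (fun z ↦ hatL (ω z) (ψ z)) z (f u) (f i) (f j) (f k) =
        1 / 2 * (s u i * omC j k + s u j * omC k i + s u k * omC i j) := by
  have hJ (j : Fin 6) : cplxL (ω z) (ψ z) (f j) = sJ j • f (mJ j) := hf.cplx j
  have hψ := (h.smooth_psi z hz).differentiableAt (by simp)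
  have hω := (h.smooth_omega z hz).differentiableAt (by simp)
  have p1 (i j k : Fin 6) : ψ z ![f i, f j, f k] = psC i j k := hf.psi i j k
  have alt (u : Fin 6) : IsAlt2 fun i j ↦ covTwo (conn ω ψ) ω z (f u) (f i) (f j) :=
    fun i j ↦ covTwo_swap ω _ _ _
  have type (u i j : Fin 6) : sJ i * covTwo (conn ω ψ) ω z (f u) (f (mJ i)) (f j) =
      sJ j * covTwo (conn ω ψ) ω z (f u) (f i) (f (mJ j)) := by
    have := h.covTwo_cplx hz (f u) (f i) (f j)
    simpa only [hJ, map_smul, LinearMap.smul_apply, smul_eq_mul] using this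
  have hK (u i j k : Fin 6) : ψ z ![covEndo (conn ω ψ) (fun z ↦ cplxL (ω z) (ψ z)) z (f u) (f i),
      f j, f k] = ∑ m, covTwo (conn ω ψ) ω z (f u) (f i) (f m) * psC m j k := by
    rw [eq_sum_metric hf (covEndo _ _ _ _ _)]
    simp only [h.metric_covEndo hz, ← tril_apply_continuous, map_sum, map_smul,
      LinearMap.sum_apply, LinearMap.smul_apply, smul_eq_mul]
    exact Finset.sum_congr rfl fun m _ ↦ by rw [tril_apply_continuous, p1]
  have hK' (u i j k : Fin 6) : ψ z ![f i,
      covEndo (conn ω ψ) (fun z ↦ cplxL (ω z) (ψ z)) z (f u) (f j), f k] =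
      ∑ m, covTwo (conn ω ψ) ω z (f u) (f j) (f m) * psC i m k := by
    rw [eq_sum_metric hf (covEndo _ _ _ _ _)]
    simp only [h.metric_covEndo hz, ← tril_apply_continuous, map_sum, map_smul,
      LinearMap.sum_apply, LinearMap.smul_apply, smul_eq_mul]
    exact Finset.sum_congr rfl fun m _ ↦ by rw [tril_apply_continuous, p1]
  choose s hs using fun u ↦ (alt u).eq_contraction (type u)
  -- A contraction of ψ̂ has no component along ω, so the right-hand side of `normalized_deriv`
  -- vanishes.
  have tr (u : Fin 6) : covTwo (conn ω ψ) ω z (f u) (f 0) (f 1)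
      + covTwo (conn ω ψ) ω z (f u) (f 2) (f 3) + covTwo (conn ω ψ) ω z (f u) (f 4) (f 5) = 0 := by
    simp only [hs, Fin.sum_univ_six, isAlt3_qsC.rules, qsC_sorted]
    ring
  choose q hX hY using fun u ↦ dPsiComp_of_type (hs u) (type u)
    (X := fun i j k ↦ covThree (conn ω ψ) ψ z (f u) (f i) (f j) (f k))
    ⟨fun _ _ _ ↦ covThree_swap_left _ _ _ _ _, fun _ _ _ ↦ covThree_swap_right _ _ _ _ _⟩
    (fun i j k ↦ by
      have := h.covThree_psi_cplx hz (f u) (f i) (f j) (f k)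
      simpa only [hK, hK', hJ, map_smul, LinearMap.smul_apply, smul_eq_mul] using this)
    (Y := fun i j k ↦ covThree (conn ω ψ) (fun z ↦ hatL (ω z) (ψ z)) z (f u) (f i) (f j) (f k))
    ⟨fun _ _ _ ↦ covThree_swap_left _ _ _ _ _, fun _ _ _ ↦ covThree_swap_right _ _ _ _ _⟩
    (fun i j k ↦ by
      have := h.covThree_hat hz (f u) (f i) (f j) (f k)
      simpa only [hK, hJ, map_smul, LinearMap.smul_apply, smul_eq_mul] using this)
    (by rw [h.normalized_deriv hz hf, tr, mul_zero])
  -- Closedness of ω and ψ enters only here, through the alternations of ∇ω and ∇ψ.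
  obtain ⟨hq, h1, h2, h3⟩ := torsion_symmetries (s := s) (q := q) hs
    (fun i j k ↦ by
      rw [← extDeriv_two_eq_cov hω (h.conn_symm hz), h.closed_omega z hz]; rfl)
    (fun i j k l ↦ by
      simp only [← hX]
      rw [← extDeriv_three_eq_cov hψ (h.conn_symm hz), h.closed_psi z hz]; rfl)
  refine ⟨s, h1, h2, h3, hs, fun u i j k ↦ ?_⟩
  rw [hY, dHatComp, hq]
  ring

end IsLocalSHF

end FirstOrder

/-! ### The Ricci tensor in terms of the torsion: frame computations -/

section SecondOrderAlgebra

/-- The components of `∇ω` in terms of the torsion. -/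
def dOmegaComp (s : Fin 6 → Fin 6 → ℝ) (u i j : Fin 6) : ℝ := -(1 / 2) * ∑ m, s u m * qsC m i j

/-- The components of `∇∇ω` in terms of the torsion and its covariant derivative. -/
def hessComp (s : Fin 6 → Fin 6 → ℝ) (S : Fin 6 → Fin 6 → Fin 6 → ℝ) (u v i j : Fin 6) : ℝ :=
  -(1 / 2) * ∑ m, (s v m * dHatComp (s u) 0 m i j + S u v m * qsC m i j)

/-- The part of `∇∇ψ̂` that determines the Ricci form. -/
def hessHatComp (s : Fin 6 → Fin 6 → ℝ) (u v : Fin 6) : ℝ :=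
  1 / 2 * (s v 0 * dOmegaComp s u 2 4 + s v 2 * dOmegaComp s u 4 0 + s v 4 * dOmegaComp s u 0 2)

/-- The components of the exterior derivative of a `2`-form with covariant derivative `S`. -/
def altComp (S : Fin 6 → Fin 6 → Fin 6 → ℝ) (i j k : Fin 6) : ℝ := S i j k + S j k i + S k i j

/-- The components of a `2`-form in the fundamental representation of `SU(3)`. -/
structure IsTorsionComp (s : Fin 6 → Fin 6 → ℝ) : Prop where
  alt : IsAlt2 s
  type : ∀ i j, sJ i * s (mJ i) j = -(sJ j * s i (mJ j))
  trace : s 0 1 + s 2 3 + s 4 5 = 0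

/-- The components of the covariant derivative of the torsion. -/
structure IsTorsionDerivComp (s : Fin 6 → Fin 6 → ℝ) (S : Fin 6 → Fin 6 → Fin 6 → ℝ) : Prop where
  alt : ∀ u, IsAlt2 (S u)
  type : ∀ u i j, sJ i * S u (mJ i) j + sJ j * S u i (mJ j) +
    ∑ m, (dOmegaComp s u i m * s m j + dOmegaComp s u j m * s i m) = 0
  trace : ∀ u, S u 0 1 + S u 2 3 + S u 4 5 = 0

theorem IsTorsionComp.values {s : Fin 6 → Fin 6 → ℝ} (h : IsTorsionComp s) :
    s 1 2 = -s 0 3 ∧ s 1 3 = s 0 2 ∧ s 1 4 = -s 0 5 ∧ s 1 5 = s 0 4 ∧ s 3 4 = -s 2 5 ∧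
      s 3 5 = s 2 4 ∧ s 4 5 = -s 0 1 - s 2 3 := by
  have h1 := h.type 0 2; have h2 := h.type 0 3; have h3 := h.type 0 4; have h4 := h.type 0 5
  have h5 := h.type 2 4; have h6 := h.type 2 5
  simp only [sJ_values, mJ_values] at h1 h2 h3 h4 h5 h6
  have := h.trace
  refine ⟨?_, ?_, ?_, ?_, ?_, ?_, ?_⟩ <;> linarith

/-- ∇_u σ satisfies the linear equations of σ up to corrections quadratic in s, which come from ∇_u
J in the differentiated type condition. -/
theorem IsTorsionDerivComp.values {s : Fin 6 → Fin 6 → ℝ} {S : Fin 6 → Fin 6 → Fin 6 → ℝ}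
    (hs : IsTorsionComp s) (h : IsTorsionDerivComp s S) (u : Fin 6) :
    S u 1 2 = -S u 0 3 + 1 / 2 * (-s u 4 * s 0 1 - s u 4 * s 2 3 + s u 3 * s 2 4 + s u 1 * s 0 4
      + s u 2 * s 2 5 + s u 0 * s 0 5) ∧
    S u 1 3 = S u 0 2 - 1 / 2 * (-s u 5 * s 0 1 - s u 5 * s 2 3 + s u 3 * s 2 5 - s u 0 * s 0 4
      - s u 2 * s 2 4 + s u 1 * s 0 5) ∧
    S u 1 4 = -S u 0 5 + 1 / 2 * (s u 5 * s 2 4 - s u 1 * s 0 2 - s u 4 * s 2 5 - s u 0 * s 0 3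
      - s u 2 * s 2 3) ∧
    S u 1 5 = S u 0 4 - 1 / 2 * (-s u 5 * s 2 5 + s u 0 * s 0 2 - s u 4 * s 2 4 - s u 1 * s 0 3
      - s u 3 * s 2 3) ∧
    S u 3 4 = -S u 2 5 + 1 / 2 * (-s u 5 * s 0 4 - s u 3 * s 0 2 + s u 4 * s 0 5 + s u 2 * s 0 3
      + s u 0 * s 0 1) ∧
    S u 3 5 = S u 2 4 - 1 / 2 * (s u 5 * s 0 5 + s u 2 * s 0 2 + s u 4 * s 0 4 + s u 3 * s 0 3
      + s u 1 * s 0 1) ∧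
    S u 4 5 = -S u 0 1 - S u 2 3 := by
  have h1 := h.type u 0 2; have h2 := h.type u 0 3; have h3 := h.type u 0 4
  have h4 := h.type u 0 5; have h5 := h.type u 2 4; have h6 := h.type u 2 5
  simp only [sJ_values, mJ_values, Fin.sum_univ_six, dOmegaComp, isAlt3_qsC.rules, qsC_sorted]
    at h1 h2 h3 h4 h5 h6
  simp only [hs.alt.rules, hs.values] at h1 h2 h3 h4 h5 h6
  have := h.trace u
  refine ⟨?_, ?_, ?_, ?_, ?_, ?_, by linarith⟩
  · linear_combination h1
  · linear_combination h2
  · linear_combination h3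
  · linear_combination h4
  · linear_combination h5
  · linear_combination h6

variable {R : Fin 6 → Fin 6 → Fin 6 → Fin 6 → ℝ} {s : Fin 6 → Fin 6 → ℝ}
  {S : Fin 6 → Fin 6 → Fin 6 → ℝ}

/-- `h1` is the Ricci identity for ω and `h2` that for ψ̂ on (f₀, f₂, f₄). Contracting `h1` yields
Ric(J·, ·) and the sum of R(k, u, Jk, z) over k. By the Bianchi identity that sum is the trace of
R(u, z) over complex lines, which is the left-hand side of `h2` up to sign. -/
theorem ricci_cplx_eq (r1 : ∀ u v w x, R u v w x = -R v u w x)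
    (r3 : ∀ u v w x, R u v w x = R w x u v)
    (rb : ∀ u v w x, R u v w x + R v w u x + R w u v x = 0)
    (h1 : ∀ u v w z, hessComp s S u v w z - hessComp s S v u w z =
      sJ z * R u v w (mJ z) + sJ w * R u v (mJ w) z)
    (h2 : ∀ u v, -(R u v 0 1 + R u v 2 3 + R u v 4 5) = hessHatComp s u v - hessHatComp s v u)
    (z u : Fin 6) : sJ z * ∑ k, R k u (mJ z) k = hessHatComp s z u - hessHatComp s u z
      + ∑ k, (hessComp s S u k k z - hessComp s S k u k z) := by
  have e (k : Fin 6) : hessComp s S u k k z - hessComp s S k u k z =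
      sJ z * R k u (mJ z) k - sJ k * R k u (mJ k) z := by
    have r2 : R k u k (mJ z) = -R k u (mJ z) k := by
      rw [r3, r1, r3]
    linear_combination -h1 k u k z - sJ z * r2
  -- This is the Bianchi identity together with the pair symmetries; it is used with l = Jk.
  have b (k l : Fin 6) : R k u l z - R l u k z = R u z k l := by
    linear_combination rb k u l z - r1 l u k z - r1 l k u z + r3 k l u z
  simp only [e, Finset.sum_sub_distrib, ← Finset.mul_sum]
  have := h2 u z
  simp only [Fin.sum_univ_six, sJ_values, mJ_values]
  linarith [b 0 1, b 2 3, b 4 5]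

/-- The components of the non-Hermitian part of the derivative of the torsion. -/
def nuComp (s : Fin 6 → Fin 6 → ℝ) (S : Fin 6 → Fin 6 → Fin 6 → ℝ) (i j k : Fin 6) : ℝ :=
  altComp S i j k - (∑ i, ∑ j, s i j * s i j) / 8 * psC i j k

/-- The expression of the Ricci tensor in terms of the torsion. -/
def ricciComp (s : Fin 6 → Fin 6 → ℝ) (ν : Fin 6 → Fin 6 → Fin 6 → ℝ) (z u : Fin 6) : ℝ :=
  -(1 / 4) * (∑ k, ∑ m, ν k m u * psC k m z) + 1 / 2 * ∑ m, s z m * s u m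
    - if z = u then (∑ i, ∑ j, s i j * s i j) / 8 else 0

/-- Only dσ survives from ∇σ: contraction with ψ̂ antisymmetrises two indices, and ∇_u σ itself is
of type (1,1) up to terms quadratic in s. Once the dependent components are eliminated by `values`,
each of the 36 entries is a polynomial identity. -/
theorem hess_eq_ricciComp (hs : IsTorsionComp s) (hS : IsTorsionDerivComp s S) (z u : Fin 6) :
    hessHatComp s z u - hessHatComp s u z + ∑ k, (hessComp s S u k k z - hessComp s S k u k z) =
      sJ z * ricciComp s (nuComp s S) (mJ z) u := by
  fin_cases z <;>
    simp only [Fin.reduceFinMk, Fin.zero_eta, Fin.mk_one, sJ_values, mJ_values, ricciComp, nuComp,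
      hessHatComp, hessComp, dOmegaComp, dHatComp, altComp, Fin.sum_univ_six, isAlt3_qsC.rules,
      qsC_sorted, isAlt3_psC.rules, psC_sorted, isAlt2_omC.rules, omC_sorted, hs.alt.rules,
      hs.values, (hS.alt _).rules, hS.values hs, sub_zero, mul_zero, add_zero, zero_add, neg_zero,
      mul_one, one_mul, zero_mul, mul_neg, neg_neg, neg_mul] <;>
    fin_cases u <;>
    simp only [Fin.reduceFinMk, Fin.zero_eta, Fin.mk_one, hs.alt.rules, hs.values, (hS.alt _).rules,
      hS.values hs, isAlt3_psC.rules, psC_sorted, Fin.reduceEq, if_true, if_false] <;> ring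

/-- The components of a primitive `3`-form of type `(2,1) + (1,2)`. -/
structure IsPrimitiveComp (ν : Fin 6 → Fin 6 → Fin 6 → ℝ) : Prop where
  alt : IsAlt3 ν
  omega : ∀ i, ν i 0 1 + ν i 2 3 + ν i 4 5 = 0
  psi : ν 0 2 4 = ν 0 3 5 + ν 1 2 5 + ν 1 3 4
  hat : ν 1 3 5 = ν 0 2 5 + ν 0 3 4 + ν 1 2 4

variable {ν : Fin 6 → Fin 6 → Fin 6 → ℝ}

/-- The six trace conditions and the two orthogonality conditions to ψ and ψ̂ eliminate eight of the
twenty components and leave the twelve real parameters of primitive forms of type (2,1)+(1,2). -/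
theorem IsPrimitiveComp.values (h : IsPrimitiveComp ν) :
    ν 0 4 5 = -ν 0 2 3 ∧ ν 1 4 5 = -ν 1 2 3 ∧ ν 2 4 5 = -ν 0 1 2 ∧ ν 3 4 5 = -ν 0 1 3 ∧
      ν 2 3 4 = -ν 0 1 4 ∧ ν 2 3 5 = -ν 0 1 5 ∧ ν 0 2 4 = ν 0 3 5 + ν 1 2 5 + ν 1 3 4 ∧
      ν 1 3 5 = ν 0 2 5 + ν 0 3 4 + ν 1 2 4 := by
  have h0 := h.omega 0; have h1 := h.omega 1; have h2 := h.omega 2; have h3 := h.omega 3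
  have h4 := h.omega 4; have h5 := h.omega 5
  simp only [h.alt.rules] at h0 h1 h2 h3 h4 h5
  refine ⟨?_, ?_, ?_, ?_, ?_, ?_, h.psi, h.hat⟩ <;> linarith

/-- A primitive `3`-form of type `(2,1) + (1,2)` pairs with `ψ` to an anti-Hermitian tensor. -/
theorem IsPrimitiveComp.contract_cplx (h : IsPrimitiveComp ν) (z u : Fin 6) :
    sJ z * (sJ u * ∑ k, ∑ m, ν k m (mJ u) * psC k m (mJ z)) = -∑ k, ∑ m, ν k m u * psC k m z := by
  fin_cases z <;>
    simp only [Fin.reduceFinMk, Fin.zero_eta, Fin.mk_one, sJ_values, mJ_values, Fin.sum_univ_six,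
      isAlt3_psC.rules, psC_sorted, mul_zero, add_zero, zero_add, neg_zero, mul_one, one_mul,
      mul_neg, neg_neg, neg_mul] <;>
    fin_cases u <;>
    simp only [Fin.reduceFinMk, Fin.zero_eta, Fin.mk_one, sJ_values, mJ_values, h.alt.rules,
      h.values] <;> ring

/-- Contraction with ψ is injective on this space: the entries of the contracted tensor already
determine the twelve free components linearly. -/
theorem IsPrimitiveComp.eq_zero (h : IsPrimitiveComp ν)
    (h0 : ∀ z u, ∑ k, ∑ m, ν k m u * psC k m z = 0) (i j k : Fin 6) : ν i j k = 0 := by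
  have a (u) := h0 0 u; have b (u) := h0 1 u; have c (u) := h0 2 u; have d (u) := h0 3 u
  have e (u) := h0 4 u; have f (u) := h0 5 u
  simp only [Fin.sum_univ_six, isAlt3_psC.rules, psC_sorted, mul_zero, add_zero, zero_add, neg_zero,
    mul_one, mul_neg, neg_neg] at a b c d e f
  have a0 := a 0; have a1 := a 1; have a2 := a 2; have a3 := a 3; have a4 := a 4; have a5 := a 5
  have c1 := c 1; have c2 := c 2; have c3 := c 3; have c4 := c 4; have c5 := c 5
  have e1 := e 1; have e2 := e 2; have e3 := e 3; have e4 := e 4; have e5 := e 5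
  have b2 := b 2; have b3 := b 3; have d0 := d 0; have d1 := d 1
  simp only [h.alt.rules, h.values] at a0 a1 a2 a3 a4 a5 c1 c2 c3 c4 c5 e1 e2 e3 e4 e5 b2 b3 d0 d1
  refine h.alt.ext_sorted (b := fun _ _ _ ↦ 0) ⟨fun _ _ _ ↦ by simp, fun _ _ _ ↦ by simp⟩ ?_ i j k
  simp only [h.values]
  refine ⟨?_, ?_, ?_, ?_, ?_, ?_, ?_, ?_, ?_, ?_, ?_, ?_, ?_, ?_, ?_, ?_, ?_, ?_, ?_, ?_⟩ <;>
    linarith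

/-- The σ-square and the multiple of g are Hermitian because σ has type (1,1). The term -1/4 ν·ψ
changes sign, which accounts for the difference 1/2 ν·ψ. -/
theorem IsPrimitiveComp.ricciComp_cplx (h : IsPrimitiveComp ν) (hs : IsTorsionComp s)
    (z u : Fin 6) : sJ z * (sJ u * ricciComp s ν (mJ z) (mJ u)) =
      ricciComp s ν z u + 1 / 2 * ∑ k, ∑ m, ν k m u * psC k m z := by
  have h1 := h.contract_cplx z u
  have h2 : sJ z * (sJ u * ∑ m, s (mJ z) m * s (mJ u) m) = ∑ m, s z m * s u m := by
    rw [← sum_mJ fun m ↦ s z m * s u m, Finset.mul_sum, Finset.mul_sum]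
    refine Finset.sum_congr rfl fun m _ ↦ ?_
    linear_combination sJ u * s (mJ u) m * hs.type z m - sJ m * s z (mJ m) * hs.type u m
      + s z (mJ m) * s u (mJ m) * sJ_sq m
  have h3 : sJ z * (sJ u * if mJ z = mJ u then (∑ i, ∑ j, s i j * s i j) / 8 else 0) =
      if z = u then (∑ i, ∑ j, s i j * s i j) / 8 else 0 := by
    have e : mJ z = mJ u ↔ z = u := ⟨fun e ↦ by rw [← mJ_mJ z, e, mJ_mJ], fun e ↦ by rw [e]⟩
    simp only [e]
    split_ifs with hzu
    · rw [hzu, ← mul_assoc, sJ_sq, one_mul]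
    · simp
  simp only [ricciComp]
  linear_combination -(1 / 4) * h1 + 1 / 2 * h2 - h3

/-- The ν-term has trace zero since ν is orthogonal to ψ; the rest gives 1/2 - 6/8 = -1/4. -/
theorem IsPrimitiveComp.sum_ricciComp (h : IsPrimitiveComp ν) :
    ∑ z, ricciComp s ν z z = -(1 / 4) * ∑ i, ∑ j, s i j * s i j := by
  have h1 : ∑ z, ∑ k, ∑ m, ν k m z * psC k m z = 0 := by
    simp only [Fin.sum_univ_six, isAlt3_psC.rules, psC_sorted, h.alt.rules, h.values]
    ring
  simp only [ricciComp, if_true, Finset.sum_sub_distrib, Finset.sum_add_distrib, ← Finset.mul_sum,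
    h1, Finset.sum_const, Finset.card_univ, Fintype.card_fin]
  ring

theorem nuComp_alt (hS : IsTorsionDerivComp s S) : IsAlt3 (nuComp s S) := by
  have h (u i j) := hS.alt u i j
  constructor <;> intro i j k
  · simp only [nuComp, altComp, isAlt3_psC.1 i j k]
    linear_combination h i j k + h j k i + h k i j
  · simp only [nuComp, altComp, isAlt3_psC.2 i j k]
    linear_combination h i j k + h j k i + h k i j

/-- The derivative of the torsion has no further component of type `(3,0) + (0,3)`. -/
theorem isPrimitiveComp_nuComp (hs : IsTorsionComp s) (hS : IsTorsionDerivComp s S)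
    (hω : ∀ i, altComp S i 0 1 + altComp S i 2 3 + altComp S i 4 5 = 0) :
    IsPrimitiveComp (nuComp s S) := by
  refine ⟨nuComp_alt hS, fun i ↦ ?_, ?_, ?_⟩
  · have : psC i 0 1 + psC i 2 3 + psC i 4 5 = 0 := by
      have : ∀ i, psZ i 0 1 + psZ i 2 3 + psZ i 4 5 = 0 := by decide
      simp only [psC]; exact_mod_cast this i
    simp only [nuComp]
    linear_combination hω i - (∑ i, ∑ j, s i j * s i j) / 8 * this
  -- The component of dσ along ψ is quadratic in s by the formulas for ∇σ, and `nuComp` subtracts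
  -- exactly it; along ψ̂ there is none. The factor 1/8 is |σ|²/4, because the double sum counts
  -- each pair i < j twice.
  all_goals
    simp only [nuComp, altComp, Fin.sum_univ_six, psC_sorted, hs.alt.rules, hs.values,
      (hS.alt _).rules, hS.values hs]
    ring

end SecondOrderAlgebra

/-! ### Traces and norms in adapted frames -/

section Frames

variable {V : Type*} [AddCommGroup V] [Module ℝ V]

/-- The trace with respect to a metric may be computed in any basis. -/
theorem sum_gram_inv {ι : Type*} [Fintype ι] [DecidableEq ι] {b f : Module.Basis ι ℝ V}
    {g : V →ₗ[ℝ] V →ₗ[ℝ] ℝ} (hf : ∀ i j, g (f i) (f j) = if i = j then 1 else 0)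
    (B : V →ₗ[ℝ] V →ₗ[ℝ] ℝ) :
    ∑ i, ∑ j, (Matrix.of fun i j ↦ g (b i) (b j))⁻¹ i j * B (b i) (b j) = ∑ i, B (f i) (f i) := by
  set P := f.toMatrix b with hP
  set Q := b.toMatrix f with hQ
  have hPQ : P * Q = 1 := f.toMatrix_mul_toMatrix_flip b
  have hQP : Q * P = 1 := b.toMatrix_mul_toMatrix_flip f
  have hb (i : ι) : b i = ∑ a, P a i • f a := (f.sum_toMatrix_smul_self b i).symm
  -- With P the matrix of the basis `b` in the orthonormal basis `f`, the Gram matrix is PᵀP, so its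
  -- inverse is QQᵀ with Q = P⁻¹.
  have hg : (Matrix.of fun i j ↦ g (b i) (b j)) = P.transpose * P := by
    ext i j
    simp only [Matrix.of_apply, hb, map_sum, map_smul, LinearMap.sum_apply, LinearMap.smul_apply, hf,
      Matrix.mul_apply, Matrix.transpose_apply]
    simp
    exact Finset.sum_congr rfl fun _ _ ↦ mul_comm _ _
  have hi : (Matrix.of fun i j ↦ g (b i) (b j))⁻¹ = Q * Q.transpose := by
    apply Matrix.inv_eq_right_inv
    rw [hg, Matrix.mul_assoc, ← Matrix.mul_assoc P, hPQ, Matrix.one_mul, ← Matrix.transpose_mul, hQP,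
      Matrix.transpose_one]
  have hfb (a : ι) : f a = ∑ i, Q i a • b i := (b.sum_toMatrix_smul_self f a).symm
  rw [hi]
  simp only [hfb, map_sum, map_smul, LinearMap.sum_apply, LinearMap.smul_apply, smul_eq_mul,
    Matrix.mul_apply, Matrix.transpose_apply, Finset.sum_mul, Finset.mul_sum]
  rw [Finset.sum_comm]
  conv_rhs => rw [Finset.sum_comm]; enter [2, x]; rw [Finset.sum_comm]
  refine Finset.sum_congr rfl fun i _ ↦ Finset.sum_congr rfl fun j _ ↦
    Finset.sum_congr rfl fun k _ ↦ ?_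
  ring

theorem IsAdapted.metric {b f : Module.Basis (Fin 6) ℝ V} {ω : V [⋀^Fin 2]→ₗ[ℝ] ℝ}
    {ψ : V [⋀^Fin 3]→ₗ[ℝ] ℝ} (hf : IsAdapted f ω ψ (SHF.cplx b ω ψ)) (i j : Fin 6) :
    SHF.metric b ω ψ (f i) (f j) = if i = j then 1 else 0 := by
  rw [SHF.metric, hf.cplx, ← bil_apply, map_smul, bil_apply, hf.omega]
  have : ∀ i j, sZ j * omZ i (mJ j) = if i = j then 1 else 0 := by decide
  have := this i j
  simp only [sJ, omC, smul_eq_mul]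
  split_ifs at this ⊢ <;> exact_mod_cast this

theorem IsAdapted.sum_gram_inv {b f : Module.Basis (Fin 6) ℝ V} {ω : V [⋀^Fin 2]→ₗ[ℝ] ℝ}
    {ψ : V [⋀^Fin 3]→ₗ[ℝ] ℝ} (hf : IsAdapted f ω ψ (SHF.cplx b ω ψ)) (c : Module.Basis (Fin 6) ℝ V)
    (B : V →ₗ[ℝ] V →ₗ[ℝ] ℝ) :
    ∑ i, ∑ j, (Matrix.of fun i j ↦ SHF.metric b ω ψ (c i) (c j))⁻¹ i j * B (c i) (c j) =
      ∑ i, B (f i) (f i) :=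
  SHF.sum_gram_inv (g := (bil ω).compl₂ (SHF.cplx b ω ψ)) hf.metric B

/-- The squared norm of a `2`-form in an adapted basis. -/
theorem IsAdapted.normSq {b f : Module.Basis (Fin 6) ℝ V} {ω : V [⋀^Fin 2]→ₗ[ℝ] ℝ}
    {ψ : V [⋀^Fin 3]→ₗ[ℝ] ℝ} (hf : IsAdapted f ω ψ (SHF.cplx b ω ψ)) (κ : V [⋀^Fin 2]→ₗ[ℝ] ℝ) :
    SHF.normSq b ω ψ κ = 1 / 2 * ∑ i, ∑ j, κ ![f i, f j] * κ ![f i, f j] := by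
  -- The norm contracts two pairs of indices, so the trace formula is applied once to each pair.
  have h1 (v w : V) := hf.sum_gram_inv b ((LinearMap.mul ℝ ℝ).compl₁₂ ((bil κ).flip v) ((bil κ).flip w))
  have h2 (v : V) := hf.sum_gram_inv b ((LinearMap.mul ℝ ℝ).compl₁₂ (bil κ v) (bil κ v))
  simp only [LinearMap.compl₁₂_apply, LinearMap.mul_apply', LinearMap.flip_apply, bil_apply] at h1 h2
  rw [SHF.normSq]
  congr 1
  simp only [← h2]
  symm
  calc _ = ∑ j, ∑ l, (gram b ω ψ)⁻¹ j l * ∑ a, κ ![f a, b j] * κ ![f a, b l] := by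
        rw [Finset.sum_comm]
        refine Finset.sum_congr rfl fun j _ ↦ ?_
        rw [Finset.sum_comm]
        exact Finset.sum_congr rfl fun l _ ↦ (Finset.mul_sum _ _ _).symm
    _ = ∑ j, ∑ l, (gram b ω ψ)⁻¹ j l * ∑ i, ∑ k, (gram b ω ψ)⁻¹ i k * (κ ![b i, b j] * κ ![b k, b l]) := by
        refine Finset.sum_congr rfl fun j _ ↦ Finset.sum_congr rfl fun l _ ↦ ?_
        rw [← h1]
        rfl
    _ = _ := by
        rw [Finset.sum_comm (s := Finset.univ) (f := fun i j ↦ ∑ k, ∑ l, _)]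
        refine Finset.sum_congr rfl fun j _ ↦ ?_
        refine Eq.trans ?_ ((Finset.sum_congr rfl fun i _ ↦ Finset.sum_comm).trans
          Finset.sum_comm).symm
        refine Finset.sum_congr rfl fun l _ ↦ ?_
        rw [Finset.mul_sum]
        refine Finset.sum_congr rfl fun i _ ↦ ?_
        rw [Finset.mul_sum]
        exact Finset.sum_congr rfl fun k _ ↦ by ring

/-- In dimension six, wedging a `2`-form with the symplectic form is injective. -/
theorem eq_zero_of_wedge_omC {d : Fin 6 → Fin 6 → ℝ} (hd : IsAlt2 d)
    (h : ∀ i j k l, d i j * omC k l - d i k * omC j l + d i l * omC j k + d j k * omC i l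
      - d j l * omC i k + d k l * omC i j = 0) (i j : Fin 6) : d i j = 0 := by
  have h1 := h 0 1 2 3; have h2 := h 0 1 4 5; have h3 := h 2 3 4 5
  have a1 := h 0 2 4 5; have a2 := h 0 3 4 5; have a3 := h 0 4 2 3; have a4 := h 0 5 2 3
  have a5 := h 1 2 4 5; have a6 := h 1 3 4 5; have a7 := h 1 4 2 3; have a8 := h 1 5 2 3
  have a9 := h 2 4 0 1; have b1 := h 2 5 0 1; have b2 := h 3 4 0 1; have b3 := h 3 5 0 1
  simp only [isAlt2_omC.rules, omC_sorted] at h1 h2 h3 a1 a2 a3 a4 a5 a6 a7 a8 a9 b1 b2 b3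
  refine hd.ext_sorted (b := fun _ _ ↦ 0) (fun _ _ ↦ by simp) ?_ i j
  refine ⟨?_, ?_, ?_, ?_, ?_, ?_, ?_, ?_, ?_, ?_, ?_, ?_, ?_, ?_, ?_⟩ <;> linarith

theorem IsAdapted.eq_of_wedge_eq {f : Module.Basis (Fin 6) ℝ V} {ω : V [⋀^Fin 2]→ₗ[ℝ] ℝ}
    {ψ : V [⋀^Fin 3]→ₗ[ℝ] ℝ} {J : V →ₗ[ℝ] V} (hf : IsAdapted f ω ψ J) {s : Fin 6 → Fin 6 → ℝ}
    (hs : IsAlt2 s) (κ : V [⋀^Fin 2]→ₗ[ℝ] ℝ)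
    (h : ∀ i j k l, wedge κ ω ![f i, f j, f k, f l] = s i j * omC k l - s i k * omC j l
      + s i l * omC j k + s j k * omC i l - s j l * omC i k + s k l * omC i j) (i j : Fin 6) :
    κ ![f i, f j] = s i j := by
  rw [← sub_eq_zero]
  refine eq_zero_of_wedge_omC (d := fun i j ↦ κ ![f i, f j] - s i j) (fun i j ↦ ?_)
    (fun i j k l ↦ ?_) i j
  · linear_combination isAlt2_form κ f i j - hs i j
  · have := h i j k l
    rw [wedge_two_two] at this
    simp only [hf.omega] at this
    linear_combination this

/-- The contraction of `s ∧ ω` with the inverse of `ω`. -/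
theorem IsTorsionComp.contract {s : Fin 6 → Fin 6 → ℝ} (hs : IsTorsionComp s) (k l : Fin 6) :
    1 / 2 * ∑ i, sJ i * (s i (mJ i) * omC k l - s i k * omC (mJ i) l
      + s i l * omC (mJ i) k + s (mJ i) k * omC i l - s (mJ i) l * omC i k + s k l * omC i (mJ i)) =
    s k l := by
  refine IsAlt2.ext_sorted (a := fun k l ↦ 1 / 2 * ∑ i, sJ i * (s i (mJ i) * omC k l
    - s i k * omC (mJ i) l + s i l * omC (mJ i) k + s (mJ i) k * omC i l - s (mJ i) l * omC i k
    + s k l * omC i (mJ i))) (fun k l ↦ ?_) hs.alt ?_ k l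
  · simp only [Fin.sum_univ_six, hs.alt k l, isAlt2_omC k l]
    ring
  · simp only [Fin.sum_univ_six, sJ_values, mJ_values, isAlt2_omC.rules, omC_sorted, hs.alt.rules,
      hs.values]
    refine ⟨?_, ?_, ?_, ?_, ?_, ?_, ?_, ?_, ?_, ?_, ?_, ?_, ?_, ?_, ?_⟩ <;> ring

end Frames

/-! ### Existence, uniqueness and smoothness of the local torsion form -/

section LocalTorsion

local notation "E₆" => EuclideanSpace ℝ (Fin 6)

variable {U : Set E₆} {ω σ : E₆ → E₆ [⋀^Fin 2]→L[ℝ] ℝ} {ψ : E₆ → E₆ [⋀^Fin 3]→L[ℝ] ℝ} {z : E₆}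

theorem contDiffAt_extDeriv {k : ℕ} {α : E₆ → E₆ [⋀^Fin k]→L[ℝ] ℝ}
    (hα : ContDiffAt ℝ ((⊤ : ℕ∞) : WithTop ℕ∞) α z) :
    ContDiffAt ℝ ((⊤ : ℕ∞) : WithTop ℕ∞) (extDeriv α) z :=
  (ContinuousAlternatingMap.alternatizeUncurryFinCLM ℝ E₆ ℝ).contDiff.contDiffAt.comp z
    (hα.fderiv_right (by simp))

theorem ext_of_basis {W : Type*} [AddCommGroup W] [Module ℝ W] {k : ℕ} (f : Module.Basis (Fin 6) ℝ W)
    {α β : W [⋀^Fin k]→ₗ[ℝ] ℝ} (h : ∀ r : Fin k → Fin 6, α (fun i ↦ f (r i)) = β fun i ↦ f (r i)) :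
    α = β := f.ext_alternating fun r _ ↦ h r

theorem two_ext {W : Type*} [AddCommGroup W] [Module ℝ W] (f : Module.Basis (Fin 6) ℝ W)
    {α β : W [⋀^Fin 2]→ₗ[ℝ] ℝ} (h : ∀ i j, α ![f i, f j] = β ![f i, f j]) : α = β := by
  refine ext_of_basis f fun r ↦ ?_
  have e : (fun i ↦ f (r i)) = ![f (r 0), f (r 1)] := by ext1 i; fin_cases i <;> rfl
  rw [e, h]

theorem three_ext {W : Type*} [AddCommGroup W] [Module ℝ W] (f : Module.Basis (Fin 6) ℝ W)
    {α β : W [⋀^Fin 3]→ₗ[ℝ] ℝ} (h : ∀ i j k, α ![f i, f j, f k] = β ![f i, f j, f k]) : α = β := by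
  refine ext_of_basis f fun r ↦ ?_
  have e : (fun i ↦ f (r i)) = ![f (r 0), f (r 1), f (r 2)] := by ext1 i; fin_cases i <;> rfl
  rw [e, h]

theorem four_ext {W : Type*} [AddCommGroup W] [Module ℝ W] (f : Module.Basis (Fin 6) ℝ W)
    {α β : W [⋀^Fin 4]→ₗ[ℝ] ℝ}
    (h : ∀ i j k l, α ![f i, f j, f k, f l] = β ![f i, f j, f k, f l]) : α = β := by
  refine ext_of_basis f fun r ↦ ?_
  have e : (fun i ↦ f (r i)) = ![f (r 0), f (r 1), f (r 2), f (r 3)] := by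
    ext1 i; fin_cases i <;> rfl
  rw [e, h]

set_option maxRecDepth 4000 in
theorem wedge_square_eq_zero {W : Type*} [AddCommGroup W] [Module ℝ W]
    (f : Module.Basis (Fin 6) ℝ W) {κ ω : W [⋀^Fin 2]→ₗ[ℝ] ℝ} (hω : ∀ i j, ω ![f i, f j] = omC i j)
    (h : κ ![f 0, f 1] + κ ![f 2, f 3] + κ ![f 4, f 5] = 0) : wedge κ (wedge ω ω) = 0 := by
  have key (γ : W [⋀^Fin 6]→ₗ[ℝ] ℝ) (hγ : γ ![f 0, f 1, f 2, f 3, f 4, f 5] = 0) : γ = 0 := by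
    rw [γ.eq_smul_basis_det f, apply_six γ f, hγ, zero_smul]
  have hw := wedge_two_four κ (wedge ω ω) (f 0) (f 1) (f 2) (f 3) (f 4) (f 5)
  simp only [wedge_two_two, hω, omC_sorted] at hw
  exact key (wedge κ (wedge ω ω)) (hw.trans (by linarith))

/-- `κ` is the intrinsic torsion form of a symplectic half-flat structure at the point `z`. -/
structure IsTorsionAt (ω : E₆ → E₆ [⋀^Fin 2]→L[ℝ] ℝ) (ψ : E₆ → E₆ [⋀^Fin 3]→L[ℝ] ℝ) (z : E₆)
    (κ : E₆ [⋀^Fin 2]→L[ℝ] ℝ) : Prop where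
  primitive : IsPrimitive11 stdBasis (ω z).toAlternatingMap (ψ z).toAlternatingMap
    κ.toAlternatingMap
  d_hat : (extDeriv (fun z ↦ hatL (ω z) (ψ z)) z).toAlternatingMap =
    wedge κ.toAlternatingMap (ω z).toAlternatingMap

/-- The intrinsic torsion form of a symplectic half-flat structure on an open subset of `ℝ⁶`. -/
def torsionL (ω : E₆ → E₆ [⋀^Fin 2]→L[ℝ] ℝ) (ψ : E₆ → E₆ [⋀^Fin 3]→L[ℝ] ℝ) (z : E₆) :
    E₆ [⋀^Fin 2]→L[ℝ] ℝ :=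
  (1 / 2 : ℝ) • ∑ i, ∑ j, (entries (fun z ↦ metricL (ω z) (ψ z)) z)⁻¹ i j •
    ((extDeriv (fun z ↦ hatL (ω z) (ψ z)) z).curryLeft (EuclideanSpace.single i 1)).curryLeft
      (cplxL (ω z) (ψ z) (EuclideanSpace.single j 1))

namespace IsLocalSHF

theorem exists_adapted (h : IsLocalSHF U ω ψ) (hz : z ∈ U) :
    ∃ f : Module.Basis (Fin 6) ℝ E₆, Adapted f (ω z) (ψ z) := (h.isSU3 z hz).exists_adapted

theorem extDeriv_hat_frame (h : IsLocalSHF U ω ψ) (hz : z ∈ U) {f : Module.Basis (Fin 6) ℝ E₆}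
    {s : Fin 6 → Fin 6 → ℝ} (hs : IsAlt2 s)
    (hh : ∀ u i j k, covThree (conn ω ψ) (fun z ↦ hatL (ω z) (ψ z)) z (f u) (f i) (f j) (f k) =
        1 / 2 * (s u i * omC j k + s u j * omC k i + s u k * omC i j)) (i j k l : Fin 6) :
    extDeriv (fun z ↦ hatL (ω z) (ψ z)) z ![f i, f j, f k, f l] =
      s i j * omC k l - s i k * omC j l + s i l * omC j k + s j k * omC i l
        - s j l * omC i k + s k l * omC i j := by
  rw [extDeriv_three_eq_cov ((h.smooth_hat hz).differentiableAt (by simp)) (h.conn_symm hz),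
    hh, hh, hh, hh, hs j i, hs k i, hs k j, hs l i, hs l j, hs l k, isAlt2_omC l j, isAlt2_omC l i,
    isAlt2_omC k i]
  ring

/-- `torsionL` contracts dψ̂ with the inverse of ω. Its coordinate formula is visibly smooth, and
being a metric trace it can be evaluated in any adapted frame. There it recovers s from s ∧ ω,
because s is primitive. -/
theorem torsionL_frame (h : IsLocalSHF U ω ψ) (hz : z ∈ U) {f : Module.Basis (Fin 6) ℝ E₆}
    (hf : Adapted f (ω z) (ψ z)) {s : Fin 6 → Fin 6 → ℝ} (hs : IsTorsionComp s)
    (hh : ∀ u i j k, covThree (conn ω ψ) (fun z ↦ hatL (ω z) (ψ z)) z (f u) (f i) (f j) (f k) =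
        1 / 2 * (s u i * omC j k + s u j * omC k i + s u k * omC i j)) (k l : Fin 6) :
    torsionL ω ψ z ![f k, f l] = s k l := by
  set β := extDeriv (fun z ↦ hatL (ω z) (ψ z)) z with hβ
  have hJ (j : Fin 6) : cplxL (ω z) (ψ z) (f j) = sJ j • f (mJ j) := hf.cplx j
  let B : E₆ →ₗ[ℝ] E₆ →ₗ[ℝ] ℝ := LinearMap.mk₂ ℝ
    (fun v w ↦ ((β.curryLeft v).curryLeft (cplxL (ω z) (ψ z) w)) ![f k, f l])
    (fun u v w ↦ by simp) (fun c v w ↦ by simp) (fun u v w ↦ by simp) (fun c v w ↦ by simp)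
  have h1 := hf.sum_gram_inv stdBasis B
  have h2 : torsionL ω ψ z ![f k, f l] = 1 / 2 * ∑ i, ∑ j,
      (entries (fun z ↦ metricL (ω z) (ψ z)) z)⁻¹ i j *
        B (EuclideanSpace.single i 1) (EuclideanSpace.single j 1) := by
    simp only [torsionL, ContinuousAlternatingMap.smul_apply, ContinuousAlternatingMap.sum_apply,
      smul_eq_mul]
    rfl
  simp only [stdBasis_apply] at h1
  have h3 (i : Fin 6) : B (f i) (f i) = sJ i * β ![f i, f (mJ i), f k, f l] := by
    change ((β.curryLeft (f i)).curryLeft (cplxL (ω z) (ψ z) (f i))) ![f k, f l] = _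
    rw [hJ, map_smul]
    rfl
  rw [h2, ← hs.contract k l]
  congr 1
  refine h1.trans (Finset.sum_congr rfl fun i _ ↦ ?_)
  rw [h3, hβ, h.extDeriv_hat_frame hz hs.alt hh]

theorem smooth_torsionL (h : IsLocalSHF U ω ψ) (hz : z ∈ U) :
    ContDiffAt ℝ ((⊤ : ℕ∞) : WithTop ℕ∞) (torsionL ω ψ) z := by
  have hg := h.smooth_metric hz
  have hi := contDiffAt_matrix_inv (A := entries fun z ↦ metricL (ω z) (ψ z)) (y := z)
    (fun i j ↦ (hg.clm_apply contDiffAt_const).clm_apply contDiffAt_const)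
    (entries_det_ne_zero (h.metric_nondeg hz))
  have hd := contDiffAt_extDeriv (h.smooth_hat hz)
  have key (i j : Fin 6) : ContDiffAt ℝ ((⊤ : ℕ∞) : WithTop ℕ∞) (fun z ↦
      ((extDeriv (fun z ↦ hatL (ω z) (ψ z)) z).curryLeft (EuclideanSpace.single i 1)).curryLeft
      (cplxL (ω z) (ψ z) (EuclideanSpace.single j 1))) z := by
    refine contDiffAt_form_of_basis fun r ↦ ?_
    refine (contDiffAt_form_apply (V := ![fun _ ↦ EuclideanSpace.single i 1,
      fun z ↦ cplxL (ω z) (ψ z) (EuclideanSpace.single j 1), fun _ ↦ stdBasis (r 0),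
      fun _ ↦ stdBasis (r 1)]) hd fun i ↦ ?_).congr_of_eventuallyEq (.of_forall fun y ↦ ?_)
    · fin_cases i
      · exact contDiffAt_const
      · exact (h.smooth_cplx hz).clm_apply contDiffAt_const
      · exact contDiffAt_const
      · exact contDiffAt_const
    · simp only [ContinuousAlternatingMap.curryLeft_apply_apply]
      congr 1
      ext1 i
      fin_cases i <;> rfl
  have hs (i j : Fin 6) := (hi i j).smul (key i j)
  exact ContDiffAt.const_smul (1 / 2 : ℝ) (ContDiffAt.sum fun i _ ↦ ContDiffAt.sum fun j _ ↦ hs i j)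

/-- Wedging with ω is injective on 2-forms, so any κ with dψ̂ = κ ∧ ω has the components s found by
`exists_torsion` and controls ∇ω and ∇ψ̂. -/
theorem isTorsionComp_torsion (h : IsLocalSHF U ω ψ) (hz : z ∈ U) {f : Module.Basis (Fin 6) ℝ E₆}
    (hf : Adapted f (ω z) (ψ z)) {κ : E₆ [⋀^Fin 2]→L[ℝ] ℝ} (hκ : IsTorsionAt ω ψ z κ) :
    IsTorsionComp (fun i j ↦ κ ![f i, f j]) ∧
      (∀ u i j, covTwo (conn ω ψ) ω z (f u) (f i) (f j) =
        dOmegaComp (fun i j ↦ κ ![f i, f j]) u i j) ∧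
      ∀ u i j k, covThree (conn ω ψ) (fun z ↦ hatL (ω z) (ψ z)) z (f u) (f i) (f j) (f k) =
        dHatComp (fun i ↦ κ ![f u, f i]) 0 i j k := by
  obtain ⟨s, h1, h2, h3, h4, h5⟩ := h.exists_torsion hz hf
  have e (i j : Fin 6) : κ ![f i, f j] = s i j :=
    IsAdapted.eq_of_wedge_eq hf h1 κ.toAlternatingMap (fun i j k l ↦ by
      rw [← hκ.d_hat, ← h.extDeriv_hat_frame hz h1 h5]; rfl) i j
  simp only [e]
  exact ⟨⟨h1, h2, h3⟩, h4, fun u i j k ↦ by rw [h5, dHatComp]; ring⟩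

theorem isTorsionAt_torsionL (h : IsLocalSHF U ω ψ) (hz : z ∈ U) :
    IsTorsionAt ω ψ z (torsionL ω ψ z) := by
  obtain ⟨f, hf⟩ := h.exists_adapted hz
  obtain ⟨s, h1, h2, h3, h4, h5⟩ := h.exists_torsion hz hf
  have e : ∀ i j, (torsionL ω ψ z).toAlternatingMap ![f i, f j] = s i j :=
    h.torsionL_frame hz hf ⟨h1, h2, h3⟩ h5
  refine ⟨⟨?_, ?_⟩, ?_⟩
  · refine wedge_square_eq_zero f hf.omega ?_
    rw [e, e, e, h3]
  · refine two_ext f fun i j ↦ ?_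
    rw [compLinearMap_two, hf.cplx, hf.cplx, e, ← bil_apply]
    simp only [map_smul, LinearMap.smul_apply, bil_apply, e, smul_eq_mul]
    have := h2 i (mJ j)
    rw [mJ_mJ, sJ_mJ] at this
    linear_combination sJ j * this + s i j * sJ_sq j
  · refine four_ext f fun i j k l ↦ ?_
    rw [wedge_two_two]
    simp only [hf.omega, e]
    exact h.extDeriv_hat_frame hz h1 h5 i j k l

theorem torsion_unique (h : IsLocalSHF U ω ψ) (hz : z ∈ U) {κ : E₆ [⋀^Fin 2]→L[ℝ] ℝ}
    (hκ : IsTorsionAt ω ψ z κ) : κ = torsionL ω ψ z := by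
  obtain ⟨f, hf⟩ := h.exists_adapted hz
  obtain ⟨s, h1, h2, h3, h4, h5⟩ := h.exists_torsion hz hf
  refine ContinuousAlternatingMap.toAlternatingMap_injective (two_ext f fun i j ↦ ?_)
  have e := h.torsionL_frame hz hf ⟨h1, h2, h3⟩ h5 i j
  refine (IsAdapted.eq_of_wedge_eq hf h1 κ.toAlternatingMap (fun i j k l ↦ ?_) i j).trans e.symm
  rw [← hκ.d_hat, ← h.extDeriv_hat_frame hz h1 h5]; rfl

end IsLocalSHF

end LocalTorsion

/-! ### Tensorial formulas for ∇ω and ∇ψ̂ -/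

section SecondOrder

local notation "E₆" => EuclideanSpace ℝ (Fin 6)

variable {U : Set E₆} {ω σ : E₆ → E₆ [⋀^Fin 2]→L[ℝ] ℝ} {ψ : E₆ → E₆ [⋀^Fin 3]→L[ℝ] ℝ} {z : E₆}

/-- The intrinsic torsion form of a symplectic half-flat structure on an open set. -/
structure IsLocalTorsion (U : Set E₆) (ω : E₆ → E₆ [⋀^Fin 2]→L[ℝ] ℝ)
    (ψ : E₆ → E₆ [⋀^Fin 3]→L[ℝ] ℝ) (σ : E₆ → E₆ [⋀^Fin 2]→L[ℝ] ℝ) : Prop where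
  smooth : ∀ z ∈ U, ContDiffAt ℝ ((⊤ : ℕ∞) : WithTop ℕ∞) σ z
  torsion : ∀ z ∈ U, IsTorsionAt ω ψ z (σ z)

/-- A `2`-form on `ℝ⁶` as a continuous bilinear map. -/
def bilL (α : E₆ [⋀^Fin 2]→L[ℝ] ℝ) : E₆ →L[ℝ] E₆ →L[ℝ] ℝ :=
  LinearMap.toContinuousLinearMap (LinearMap.toContinuousLinearMap.toLinearMap ∘ₗ
    bil α.toAlternatingMap)

theorem bilL_apply (α : E₆ [⋀^Fin 2]→L[ℝ] ℝ) (u v : E₆) : bilL α u v = α ![u, v] := rfl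

/-- The endomorphism obtained from a `2`-form by raising an index. -/
def shape (ω : E₆ → E₆ [⋀^Fin 2]→L[ℝ] ℝ) (ψ : E₆ → E₆ [⋀^Fin 3]→L[ℝ] ℝ)
    (σ : E₆ → E₆ [⋀^Fin 2]→L[ℝ] ℝ) (z : E₆) : E₆ →L[ℝ] E₆ :=
  ∑ i, ∑ j, (entries (fun z ↦ metricL (ω z) (ψ z)) z)⁻¹ i j •
    ((bilL (σ z)).flip (EuclideanSpace.single j 1)).smulRight (EuclideanSpace.single i (1 : ℝ))

theorem shape_apply (v : E₆) : shape ω ψ σ z v =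
    ∑ i, ∑ j, ((entries (fun z ↦ metricL (ω z) (ψ z)) z)⁻¹ i j *
      σ z ![v, EuclideanSpace.single j 1]) • EuclideanSpace.single i (1 : ℝ) := by
  simp only [shape, sum_apply, smul_apply, ContinuousLinearMap.smulRight_apply,
    ContinuousLinearMap.flip_apply, bilL_apply, smul_smul]

/-- The curvature as a trilinear map. -/
def riemL {E : Type*} [NormedAddCommGroup E] [NormedSpace ℝ E] (Γ : E → E →L[ℝ] E →L[ℝ] E) (y : E) :
    E →ₗ[ℝ] E →ₗ[ℝ] E →ₗ[ℝ] E :=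
  LinearMap.mk₂ ℝ (fun u v ↦ ((fderiv ℝ Γ y u v - fderiv ℝ Γ y v u + Γ y u ∘L Γ y v
      - Γ y v ∘L Γ y u : E →L[ℝ] E) : E →ₗ[ℝ] E))
    (fun u v w ↦ by ext x; simp; abel) (fun c v w ↦ by ext x; simp [smul_sub, smul_add])
    (fun u v w ↦ by ext x; simp; abel) (fun c v w ↦ by ext x; simp [smul_sub, smul_add])

theorem riemL_apply {E : Type*} [NormedAddCommGroup E] [NormedSpace ℝ E]
    (Γ : E → E →L[ℝ] E →L[ℝ] E) (y u v w : E) : riemL Γ y u v w = riem Γ y u v w := rfl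

namespace IsLocalSHF

theorem smooth_bilL (hσ : ContDiffAt ℝ ((⊤ : ℕ∞) : WithTop ℕ∞) σ z) :
    ContDiffAt ℝ ((⊤ : ℕ∞) : WithTop ℕ∞) (fun z ↦ bilL (σ z)) z :=
  contDiffAt_clm_of_apply fun _ ↦ contDiffAt_clm_of_apply fun _ ↦
    contDiffAt_two_apply hσ contDiffAt_const contDiffAt_const

theorem fderiv_bilL (hσ : ContDiffAt ℝ ((⊤ : ℕ∞) : WithTop ℕ∞) σ z) (u a b : E₆) :
    fderiv ℝ (fun z ↦ bilL (σ z)) z u a b = fderiv ℝ σ z u ![a, b] := by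
  have hc (a : E₆) := hasFDerivAt_const (𝕜 := ℝ) a z
  have h1 := (hasFDerivAt_bilin ((smooth_bilL hσ).differentiableAt (by simp)) (hc a) (hc b)).2 u
  have h2 := (hasFDerivAt_two (hσ.differentiableAt (by simp)) (hc a) (hc b)).2 u
  simp only [bilL_apply] at h1
  rw [h2] at h1
  simp only [← bil_apply_continuous] at h1 ⊢
  simp [-bil_apply] at h1
  exact h1.symm

theorem smooth_shape (h : IsLocalSHF U ω ψ) (hz : z ∈ U)
    (hσ : ContDiffAt ℝ ((⊤ : ℕ∞) : WithTop ℕ∞) σ z) :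
    ContDiffAt ℝ ((⊤ : ℕ∞) : WithTop ℕ∞) (shape ω ψ σ) z := by
  have hg := h.smooth_metric hz
  have hi := contDiffAt_matrix_inv (A := entries fun z ↦ metricL (ω z) (ψ z)) (y := z)
    (fun i j ↦ (hg.clm_apply contDiffAt_const).clm_apply contDiffAt_const)
    (entries_det_ne_zero (h.metric_nondeg hz))
  refine contDiffAt_clm_of_apply fun v ↦ ?_
  simp only [shape_apply]
  exact ContDiffAt.sum fun i _ ↦ ContDiffAt.sum fun j _ ↦
    ((hi i j).mul (contDiffAt_two_apply hσ contDiffAt_const contDiffAt_const)).smul contDiffAt_const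

theorem metric_shape (h : IsLocalSHF U ω ψ) (hz : z ∈ U) (v w : E₆) :
    metricL (ω z) (ψ z) (shape ω ψ σ z v) w = σ z ![v, w] := by
  obtain ⟨f, hf⟩ := h.exists_adapted hz
  have h1 := hf.sum_gram_inv stdBasis ((LinearMap.mul ℝ ℝ).compl₁₂
    (((metricL (ω z) (ψ z)).flip w).toLinearMap) (bil (σ z).toAlternatingMap v))
  simp only [stdBasis_apply] at h1
  have h2 : metricL (ω z) (ψ z) (shape ω ψ σ z v) w = ∑ i, ∑ j,
      (entries (fun z ↦ metricL (ω z) (ψ z)) z)⁻¹ i j *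
      (metricL (ω z) (ψ z) (EuclideanSpace.single i 1) w * σ z ![v, EuclideanSpace.single j 1]) := by
    simp only [shape_apply, map_sum, map_smul, sum_apply, smul_apply, smul_eq_mul]
    exact Finset.sum_congr rfl fun i _ ↦ Finset.sum_congr rfl fun j _ ↦ by ring
  rw [h2]
  refine h1.trans ?_
  conv_rhs => rw [eq_sum_metric hf w, ← bil_apply_continuous]
  simp only [map_sum, map_smul, smul_eq_mul]
  exact Finset.sum_congr rfl fun i _ ↦ by rw [h.metric_symm hz w]; rfl

theorem repr_eq {f : Module.Basis (Fin 6) ℝ E₆}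
    (hf : Adapted f (ω z) (ψ z)) (v : E₆) (i : Fin 6) :
    f.repr v i = metricL (ω z) (ψ z) v (f i) := by
  have := congrArg (fun w ↦ f.repr w i) (eq_sum_metric hf v)
  simpa [Finsupp.single_apply] using this

/-- Raising an index commutes with ∇, since ∇g = 0. -/
theorem metric_covEndo_shape (h : IsLocalSHF U ω ψ) (hz : z ∈ U)
    (hσ : ContDiffAt ℝ ((⊤ : ℕ∞) : WithTop ℕ∞) σ z) (u v w : E₆) :
    metricL (ω z) (ψ z) (covEndo (conn ω ψ) (shape ω ψ σ) z u v) w = covTwo (conn ω ψ) σ z u v w := by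
  have hA := (h.smooth_shape hz hσ).differentiableAt (by simp)
  have hg := (h.smooth_metric hz).differentiableAt (by simp)
  have hc (a : E₆) := hasFDerivAt_const (𝕜 := ℝ) a z
  have h1 := (hasFDerivAt_bilin hg (hasFDerivAt_endo hA (hc v)) (hc w)).2 u
  have h2 := (hasFDerivAt_two (hσ.differentiableAt (by simp)) (hc v) (hc w)).2 u
  rw [Filter.EventuallyEq.fderiv_eq (h.eventually hz fun y hy ↦ h.metric_shape hy v w), h2,
    h.fderiv_metric hz, h.metric_shape hz] at h1
  simp only [covTwo_apply, covEndo, map_add, map_sub, add_apply, sub_apply, h.metric_shape hz]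
  simp only [← bil_apply_continuous] at h1 ⊢
  simp [-bil_apply] at h1
  simp only [bil_apply_continuous] at h1 ⊢
  linarith

theorem apply_eq_sum_metric {f : Module.Basis (Fin 6) ℝ E₆}
    (hf : Adapted f (ω z) (ψ z)) (T : E₆ →ₗ[ℝ] ℝ) (v : E₆) :
    T v = ∑ m, metricL (ω z) (ψ z) v (f m) * T (f m) := by
  conv_lhs => rw [eq_sum_metric hf v]
  simp only [map_sum, map_smul, smul_eq_mul]

/-- Adapted frames are chosen at single points only and cannot be differentiated. The frame formulas
for ∇ω, and for ∇ψ̂ below, are therefore restated as tensor identities valid on all of U. -/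
theorem covTwo_omega (h : IsLocalSHF U ω ψ) (hσ : IsLocalTorsion U ω ψ σ) (hz : z ∈ U)
    (u v w : E₆) : covTwo (conn ω ψ) ω z u v w =
      -(1 / 2) * hatL (ω z) (ψ z) ![shape ω ψ σ z u, v, w] := by
  obtain ⟨f, hf⟩ := h.exists_adapted hz
  have key : covTwo (conn ω ψ) ω z = (-(1 / 2 : ℝ)) •
      (tril (hatL (ω z) (ψ z)).toAlternatingMap).comp (shape ω ψ σ z).toLinearMap := by
    refine f.ext fun i ↦ f.ext fun j ↦ f.ext fun k ↦ ?_
    rw [(h.isTorsionComp_torsion hz hf (hσ.torsion z hz)).2.1]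
    simp only [LinearMap.smul_apply, LinearMap.comp_apply, smul_eq_mul, dOmegaComp]
    congr 1
    have := apply_eq_sum_metric hf
      (((tril (hatL (ω z) (ψ z)).toAlternatingMap).flip (f j)).flip (f k)) (shape ω ψ σ z (f i))
    simp only [h.metric_shape hz, LinearMap.flip_apply] at this
    refine Eq.trans ?_ this.symm
    refine Finset.sum_congr rfl fun m _ ↦ ?_
    congr 1
    exact (hf.hat m j k).symm
  rw [key]
  rfl

theorem covThree_hat_eq (h : IsLocalSHF U ω ψ) (hσ : IsLocalTorsion U ω ψ σ) (hz : z ∈ U)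
    (u a b c : E₆) : covThree (conn ω ψ) (fun z ↦ hatL (ω z) (ψ z)) z u a b c =
      1 / 2 * (σ z ![u, a] * ω z ![b, c] + σ z ![u, b] * ω z ![c, a] + σ z ![u, c] * ω z ![a, b]) := by
  obtain ⟨f, hf⟩ := h.exists_adapted hz
  -- Linear functionals that agree on the frame agree everywhere; the four arguments are replaced by
  -- frame vectors one at a time.
  have step (F G : E₆ →ₗ[ℝ] ℝ) (hFG : ∀ i, F (f i) = G (f i)) (v : E₆) : F v = G v := by
    rw [f.ext hFG]
  let s := bil (σ z).toAlternatingMap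
  let o := bil (ω z).toAlternatingMap
  let C := covThree (conn ω ψ) (fun z ↦ hatL (ω z) (ψ z)) z
  refine step (((C.flip a).flip b).flip c) ((1 / 2 : ℝ) • (o b c • s.flip a + o c a • s.flip b
    + o a b • s.flip c)) (fun i ↦ ?_) u |>.trans ?_
  rotate_left
  · simp only [LinearMap.smul_apply, LinearMap.add_apply, LinearMap.flip_apply, smul_eq_mul, s, o]
    simp only [bil_apply_continuous]
    ring
  refine step (((C (f i)).flip b).flip c) ((1 / 2 : ℝ) • (o b c • s (f i) + s (f i) b • o c
    + s (f i) c • o.flip b)) (fun j ↦ ?_) a |>.trans ?_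
  rotate_left
  · simp only [LinearMap.smul_apply, LinearMap.add_apply, LinearMap.flip_apply, smul_eq_mul, s, o]
    ring
  refine step ((C (f i) (f j)).flip c) ((1 / 2 : ℝ) • (s (f i) (f j) • o.flip c
    + o c (f j) • s (f i) + s (f i) c • o (f j))) (fun k ↦ ?_) b |>.trans ?_
  rotate_left
  · simp only [LinearMap.smul_apply, LinearMap.add_apply, LinearMap.flip_apply, smul_eq_mul, s, o]
    ring
  refine step (C (f i) (f j) (f k)) ((1 / 2 : ℝ) • (s (f i) (f j) • o (f k)
    + s (f i) (f k) • o.flip (f j) + o (f j) (f k) • s (f i))) (fun l ↦ ?_) c |>.trans ?_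
  rotate_left
  · simp only [LinearMap.smul_apply, LinearMap.add_apply, LinearMap.flip_apply, smul_eq_mul, s, o]
    ring
  refine ((h.isTorsionComp_torsion hz hf (hσ.torsion z hz)).2.2 i j k l).trans ?_
  have ho (i j) : (bil (ω z).toAlternatingMap) (f i) (f j) = omC i j := hf.omega i j
  simp only [LinearMap.smul_apply, LinearMap.add_apply, LinearMap.flip_apply, smul_eq_mul, s, o,
    dHatComp, ho]
  simp only [bil_apply_continuous]
  ring

end IsLocalSHF

end SecondOrder

/-! ### Second covariant derivatives in terms of σ and ∇σ -/

section SecondOrder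

local notation "E₆" => EuclideanSpace ℝ (Fin 6)

variable {U : Set E₆} {ω σ : E₆ → E₆ [⋀^Fin 2]→L[ℝ] ℝ} {ψ : E₆ → E₆ [⋀^Fin 3]→L[ℝ] ℝ} {z : E₆}

theorem two_le_smooth : (2 : WithTop ℕ∞) ≤ ((⊤ : ℕ∞) : WithTop ℕ∞) :=
  WithTop.coe_le_coe.2 (le_top : (2 : ℕ∞) ≤ ⊤)

namespace IsLocalSHF

/-- The Ricci identity applied to ∇ω = -1/2 ψ̂(σ♯·, ·, ·), where σ♯ is `shape`; its product rule
brings in ∇ψ̂ and ∇σ♯. -/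
theorem ricci_identity_omega (h : IsLocalSHF U ω ψ) (hσ : IsLocalTorsion U ω ψ σ) (hz : z ∈ U)
    (u v a b : E₆) :
    -(1 / 2) * (covThree (conn ω ψ) (fun z ↦ hatL (ω z) (ψ z)) z u (shape ω ψ σ z v) a b
        + hatL (ω z) (ψ z) ![covEndo (conn ω ψ) (shape ω ψ σ) z u v, a, b])
      + 1 / 2 * (covThree (conn ω ψ) (fun z ↦ hatL (ω z) (ψ z)) z v (shape ω ψ σ z u) a b
        + hatL (ω z) (ψ z) ![covEndo (conn ω ψ) (shape ω ψ σ) z v u, a, b]) =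
      -ω z ![riem (conn ω ψ) z u v a, b] - ω z ![a, riem (conn ω ψ) z u v b] := by
  have hΓ := (h.smooth_conn hz).differentiableAt (by simp)
  have hA := (h.smooth_shape hz (hσ.smooth z hz)).differentiableAt (by simp)
  have hh := (h.smooth_hat hz).differentiableAt (by simp)
  have hc (a : E₆) := hasFDerivAt_const (𝕜 := ℝ) a z
  have hN : ∀ᶠ y in 𝓝 z, ∀ u a b, fderiv ℝ (fun y ↦ bilL (ω y)) y u a b =
      -(1 / 2) * hatL (ω y) (ψ y) ![shape ω ψ σ y u, a, b] + bilL (ω y) (conn ω ψ y u a) b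
        + bilL (ω y) a (conn ω ψ y u b) := h.eventually hz fun y hy u a b ↦ by
    rw [fderiv_bilL (h.smooth_omega y hy), ← h.covTwo_omega hσ hy, covTwo_apply]
    simp only [bilL_apply]
    ring
  have := ricci_identity_bilin (((smooth_bilL (h.smooth_omega z hz)).of_le
    two_le_smooth) : ContDiffAt ℝ 2 _ z) hΓ hN u v a b
  have hd (u v : E₆) : fderiv ℝ (fun y ↦ -(1 / 2) * hatL (ω y) (ψ y) ![shape ω ψ σ y v, a, b]) z u =
      -(1 / 2) * (fderiv ℝ (fun z ↦ hatL (ω z) (ψ z)) z u ![shape ω ψ σ z v, a, b] +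
        hatL (ω z) (ψ z) ![fderiv ℝ (shape ω ψ σ) z u v, a, b]) := by
    have h1 := hasFDerivAt_three hh (hasFDerivAt_endo hA (hc v)) (hc a) (hc b)
    have h2 := (h1.1.hasFDerivAt.const_mul (-(1 / 2 : ℝ))).fderiv
    have h3 := congrArg (fun L ↦ L u) h2
    refine h3.trans ?_
    rw [smul_apply, h1.2, smul_eq_mul]
    congr 1
    simp only [← tril_apply_continuous]
    simp [-tril_apply]
  rw [hd, hd] at this
  simp only [bilL_apply] at this
  rw [← this]
  simp only [covThree_apply, covEndo, ← tril_apply_continuous, map_add, map_sub,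
    LinearMap.add_apply, LinearMap.sub_apply, h.conn_symm hz v u]
  ring

/-- On a triple isotropic for ω, every term with an undifferentiated ω drops out. Thus ∇σ disappears
and only products of σ with ∇ω remain. -/
theorem ricci_identity_hat (h : IsLocalSHF U ω ψ) (hσ : IsLocalTorsion U ω ψ σ) (hz : z ∈ U)
    (u v a b c : E₆) (hab : ω z ![a, b] = 0) (hbc : ω z ![b, c] = 0) (hca : ω z ![c, a] = 0) :
    1 / 2 * (σ z ![v, a] * covTwo (conn ω ψ) ω z u b c + σ z ![v, b] * covTwo (conn ω ψ) ω z u c a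
        + σ z ![v, c] * covTwo (conn ω ψ) ω z u a b)
      - 1 / 2 * (σ z ![u, a] * covTwo (conn ω ψ) ω z v b c
        + σ z ![u, b] * covTwo (conn ω ψ) ω z v c a + σ z ![u, c] * covTwo (conn ω ψ) ω z v a b) =
      -hatL (ω z) (ψ z) ![riem (conn ω ψ) z u v a, b, c]
        - hatL (ω z) (ψ z) ![a, riem (conn ω ψ) z u v b, c]
        - hatL (ω z) (ψ z) ![a, b, riem (conn ω ψ) z u v c] := by
  have hΓ := (h.smooth_conn hz).differentiableAt (by simp)
  have hs := (hσ.smooth z hz).differentiableAt (by simp)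
  have ho := (h.smooth_omega z hz).differentiableAt (by simp)
  have hc (a : E₆) := hasFDerivAt_const (𝕜 := ℝ) a z
  have hN : ∀ᶠ y in 𝓝 z, ∀ u a b c, fderiv ℝ (fun y ↦ hatL (ω y) (ψ y)) y u ![a, b, c] =
      1 / 2 * (σ y ![u, a] * ω y ![b, c] + σ y ![u, b] * ω y ![c, a] + σ y ![u, c] * ω y ![a, b])
      + hatL (ω y) (ψ y) ![conn ω ψ y u a, b, c] + hatL (ω y) (ψ y) ![a, conn ω ψ y u b, c]
      + hatL (ω y) (ψ y) ![a, b, conn ω ψ y u c] := h.eventually hz fun y hy u a b c ↦ by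
    rw [← h.covThree_hat_eq hσ hy, covThree_apply]
    ring
  have := ricci_identity_three ((h.smooth_hat hz).of_le
    two_le_smooth : ContDiffAt ℝ 2 _ z) hΓ hN u v a b c
  have hp (u v a b c : E₆) : HasFDerivAt (fun y ↦ σ y ![v, a] * ω y ![b, c])
      (σ z ![v, a] • fderiv ℝ (fun y ↦ ω y ![b, c]) z + ω z ![b, c] • fderiv ℝ (fun y ↦ σ y ![v, a]) z)
      z :=
    (hasFDerivAt_two hs (hc v) (hc a)).1.hasFDerivAt.mul (hasFDerivAt_two ho (hc b) (hc c)).1.hasFDerivAt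
  have hq {τ : E₆ → E₆ [⋀^Fin 2]→L[ℝ] ℝ} (ht : DifferentiableAt ℝ τ z) (u a b : E₆) :
      fderiv ℝ (fun y ↦ τ y ![a, b]) z u = fderiv ℝ τ z u ![a, b] := by
    rw [(hasFDerivAt_two ht (hc a) (hc b)).2]
    simp only [← bil_apply_continuous]
    simp [-bil_apply]
  have hd (u v : E₆) : fderiv ℝ (fun y ↦ 1 / 2 * (σ y ![v, a] * ω y ![b, c]
      + σ y ![v, b] * ω y ![c, a] + σ y ![v, c] * ω y ![a, b])) z u =
      1 / 2 * (σ z ![v, a] * fderiv ℝ ω z u ![b, c] + σ z ![v, b] * fderiv ℝ ω z u ![c, a]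
        + σ z ![v, c] * fderiv ℝ ω z u ![a, b]) := by
    have h1 := ((((hp u v a b c).fun_add (hp u v b c a)).fun_add (hp u v c a b)).const_mul
      (1 / 2 : ℝ)).fderiv
    refine (congrArg (fun L ↦ L u) h1).trans ?_
    simp only [add_apply, smul_apply, smul_eq_mul, hab, hbc, hca, hq ho]
    ring
  rw [hd, hd] at this
  rw [← this]
  have sw (u v : E₆) : ω z ![u, v] = -ω z ![v, u] := two_swap (ω z).toAlternatingMap u v
  simp only [covTwo_apply, hab, hbc, hca]
  rw [sw (conn ω ψ z u b) c, sw (conn ω ψ z u c) a, sw (conn ω ψ z u a) b,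
    sw (conn ω ψ z v b) c, sw (conn ω ψ z v c) a, sw (conn ω ψ z v a) b]
  ring

/-- Differentiate σ(J·, ·) = -σ(·, J·), which is the (1,1) condition. -/
theorem covTwo_torsion_cplx (h : IsLocalSHF U ω ψ) (hσ : IsLocalTorsion U ω ψ σ) (hz : z ∈ U)
    (u v w : E₆) : covTwo (conn ω ψ) σ z u (cplxL (ω z) (ψ z) v) w
      + covTwo (conn ω ψ) σ z u v (cplxL (ω z) (ψ z) w)
      + (σ z ![covEndo (conn ω ψ) (fun z ↦ cplxL (ω z) (ψ z)) z u v, w]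
      + σ z ![v, covEndo (conn ω ψ) (fun z ↦ cplxL (ω z) (ψ z)) z u w]) = 0 := by
  have type : ∀ y ∈ U, ∀ v w, σ y ![cplxL (ω y) (ψ y) v, w] = -σ y ![v, cplxL (ω y) (ψ y) w] := by
    intro y hy v w
    have h1 := congrArg (fun F ↦ F ![v, cplxL (ω y) (ψ y) w]) (hσ.torsion y hy).primitive.2
    simp only [compLinearMap_two] at h1
    change σ y ![cplxL (ω y) (ψ y) v, cplxL (ω y) (ψ y) (cplxL (ω y) (ψ y) w)] =
      σ y ![v, cplxL (ω y) (ψ y) w] at h1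
    rw [← h1, h.cplx_cplx hy]
    simp only [← bil_apply_continuous, map_neg, neg_neg]
  have hJ := (h.smooth_cplx hz).differentiableAt (by simp)
  have hs := (hσ.smooth z hz).differentiableAt (by simp)
  have hc (a : E₆) := hasFDerivAt_const (𝕜 := ℝ) a z
  have h1 := (hasFDerivAt_two hs (hasFDerivAt_endo hJ (hc v)) (hc w)).2 u
  have h0 := hasFDerivAt_two hs (hc v) (hasFDerivAt_endo hJ (hc w))
  have h2 := (congrArg (fun L ↦ L u) h0.1.hasFDerivAt.neg.fderiv)
  rw [Filter.EventuallyEq.fderiv_eq (h.eventually hz fun y hy ↦ type y hy v w)] at h1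
  have h3 := h1.symm.trans h2
  rw [neg_apply, h0.2] at h3
  have e1 := type z hz (conn ω ψ z u v) w
  have e2 := type z hz v (conn ω ψ z u w)
  simp only [covTwo_apply, covEndo, ← bil_apply_continuous] at h3 e1 e2 ⊢
  simp [-bil_apply] at h3
  simp only [map_add, map_sub, LinearMap.add_apply, LinearMap.sub_apply]
  linarith

theorem trace_shape_cplx (h : IsLocalSHF U ω ψ) (hσ : IsLocalTorsion U ω ψ σ) (hz : z ∈ U) :
    LinearMap.trace ℝ E₆ (shape ω ψ σ z ∘L cplxL (ω z) (ψ z) : E₆ →L[ℝ] E₆) = 0 := by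
  obtain ⟨f, hf⟩ := h.exists_adapted hz
  have ht := (h.isTorsionComp_torsion hz hf (hσ.torsion z hz)).1
  have hJ (j : Fin 6) : cplxL (ω z) (ψ z) (f j) = sJ j • f (mJ j) := hf.cplx j
  rw [LinearMap.trace_eq_matrix_trace ℝ f, Matrix.trace]
  simp only [Matrix.diag_apply, LinearMap.toMatrix_apply]
  have e (i : Fin 6) : f.repr ((shape ω ψ σ z ∘L cplxL (ω z) (ψ z) : E₆ →L[ℝ] E₆) (f i)) i =
      sJ i * σ z ![f (mJ i), f i] := by
    rw [repr_eq hf, ContinuousLinearMap.comp_apply, h.metric_shape hz, hJ,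
      ← bil_apply_continuous, map_smul]
    rfl
  refine (Finset.sum_congr rfl fun i _ ↦ e i).trans ?_
  have a1 := ht.alt 0 1; have a2 := ht.alt 2 3; have a3 := ht.alt 4 5
  have a4 := ht.trace
  simp only [Fin.sum_univ_six, sJ_values, mJ_values]
  linarith

/-- Differentiate tr(σ♯ ∘ J) = 0, the primitivity of σ. Partial derivatives may be replaced by
covariant ones because a commutator with the connection form has trace zero. -/
theorem sum_covTwo_torsion (h : IsLocalSHF U ω ψ) (hσ : IsLocalTorsion U ω ψ σ) (hz : z ∈ U)
    {f : Module.Basis (Fin 6) ℝ E₆} (hf : Adapted f (ω z) (ψ z)) (u : E₆) :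
    ∑ i, (sJ i * covTwo (conn ω ψ) σ z u (f (mJ i)) (f i)
      + σ z ![covEndo (conn ω ψ) (fun z ↦ cplxL (ω z) (ψ z)) z u (f i), f i]) = 0 := by
  have hJ (j : Fin 6) : cplxL (ω z) (ψ z) (f j) = sJ j • f (mJ j) := hf.cplx j
  have dJ := ((h.smooth_cplx hz).differentiableAt (by simp)).hasFDerivAt
  have dA := ((h.smooth_shape hz (hσ.smooth z hz)).differentiableAt (by simp)).hasFDerivAt
  let tr : (E₆ →L[ℝ] E₆) →L[ℝ] ℝ := LinearMap.toContinuousLinearMap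
    (LinearMap.trace ℝ E₆ ∘ₗ ContinuousLinearMap.coeLM ℝ)
  have d := tr.hasFDerivAt.comp z (dA.clm_comp dJ)
  have d0 := d.congr_of_eventuallyEq (f₁ := fun _ ↦ (0 : ℝ))
    (h.eventually hz fun y hy ↦ (h.trace_shape_cplx hσ hy).symm)
  have d1 := congrArg (fun L ↦ L u) (d0.unique (hasFDerivAt_const (0 : ℝ) z))
  have d2 : LinearMap.trace ℝ E₆ (shape ω ψ σ z ∘L (fderiv ℝ (fun z ↦ cplxL (ω z) (ψ z)) z u)
      + (fderiv ℝ (shape ω ψ σ) z u) ∘L cplxL (ω z) (ψ z) : E₆ →L[ℝ] E₆) = 0 := d1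
  have d3 : LinearMap.trace ℝ E₆ ((conn ω ψ z u ∘L (shape ω ψ σ z ∘L cplxL (ω z) (ψ z)) :
      E₆ →L[ℝ] E₆) : E₆ →ₗ[ℝ] E₆) = LinearMap.trace ℝ E₆ (((shape ω ψ σ z ∘L cplxL (ω z) (ψ z)) ∘L
      conn ω ψ z u : E₆ →L[ℝ] E₆) : E₆ →ₗ[ℝ] E₆) :=
    LinearMap.trace_mul_comm ℝ (conn ω ψ z u).toLinearMap
      (shape ω ψ σ z ∘L cplxL (ω z) (ψ z) : E₆ →L[ℝ] E₆).toLinearMap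
  simp only [LinearMap.trace_eq_matrix_trace ℝ f, Matrix.trace, Matrix.diag_apply,
    LinearMap.toMatrix_apply] at d2 d3
  have key (X : E₆ →L[ℝ] E₆) (i : Fin 6) : f.repr ((X : E₆ →ₗ[ℝ] E₆) (f i)) i =
      metricL (ω z) (ψ z) (X (f i)) (f i) := repr_eq hf _ i
  simp only [key] at d2 d3
  refine Eq.trans ?_ ((congrArg₂ (· + ·) d2 (sub_eq_zero.2 d3)).trans (add_zero 0))
  rw [← Finset.sum_sub_distrib, ← Finset.sum_add_distrib]
  refine Finset.sum_congr rfl fun i _ ↦ ?_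
  have e1 : sJ i * covTwo (conn ω ψ) σ z u (f (mJ i)) (f i) =
      covTwo (conn ω ψ) σ z u (cplxL (ω z) (ψ z) (f i)) (f i) := by
    rw [hJ, map_smul]; rfl
  rw [e1, ← h.metric_covEndo_shape hz (hσ.smooth z hz), ← h.metric_shape hz]
  simp only [covEndo, ContinuousLinearMap.comp_apply, map_add, map_sub, add_apply, sub_apply]
  ring

end IsLocalSHF

end SecondOrder

/-! ### The exterior derivative of σ and the Ricci tensor -/

section LocalTheorem

theorem extDeriv_four_apply {E : Type*} [NormedAddCommGroup E] [NormedSpace ℝ E]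
    {α : E → E [⋀^Fin 4]→L[ℝ] ℝ} {y : E} (hα : DifferentiableAt ℝ α y) (a b c d e : E) :
    extDeriv α y ![a, b, c, d, e] =
      fderiv ℝ (fun z ↦ α z ![b, c, d, e]) y a - fderiv ℝ (fun z ↦ α z ![a, c, d, e]) y b
      + fderiv ℝ (fun z ↦ α z ![a, b, d, e]) y c - fderiv ℝ (fun z ↦ α z ![a, b, c, e]) y d
      + fderiv ℝ (fun z ↦ α z ![a, b, c, d]) y e := by
  rw [extDeriv_apply hα, Fin.sum_univ_five]
  have e0 : (0 : Fin 5).removeNth ![a, b, c, d, e] = ![b, c, d, e] := by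
    ext i; fin_cases i <;> rfl
  have e1 : (1 : Fin 5).removeNth ![a, b, c, d, e] = ![a, c, d, e] := by
    ext i; fin_cases i <;> rfl
  have e2 : (2 : Fin 5).removeNth ![a, b, c, d, e] = ![a, b, d, e] := by
    ext i; fin_cases i <;> rfl
  have e3 : (3 : Fin 5).removeNth ![a, b, c, d, e] = ![a, b, c, e] := by
    ext i; fin_cases i <;> rfl
  have e4 : (4 : Fin 5).removeNth ![a, b, c, d, e] = ![a, b, c, d] := by
    ext i; fin_cases i <;> rfl
  rw [e0, e1, e2, e3, e4]
  simp
  ring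

theorem wedge_comm_two_three {V : Type*} [AddCommGroup V] [Module ℝ V] (α : V [⋀^Fin 2]→ₗ[ℝ] ℝ)
    (β : V [⋀^Fin 3]→ₗ[ℝ] ℝ) (a b c d e : V) :
    wedge β α ![a, b, c, d, e] = wedge α β ![a, b, c, d, e] := by
  rw [wedge_three_two, wedge_two_three]
  ring

theorem five_ext {W : Type*} [AddCommGroup W] [Module ℝ W] (f : Module.Basis (Fin 6) ℝ W)
    {α β : W [⋀^Fin 5]→ₗ[ℝ] ℝ}
    (h : ∀ i j k l m, α ![f i, f j, f k, f l, f m] = β ![f i, f j, f k, f l, f m]) : α = β := by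
  refine ext_of_basis f fun r ↦ ?_
  have e : (fun i ↦ f (r i)) = ![f (r 0), f (r 1), f (r 2), f (r 3), f (r 4)] := by
    ext1 i; fin_cases i <;> rfl
  rw [e, h]

set_option maxRecDepth 4000 in
theorem wedge_three_three_eq_zero {W : Type*} [AddCommGroup W] [Module ℝ W]
    (f : Module.Basis (Fin 6) ℝ W) {α β : W [⋀^Fin 3]→ₗ[ℝ] ℝ}
    (h : wedgeThreeThree (fun i j k ↦ α ![f i, f j, f k]) (fun i j k ↦ β ![f i, f j, f k]) = 0) :
    wedge α β = 0 := by
  have key (γ : W [⋀^Fin 6]→ₗ[ℝ] ℝ) (hγ : γ ![f 0, f 1, f 2, f 3, f 4, f 5] = 0) : γ = 0 := by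
    rw [γ.eq_smul_basis_det f, apply_six γ f, hγ, zero_smul]
  have hw := wedge_three_three α β (f 0) (f 1) (f 2) (f 3) (f 4) (f 5)
  exact key (wedge α β) (hw.trans h)

local notation "E₆" => EuclideanSpace ℝ (Fin 6)

variable {U : Set E₆} {ω σ : E₆ → E₆ [⋀^Fin 2]→L[ℝ] ℝ} {ψ : E₆ → E₆ [⋀^Fin 3]→L[ℝ] ℝ} {z : E₆}

namespace IsLocalSHF

/-- 0 = d²ψ̂ = d(σ ∧ ω) = dσ ∧ ω, as dω = 0. The final combination removes the ten terms of σ ∧ dω.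
-/
theorem extDeriv_torsion_wedge (h : IsLocalSHF U ω ψ) (hσ : IsLocalTorsion U ω ψ σ) (hz : z ∈ U)
    (a b c d e : E₆) : wedge (extDeriv σ z).toAlternatingMap (ω z).toAlternatingMap
      ![a, b, c, d, e] = 0 := by
  have hs := (hσ.smooth z hz).differentiableAt (by simp)
  have ho := (h.smooth_omega z hz).differentiableAt (by simp)
  have hb := (contDiffAt_extDeriv (h.smooth_hat hz)).differentiableAt (by simp)
  have hc (a : E₆) := hasFDerivAt_const (𝕜 := ℝ) a z
  have h0 : extDeriv (extDeriv fun z ↦ hatL (ω z) (ψ z)) z ![a, b, c, d, e] = 0 := by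
    rw [extDeriv_extDeriv_apply ((h.smooth_hat hz).of_le two_le_smooth) (by simp)]; rfl
  have hq {τ : E₆ → E₆ [⋀^Fin 2]→L[ℝ] ℝ} (ht : DifferentiableAt ℝ τ z) (u a b : E₆) :
      fderiv ℝ (fun y ↦ τ y ![a, b]) z u = fderiv ℝ τ z u ![a, b] := by
    rw [(hasFDerivAt_two ht (hc a) (hc b)).2]
    simp only [← bil_apply_continuous]
    simp [-bil_apply]
  have hp (a b c d : E₆) : HasFDerivAt (fun y ↦ σ y ![a, b] * ω y ![c, d])
      (σ z ![a, b] • fderiv ℝ (fun y ↦ ω y ![c, d]) z + ω z ![c, d] • fderiv ℝ (fun y ↦ σ y ![a, b]) z)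
      z :=
    (hasFDerivAt_two hs (hc a) (hc b)).1.hasFDerivAt.mul (hasFDerivAt_two ho (hc c) (hc d)).1.hasFDerivAt
  have hd (u a b c d : E₆) : fderiv ℝ (fun y ↦ extDeriv (fun z ↦ hatL (ω z) (ψ z)) y ![a, b, c, d]) z u =
      (σ z ![a, b] * fderiv ℝ ω z u ![c, d] + ω z ![c, d] * fderiv ℝ σ z u ![a, b])
      - (σ z ![a, c] * fderiv ℝ ω z u ![b, d] + ω z ![b, d] * fderiv ℝ σ z u ![a, c])
      + (σ z ![a, d] * fderiv ℝ ω z u ![b, c] + ω z ![b, c] * fderiv ℝ σ z u ![a, d])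
      + (σ z ![b, c] * fderiv ℝ ω z u ![a, d] + ω z ![a, d] * fderiv ℝ σ z u ![b, c])
      - (σ z ![b, d] * fderiv ℝ ω z u ![a, c] + ω z ![a, c] * fderiv ℝ σ z u ![b, d])
      + (σ z ![c, d] * fderiv ℝ ω z u ![a, b] + ω z ![a, b] * fderiv ℝ σ z u ![c, d]) := by
    have e : (fun y ↦ extDeriv (fun z ↦ hatL (ω z) (ψ z)) y ![a, b, c, d]) =ᶠ[𝓝 z] fun y ↦
        σ y ![a, b] * ω y ![c, d] - σ y ![a, c] * ω y ![b, d] + σ y ![a, d] * ω y ![b, c]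
        + σ y ![b, c] * ω y ![a, d] - σ y ![b, d] * ω y ![a, c] + σ y ![c, d] * ω y ![a, b] :=
      h.eventually hz fun y hy ↦ by
        have := congrArg (fun F ↦ F ![a, b, c, d]) (hσ.torsion y hy).d_hat
        refine this.trans ?_
        exact wedge_two_two _ _ _ _ _ _
    rw [Filter.EventuallyEq.fderiv_eq e]
    have h1 := ((((((hp a b c d).fun_sub (hp a c b d)).fun_add (hp a d b c)).fun_add
      (hp b c a d)).fun_sub (hp b d a c)).fun_add (hp c d a b)).fderiv
    refine (congrArg (fun L ↦ L u) h1).trans ?_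
    simp only [add_apply, sub_apply, smul_apply, smul_eq_mul, hq ho, hq hs]
  rw [extDeriv_four_apply hb, hd, hd, hd, hd, hd] at h0
  have w (a b c : E₆) : fderiv ℝ ω z a ![b, c] - fderiv ℝ ω z b ![a, c] + fderiv ℝ ω z c ![a, b] = 0 := by
    rw [← extDeriv_two_apply ho, h.closed_omega z hz]; rfl
  have s (a b c : E₆) : (extDeriv σ z).toAlternatingMap ![a, b, c] =
    fderiv ℝ σ z a ![b, c] - fderiv ℝ σ z b ![a, c] + fderiv ℝ σ z c ![a, b] := extDeriv_two_apply hs a b c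
  have o (a b : E₆) : (ω z).toAlternatingMap ![a, b] = ω z ![a, b] := rfl
  rw [wedge_three_two]
  simp only [s, o]
  linear_combination h0 - σ z ![d, e] * w a b c + σ z ![c, e] * w a b d - σ z ![c, d] * w a b e
    - σ z ![b, e] * w a c d + σ z ![b, d] * w a c e - σ z ![b, c] * w a d e
    + σ z ![a, e] * w b c d - σ z ![a, d] * w b c e + σ z ![a, c] * w b d e - σ z ![a, b] * w c d e

theorem altComp_torsion (h : IsLocalSHF U ω ψ) (hσ : IsLocalTorsion U ω ψ σ) (hz : z ∈ U)
    (f : Module.Basis (Fin 6) ℝ E₆) (i j k : Fin 6) :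
    altComp (fun u i j ↦ covTwo (conn ω ψ) σ z (f u) (f i) (f j)) i j k =
      extDeriv σ z ![f i, f j, f k] :=
  (extDeriv_two_eq_cov ((hσ.smooth z hz).differentiableAt (by simp)) (h.conn_symm hz) _ _ _).symm

theorem isTorsionDerivComp_torsion (h : IsLocalSHF U ω ψ) (hσ : IsLocalTorsion U ω ψ σ) (hz : z ∈ U)
    {f : Module.Basis (Fin 6) ℝ E₆} (hf : Adapted f (ω z) (ψ z)) :
    IsTorsionDerivComp (fun i j ↦ σ z ![f i, f j])
      fun u i j ↦ covTwo (conn ω ψ) σ z (f u) (f i) (f j) := by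
  have hJ (j : Fin 6) : cplxL (ω z) (ψ z) (f j) = sJ j • f (mJ j) := hf.cplx j
  obtain ⟨ht, hc, -⟩ := h.isTorsionComp_torsion hz hf (hσ.torsion z hz)
  have hK (u i j : Fin 6) : σ z ![covEndo (conn ω ψ) (fun z ↦ cplxL (ω z) (ψ z)) z (f u) (f i),
      f j] = ∑ m, dOmegaComp (fun i j ↦ σ z ![f i, f j]) u i m * σ z ![f m, f j] := by
    have := apply_eq_sum_metric hf ((bil (σ z).toAlternatingMap).flip (f j))
      (covEndo (conn ω ψ) (fun z ↦ cplxL (ω z) (ψ z)) z (f u) (f i))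
    simp only [h.metric_covEndo hz, hc] at this
    exact this
  have hK' (u i j : Fin 6) : σ z ![f i, covEndo (conn ω ψ) (fun z ↦ cplxL (ω z) (ψ z)) z (f u) (f j)]
      = ∑ m, dOmegaComp (fun i j ↦ σ z ![f i, f j]) u j m * σ z ![f i, f m] := by
    have := apply_eq_sum_metric hf (bil (σ z).toAlternatingMap (f i))
      (covEndo (conn ω ψ) (fun z ↦ cplxL (ω z) (ψ z)) z (f u) (f j))
    simp only [h.metric_covEndo hz, hc] at this
    exact this
  refine ⟨fun u i j ↦ covTwo_swap _ _ _ _, fun u i j ↦ ?_, fun u ↦ ?_⟩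
  · have := h.covTwo_torsion_cplx hσ hz (f u) (f i) (f j)
    simpa only [hJ, map_smul, LinearMap.smul_apply, smul_eq_mul, hK, hK',
      ← Finset.sum_add_distrib] using this
  · have := h.sum_covTwo_torsion hσ hz hf (f u)
    have a1 := covTwo_swap (Γ := conn ω ψ) (y := z) σ (f u) (f 1) (f 0)
    have a2 := covTwo_swap (Γ := conn ω ψ) (y := z) σ (f u) (f 3) (f 2)
    have a3 := covTwo_swap (Γ := conn ω ψ) (y := z) σ (f u) (f 5) (f 4)
    simp only [hK] at this
    generalize hs : (fun i j ↦ σ z ![f i, f j]) = s at *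
    have hs' (i j : Fin 6) : σ z ![f i, f j] = s i j := congrFun (congrFun hs i) j
    -- The correction from ∇_u J pairs a form of type (2,0)+(0,2) with one of type (1,1), so it
    -- vanishes and ∇_u σ is itself trace-free.
    simp only [hs', Fin.sum_univ_six, sJ_values, mJ_values, dOmegaComp, isAlt3_qsC.rules,
      qsC_sorted, ht.alt.rules, ht.values] at this
    linarith

/-- The curvature tensor in a frame. -/
def riemComp (ω : E₆ → E₆ [⋀^Fin 2]→L[ℝ] ℝ) (ψ : E₆ → E₆ [⋀^Fin 3]→L[ℝ] ℝ) (z : E₆)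
    (f : Fin 6 → E₆) (u v w x : Fin 6) : ℝ :=
  metricL (ω z) (ψ z) (riem (conn ω ψ) z (f u) (f v) (f w)) (f x)

theorem sum_riemComp (h : IsLocalSHF U ω ψ) (hσ : IsLocalTorsion U ω ψ σ) (hz : z ∈ U)
    {f : Module.Basis (Fin 6) ℝ E₆} (hf : Adapted f (ω z) (ψ z)) (i u : Fin 6) :
    ∑ k, riemComp ω ψ z f k u i k = ricciComp (fun i j ↦ σ z ![f i, f j])
      (nuComp (fun i j ↦ σ z ![f i, f j]) fun u i j ↦ covTwo (conn ω ψ) σ z (f u) (f i) (f j)) i u := by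
  obtain ⟨ht, hc2, hc3⟩ := h.isTorsionComp_torsion hz hf (hσ.torsion z hz)
  have hS := h.isTorsionDerivComp_torsion hσ hz hf
  have hΓ := (h.smooth_conn hz).differentiableAt (by simp)
  have hg := (h.smooth_metric hz).of_le two_le_smooth
  have hN : ∀ᶠ y in 𝓝 z, ∀ u a b, fderiv ℝ (fun z ↦ metricL (ω z) (ψ z)) y u a b =
      metricL (ω y) (ψ y) (conn ω ψ y u a) b + metricL (ω y) (ψ y) a (conn ω ψ y u b) :=
    h.eventually hz fun y hy ↦ h.fderiv_metric hy
  have hcs : ∀ᶠ y in 𝓝 z, ∀ u v, conn ω ψ y u v = conn ω ψ y v u :=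
    h.eventually hz fun y hy ↦ h.conn_symm hy
  have ho (i j : Fin 6) : ω z ![f i, f j] = omC i j := hf.omega i j
  have hq (i j k : Fin 6) : hatL (ω z) (ψ z) ![f i, f j, f k] = qsC i j k := hf.hat i j k
  have key := ricci_cplx_eq (R := riemComp ω ψ z f) (s := fun i j ↦ σ z ![f i, f j])
    (S := fun u i j ↦ covTwo (conn ω ψ) σ z (f u) (f i) (f j))
    (fun u v w x ↦ by simp only [riemComp]; rw [riem_swap, map_neg, neg_apply])
    (fun u v w x ↦ riem_pair_symm hg hΓ hcs (h.metric_symm hz) hN _ _ _ _)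
    (fun u v w x ↦ by
      simp only [riemComp, ← add_apply, ← map_add, riem_bianchi hΓ hcs]
      simp)
    (fun u v w x ↦ by
      have h1 := h.ricci_identity_omega hσ hz (f u) (f v) (f w) (f x)
      have e1 (u v i j : Fin 6) : covThree (conn ω ψ) (fun z ↦ hatL (ω z) (ψ z)) z (f u)
          (shape ω ψ σ z (f v)) (f i) (f j) =
          ∑ m, σ z ![f v, f m] * dHatComp (fun i ↦ σ z ![f u, f i]) 0 m i j := by
        have := apply_eq_sum_metric hf (((covThree (conn ω ψ) (fun z ↦ hatL (ω z) (ψ z)) z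
          (f u)).flip (f i)).flip (f j)) (shape ω ψ σ z (f v))
        simpa only [h.metric_shape hz, LinearMap.flip_apply, hc3] using this
      have e2 (u v i j : Fin 6) : hatL (ω z) (ψ z) ![covEndo (conn ω ψ) (shape ω ψ σ) z (f u) (f v),
          f i, f j] = ∑ m, covTwo (conn ω ψ) σ z (f u) (f v) (f m) * qsC m i j := by
        have := apply_eq_sum_metric hf (((tril (hatL (ω z) (ψ z)).toAlternatingMap).flip
          (f i)).flip (f j)) (covEndo (conn ω ψ) (shape ω ψ σ) z (f u) (f v))
        simpa only [h.metric_covEndo_shape hz (hσ.smooth z hz), LinearMap.flip_apply,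
          tril_apply_continuous, hq] using this
      have hJ (j : Fin 6) : cplxL (ω z) (ψ z) (f j) = sJ j • f (mJ j) := hf.cplx j
      have e3 (X : E₆) (j : Fin 6) : ω z ![X, f j] = -sJ j * metricL (ω z) (ψ z) X (f (mJ j)) := by
        have : f j = -cplxL (ω z) (ψ z) (cplxL (ω z) (ψ z) (f j)) := by rw [h.cplx_cplx hz, neg_neg]
        conv_lhs => rw [this, ← bil_apply_continuous, map_neg, bil_apply_continuous]
        rw [← metricL_apply, hJ, map_smul, smul_eq_mul]
        ring
      have e4 (X : E₆) (j : Fin 6) : ω z ![f j, X] = sJ j * metricL (ω z) (ψ z) X (f (mJ j)) := by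
        have : ω z ![f j, X] = -ω z ![X, f j] := two_swap (ω z).toAlternatingMap _ _
        rw [this, e3]; ring
      have sk := riem_skew hg hΓ hN (f u) (f v) (f x) (f (mJ w))
      rw [h.metric_symm hz] at sk
      rw [e1, e1, e2, e2, e3, e4, ← Finset.sum_add_distrib, ← Finset.sum_add_distrib] at h1
      simp only [hessComp, riemComp]
      have sk' : metricL (ω z) (ψ z) (riem (conn ω ψ) z (f u) (f v) (f x)) (f (mJ w)) =
          -metricL (ω z) (ψ z) (riem (conn ω ψ) z (f u) (f v) (f (mJ w))) (f x) := by
        rw [riem_skew hg hΓ hN, h.metric_symm hz]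
      linear_combination h1 - sJ w * sk')
    (fun u v ↦ by
      -- (f₀, f₂, f₄) spans an isotropic subspace. In each slot ψ̂ keeps only the component along
      -- the J-image of that frame vector, so the right-hand side is minus the trace of R(u, v) over
      -- complex lines.
      have h1 := h.ricci_identity_hat hσ hz (f u) (f v) (f 0) (f 2) (f 4) (by simp [ho, omC_sorted])
        (by simp [ho, omC_sorted]) (by simp [ho, isAlt2_omC.rules, omC_sorted])
      have q1 := apply_eq_sum_metric hf (((tril (hatL (ω z) (ψ z)).toAlternatingMap).flip
          (f 2)).flip (f 4)) (riem (conn ω ψ) z (f u) (f v) (f 0))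
      have q2 := apply_eq_sum_metric hf ((tril (hatL (ω z) (ψ z)).toAlternatingMap (f 0)).flip
          (f 4)) (riem (conn ω ψ) z (f u) (f v) (f 2))
      have q3 := apply_eq_sum_metric hf (tril (hatL (ω z) (ψ z)).toAlternatingMap (f 0) (f 2))
          (riem (conn ω ψ) z (f u) (f v) (f 4))
      simp only [LinearMap.flip_apply, tril_apply_continuous, hq, Fin.sum_univ_six, isAlt3_qsC.rules,
        qsC_sorted] at q1 q2 q3
      rw [q1, q2, q3] at h1
      simp only [hc2] at h1
      simp only [hessHatComp, riemComp]
      linear_combination -h1)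
  -- `key` computes Ric(J·, ·); evaluating it at `mJ i` returns to the index i up to a sign of
  -- square 1.
  have h2 := key (mJ i) u
  rw [hess_eq_ricciComp ht hS, mJ_mJ] at h2
  have h3 := sJ_sq (mJ i)
  linear_combination sJ (mJ i) * h2 - (∑ k, riemComp ω ψ z f k u i k - ricciComp (fun i j ↦ σ z ![f i, f j])
      (nuComp (fun i j ↦ σ z ![f i, f j]) fun u i j ↦ covTwo (conn ω ψ) σ z (f u) (f i) (f j)) i u) * h3

end IsLocalSHF

end LocalTheorem

/-! ### Hermitian Ricci tensor, scalar curvature and d|σ|² on an open set -/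

section LocalConclusion

local notation "E₆" => EuclideanSpace ℝ (Fin 6)

variable {U : Set E₆} {ω σ : E₆ → E₆ [⋀^Fin 2]→L[ℝ] ℝ} {ψ : E₆ → E₆ [⋀^Fin 3]→L[ℝ] ℝ} {z : E₆}

/-- A bilinear form on `ℝ⁶` given by a matrix. -/
def matrixForm (c : Fin 6 → Fin 6 → ℝ) : E₆ →ₗ[ℝ] E₆ →ₗ[ℝ] ℝ :=
  LinearMap.mk₂ ℝ (fun v w ↦ ∑ i, ∑ j, c i j * v i * w j)
    (fun u v w ↦ by simp [mul_add, add_mul, Finset.sum_add_distrib])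
    (fun r v w ↦ by
      simp only [Finset.smul_sum]
      exact Finset.sum_congr rfl fun i _ ↦ Finset.sum_congr rfl fun j _ ↦ by simp; ring)
    (fun u v w ↦ by simp [mul_add, Finset.sum_add_distrib])
    (fun r v w ↦ by
      simp only [Finset.smul_sum]
      exact Finset.sum_congr rfl fun i _ ↦ Finset.sum_congr rfl fun j _ ↦ by simp; ring)

/-- The Ricci tensor of an `SU(3)`-structure on an open subset of `ℝ⁶`. -/
def ricciL (ω : E₆ → E₆ [⋀^Fin 2]→L[ℝ] ℝ) (ψ : E₆ → E₆ [⋀^Fin 3]→L[ℝ] ℝ) (z : E₆) :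
    E₆ →ₗ[ℝ] E₆ →ₗ[ℝ] ℝ :=
  matrixForm fun i j ↦ ricciCoord (entries fun z ↦ metricL (ω z) (ψ z)) i j z

/-- The squared norm of a `2`-form on an open subset of `ℝ⁶`. -/
def normSqL (ω σ : E₆ → E₆ [⋀^Fin 2]→L[ℝ] ℝ) (ψ : E₆ → E₆ [⋀^Fin 3]→L[ℝ] ℝ) (z : E₆) : ℝ :=
  normSq stdBasis (ω z).toAlternatingMap (ψ z).toAlternatingMap (σ z).toAlternatingMap

/-- The primitive part of the derivative of the torsion. -/
def nuL (ω σ : E₆ → E₆ [⋀^Fin 2]→L[ℝ] ℝ) (ψ : E₆ → E₆ [⋀^Fin 3]→L[ℝ] ℝ) (z : E₆) :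
    E₆ [⋀^Fin 3]→L[ℝ] ℝ :=
  extDeriv σ z - (normSqL ω σ ψ z / 4) • ψ z

namespace IsLocalSHF

/-- Both sides are the trace of x ↦ R(x, w)v, taken in the coordinate basis on the left and in the
adapted basis on the right. -/
theorem ricciL_eq (h : IsLocalSHF U ω ψ) (hz : z ∈ U) {f : Module.Basis (Fin 6) ℝ E₆}
    (hf : Adapted f (ω z) (ψ z)) (i u : Fin 6) :
    ricciL ω ψ z (f i) (f u) = ∑ k, riemComp ω ψ z f k u i k := by
  set v := f i with hv
  set w := f u with hw
  obtain ⟨T, hT⟩ : ∃ T : E₆ →ₗ[ℝ] E₆, ∀ x, T x = riemL (conn ω ψ) z x w v :=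
    ⟨((riemL (conn ω ψ) z).flip w).flip v, fun x ↦ rfl⟩
  have h1 : LinearMap.trace ℝ E₆ T = ∑ k, riemComp ω ψ z f k u i k := by
    rw [LinearMap.trace_eq_matrix_trace ℝ f, Matrix.trace]
    refine Finset.sum_congr rfl fun k _ ↦ ?_
    rw [Matrix.diag_apply, LinearMap.toMatrix_apply, repr_eq hf]
    rw [hT, riemL_apply, riemComp]
  rw [← h1, LinearMap.trace_eq_matrix_trace ℝ stdBasis, Matrix.trace]
  simp only [Matrix.diag_apply, LinearMap.toMatrix_apply, stdBasis_apply]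
  have h2 (k : Fin 6) : stdBasis.repr (T (EuclideanSpace.single k 1)) k =
      ∑ i, ∑ j, riem (conn ω ψ) z (EuclideanSpace.single k 1) (EuclideanSpace.single j 1)
        (EuclideanSpace.single i 1) k * v i * w j := by
    have e : T (EuclideanSpace.single k 1) = ∑ i, ∑ j, (v i * w j) • riemL (conn ω ψ) z
        (EuclideanSpace.single k 1) (EuclideanSpace.single j 1) (EuclideanSpace.single i 1) := by
      rw [hT]
      conv_lhs => rw [euclidean_sum_single v, euclidean_sum_single w]
      simp only [map_sum, map_smul, LinearMap.sum_apply, LinearMap.smul_apply, Finset.smul_sum,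
        smul_smul]
    rw [e]
    simp [stdBasis, riemL_apply]
    exact Finset.sum_congr rfl fun i _ ↦ Finset.sum_congr rfl fun j _ ↦ by ring
  simp only [h2]
  change ∑ i, ∑ j, ricciCoord _ i j z * v i * w j = _
  have h3 (i j : Fin 6) := ricciCoord_eq h.isOpen (fun _ hz ↦ h.smooth_metric hz)
    (fun _ hz ↦ h.metric_nondeg hz) (fun _ hz ↦ h.metric_symm hz) hz i j
  simp only [h3, Finset.sum_mul]
  refine Eq.trans ?_ Finset.sum_comm
  exact Finset.sum_congr rfl fun i _ ↦ Finset.sum_comm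

theorem nuL_frame (h : IsLocalSHF U ω ψ) (hσ : IsLocalTorsion U ω ψ σ) (hz : z ∈ U)
    {f : Module.Basis (Fin 6) ℝ E₆} (hf : Adapted f (ω z) (ψ z)) (i j k : Fin 6) :
    nuL ω σ ψ z ![f i, f j, f k] = nuComp (fun i j ↦ σ z ![f i, f j])
      (fun u i j ↦ covTwo (conn ω ψ) σ z (f u) (f i) (f j)) i j k := by
  have hn : normSqL ω σ ψ z = 1 / 2 * ∑ i, ∑ j, σ z ![f i, f j] * σ z ![f i, f j] := hf.normSq _
  have hp : ψ z ![f i, f j, f k] = psC i j k := hf.psi i j k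
  rw [nuComp, h.altComp_torsion hσ hz, nuL, ContinuousAlternatingMap.sub_apply,
    ContinuousAlternatingMap.smul_apply, hn, hp, smul_eq_mul]
  ring

theorem isPrimitiveComp_nuL (h : IsLocalSHF U ω ψ) (hσ : IsLocalTorsion U ω ψ σ) (hz : z ∈ U)
    {f : Module.Basis (Fin 6) ℝ E₆} (hf : Adapted f (ω z) (ψ z)) :
    IsPrimitiveComp fun i j k ↦ nuL ω σ ψ z ![f i, f j, f k] := by
  simp only [h.nuL_frame hσ hz hf]
  refine isPrimitiveComp_nuComp (h.isTorsionComp_torsion hz hf (hσ.torsion z hz)).1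
    (h.isTorsionDerivComp_torsion hσ hz hf) fun i ↦ ?_
  simp only [h.altComp_torsion hσ hz]
  have w (a b c d e : Fin 6) := h.extDeriv_torsion_wedge hσ hz (f a) (f b) (f c) (f d) (f e)
  have s := (isAlt3_form (extDeriv σ z).toAlternatingMap f)
  simp only [wedge_three_two, hf.omega] at w
  change (extDeriv σ z).toAlternatingMap ![f i, f 0, f 1] +
    (extDeriv σ z).toAlternatingMap ![f i, f 2, f 3] +
    (extDeriv σ z).toAlternatingMap ![f i, f 4, f 5] = 0
  generalize hr : (fun i j k ↦ (extDeriv σ z).toAlternatingMap ![f i, f j, f k]) = r at s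
  have hr' (i j k : Fin 6) : (extDeriv σ z).toAlternatingMap ![f i, f j, f k] = r i j k :=
    congrFun (congrFun (congrFun hr i) j) k
  simp only [hr'] at w ⊢
  -- The component of dσ ∧ ω on all frame indices but one is, up to sign, the trace of dσ(f_i, ·, ·)
  -- over complex lines, where Jf_i is proportional to the omitted vector.
  have w0 := w 0 2 3 4 5; have w1 := w 1 2 3 4 5; have w2 := w 0 1 2 4 5
  have w3 := w 0 1 3 4 5; have w4 := w 0 1 2 3 4; have w5 := w 0 1 2 3 5
  simp only [omC_sorted] at w0 w1 w2 w3 w4 w5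
  fin_cases i <;> simp only [Fin.reduceFinMk, Fin.zero_eta, Fin.mk_one, s.rules] <;> linarith

-- Up to sign ψ and ψ̂ are Hodge dual to each other. Hence ν ∧ ψ = 0 and ν ∧ ψ̂ = 0 are the
-- orthogonality relations of `IsPrimitiveComp` to ψ̂ and to ψ respectively.
set_option maxRecDepth 8000 in
theorem isPrimitive21_nuL (h : IsLocalSHF U ω ψ) (hσ : IsLocalTorsion U ω ψ σ) (hz : z ∈ U) :
    IsPrimitive21 stdBasis (ω z).toAlternatingMap (ψ z).toAlternatingMap
      (nuL ω σ ψ z).toAlternatingMap := by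
  obtain ⟨f, hf⟩ := h.exists_adapted hz
  have hp := h.isPrimitiveComp_nuL hσ hz hf
  generalize hr : (fun i j k ↦ (nuL ω σ ψ z) ![f i, f j, f k]) = r at hp
  have hr' (i j k : Fin 6) : (nuL ω σ ψ z).toAlternatingMap ![f i, f j, f k] = r i j k :=
    congrFun (congrFun (congrFun hr i) j) k
  refine ⟨five_ext f fun i j k l m ↦ ?_, ?_, ?_⟩
  · have w := h.extDeriv_torsion_wedge hσ hz (f i) (f j) (f k) (f l) (f m)
    have w' : wedge (ω z).toAlternatingMap (ψ z).toAlternatingMap ![f i, f j, f k, f l, f m] = 0 := by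
      rw [(h.isSU3 z hz).compatible]; rfl
    rw [← wedge_comm_two_three, wedge_three_two] at w'
    rw [wedge_three_two] at w
    change wedge (nuL ω σ ψ z).toAlternatingMap (ω z).toAlternatingMap ![f i, f j, f k, f l, f m] = 0
    rw [wedge_three_two]
    have e (a b c : E₆) : (nuL ω σ ψ z).toAlternatingMap ![a, b, c] =
      (extDeriv σ z).toAlternatingMap ![a, b, c]
        - normSqL ω σ ψ z / 4 * (ψ z).toAlternatingMap ![a, b, c] := rfl
    simp only [e]
    linear_combination w - normSqL ω σ ψ z / 4 * w'
  · refine wedge_three_three_eq_zero f ?_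
    simp only [hr', hf.psi, wedgeThreeThree, isAlt3_psC.rules, psC_sorted]
    simp only [hp.values]
    ring
  · refine wedge_three_three_eq_zero f ?_
    have hq (i j k : Fin 6) : SHF.hat stdBasis (ω z).toAlternatingMap (ψ z).toAlternatingMap
      ![f i, f j, f k] = qsC i j k := hf.hat i j k
    simp only [hr', hq, wedgeThreeThree, isAlt3_qsC.rules, qsC_sorted]
    simp only [hp.values]
    ring

theorem ricciL_frame (h : IsLocalSHF U ω ψ) (hσ : IsLocalTorsion U ω ψ σ) (hz : z ∈ U)
    {f : Module.Basis (Fin 6) ℝ E₆} (hf : Adapted f (ω z) (ψ z)) (i u : Fin 6) :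
    ricciL ω ψ z (f i) (f u) = ricciComp (fun i j ↦ σ z ![f i, f j])
      (fun i j k ↦ nuL ω σ ψ z ![f i, f j, f k]) i u := by
  simp only [h.nuL_frame hσ hz hf, h.ricciL_eq hz hf, h.sum_riemComp hσ hz hf]

/-- The Hermitian defect of the Ricci tensor is half the contraction of ν with ψ, which is injective
in ν. -/
theorem ricciL_hermitian_iff (h : IsLocalSHF U ω ψ) (hσ : IsLocalTorsion U ω ψ σ) (hz : z ∈ U) :
    (∀ v w, ricciL ω ψ z (cplxL (ω z) (ψ z) v) (cplxL (ω z) (ψ z) w) = ricciL ω ψ z v w) ↔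
      nuL ω σ ψ z = 0 := by
  obtain ⟨f, hf⟩ := h.exists_adapted hz
  have hJ (j : Fin 6) : cplxL (ω z) (ψ z) (f j) = sJ j • f (mJ j) := hf.cplx j
  have hp := h.isPrimitiveComp_nuL hσ hz hf
  have ht := (h.isTorsionComp_torsion hz hf (hσ.torsion z hz)).1
  have key (i j : Fin 6) : ricciL ω ψ z (cplxL (ω z) (ψ z) (f i)) (cplxL (ω z) (ψ z) (f j)) =
      ricciL ω ψ z (f i) (f j) + 1 / 2 * ∑ k, ∑ m, nuL ω σ ψ z ![f k, f m, f j] * psC k m i := by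
    rw [h.ricciL_frame hσ hz hf, ← hp.ricciComp_cplx ht, ← h.ricciL_frame hσ hz hf, hJ, hJ]
    simp only [map_smul, LinearMap.smul_apply, smul_eq_mul]
    ring
  constructor
  · intro H
    have h0 := hp.eq_zero fun i j ↦ by
      have := key i j
      rw [H] at this
      linarith
    exact ContinuousAlternatingMap.toAlternatingMap_injective (three_ext f h0)
  · intro H
    have : (ricciL ω ψ z).compl₁₂ (cplxL (ω z) (ψ z)).toLinearMap (cplxL (ω z) (ψ z)).toLinearMap =
        ricciL ω ψ z := f.ext fun i ↦ f.ext fun j ↦ by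
      refine (key i j).trans ?_
      simp [H]
    exact fun v w ↦ congrArg (fun B ↦ B v w) this

theorem scal_eq (h : IsLocalSHF U ω ψ) (hσ : IsLocalTorsion U ω ψ σ) (hz : z ∈ U) :
    ∑ i, ∑ j, (entries (fun z ↦ metricL (ω z) (ψ z)) z)⁻¹ i j *
      ricciL ω ψ z (EuclideanSpace.single i 1) (EuclideanSpace.single j 1) =
      -(1 / 2) * normSqL ω σ ψ z := by
  obtain ⟨f, hf⟩ := h.exists_adapted hz
  have hn : normSqL ω σ ψ z = 1 / 2 * ∑ i, ∑ j, σ z ![f i, f j] * σ z ![f i, f j] := hf.normSq _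
  have h1 := hf.sum_gram_inv stdBasis (ricciL ω ψ z)
  simp only [stdBasis_apply] at h1
  refine h1.trans ?_
  simp only [h.ricciL_frame hσ hz hf, (h.isPrimitiveComp_nuL hσ hz hf).sum_ricciComp, hn]
  ring

theorem smooth_normSqL (h : IsLocalSHF U ω ψ) (hz : z ∈ U)
    (hσ : ContDiffAt ℝ ((⊤ : ℕ∞) : WithTop ℕ∞) σ z) :
    ContDiffAt ℝ ((⊤ : ℕ∞) : WithTop ℕ∞) (normSqL ω σ ψ) z := by
  have hg := h.smooth_metric hz
  have hi := contDiffAt_matrix_inv (A := entries fun z ↦ metricL (ω z) (ψ z)) (y := z)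
    (fun i j ↦ (hg.clm_apply contDiffAt_const).clm_apply contDiffAt_const)
    (entries_det_ne_zero (h.metric_nondeg hz))
  have e : normSqL ω σ ψ = fun z ↦ (1 / 2) * ∑ i, ∑ j, ∑ k, ∑ l,
      (entries (fun z ↦ metricL (ω z) (ψ z)) z)⁻¹ i k *
      (entries (fun z ↦ metricL (ω z) (ψ z)) z)⁻¹ j l * σ z ![stdBasis i, stdBasis j] *
      σ z ![stdBasis k, stdBasis l] := by
    ext z
    have : gram stdBasis (ω z).toAlternatingMap (ψ z).toAlternatingMap =
        entries (fun z ↦ metricL (ω z) (ψ z)) z := by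
      ext i j
      simp only [gram, Matrix.of_apply, stdBasis_apply]
      rfl
    simp only [normSqL, normSq, this]
    rfl
  rw [e]
  have hc (v w : E₆) : ContDiffAt ℝ ((⊤ : ℕ∞) : WithTop ℕ∞) (fun z ↦ σ z ![v, w]) z :=
    contDiffAt_two_apply hσ contDiffAt_const contDiffAt_const
  exact contDiffAt_const.mul (ContDiffAt.sum fun i _ ↦ ContDiffAt.sum fun j _ ↦
    ContDiffAt.sum fun k _ ↦ ContDiffAt.sum fun l _ ↦
      (((hi i k).mul (hi j l)).mul (hc _ _)).mul (hc _ _))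

theorem smooth_nuL (h : IsLocalSHF U ω ψ) (hσ : IsLocalTorsion U ω ψ σ) (hz : z ∈ U) :
    ContDiffAt ℝ ((⊤ : ℕ∞) : WithTop ℕ∞) (nuL ω σ ψ) z :=
  (contDiffAt_extDeriv (hσ.smooth z hz)).sub
    (((h.smooth_normSqL hz (hσ.smooth z hz)).div_const 4).smul (h.smooth_psi z hz))

/-- Near z one has dσ = Fψ with F = |σ|²/4, so 0 = d²σ = dF ∧ ψ because dψ = 0. Wedging a covector
with ψ is injective. -/
theorem fderiv_normSqL (h : IsLocalSHF U ω ψ) (hσ : IsLocalTorsion U ω ψ σ)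
    (hn : ∀ z ∈ U, nuL ω σ ψ z = 0) (hz : z ∈ U) : fderiv ℝ (normSqL ω σ ψ) z = 0 := by
  obtain ⟨f, hf⟩ := h.exists_adapted hz
  have hF := (h.smooth_normSqL hz (hσ.smooth z hz)).differentiableAt (by simp)
  have hψ := (h.smooth_psi z hz).differentiableAt (by simp)
  have hp (i j k : Fin 6) : ψ z ![f i, f j, f k] = psC i j k := hf.psi i j k
  set F := fun y ↦ normSqL ω σ ψ y / 4 with hFd
  have hF4 : HasFDerivAt F ((1 / 4 : ℝ) • fderiv ℝ (normSqL ω σ ψ) z) z := by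
    have := hF.hasFDerivAt.const_mul (1 / 4 : ℝ)
    refine this.congr_of_eventuallyEq (.of_forall fun y ↦ ?_)
    simp only [hFd]; ring
  have hs := hF4.smul hψ.hasFDerivAt
  have e : extDeriv σ =ᶠ[𝓝 z] F • ψ := h.eventually hz fun y hy ↦ sub_eq_zero.1 (hn y hy)
  have h0 : extDeriv (F • ψ) z = 0 := by
    rw [← e.extDeriv_eq]
    exact extDeriv_extDeriv_apply ((hσ.smooth z hz).of_le two_le_smooth) (by simp)
  have key (i j k l : Fin 6) : fderiv ℝ (normSqL ω σ ψ) z (f i) * psC j k l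
      - fderiv ℝ (normSqL ω σ ψ) z (f j) * psC i k l + fderiv ℝ (normSqL ω σ ψ) z (f k) * psC i j l
      - fderiv ℝ (normSqL ω σ ψ) z (f l) * psC i j k = 0 := by
    have h1 : extDeriv (F • ψ) z ![f i, f j, f k, f l] = 0 := by rw [h0]; rfl
    have h2 : extDeriv ψ z ![f i, f j, f k, f l] = 0 := by rw [h.closed_psi z hz]; rfl
    rw [extDeriv_three_apply hs.differentiableAt, hs.fderiv] at h1
    rw [extDeriv_three_apply hψ] at h2
    simp only [add_apply, smul_apply, ContinuousLinearMap.smulRight_apply,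
      ContinuousAlternatingMap.add_apply, ContinuousAlternatingMap.smul_apply, smul_eq_mul, hp] at h1
    linear_combination 4 * h1 - 4 * F z * h2
  -- Each quadruple joins one index to a monomial of ψ not containing it, chosen so that no other
  -- term of dF ∧ ψ contributes.
  have k1 := key 1 0 2 4; have k3 := key 3 0 2 4; have k5 := key 5 0 2 4
  have k0 := key 0 1 3 4; have k2 := key 2 1 3 4; have k4 := key 4 0 3 5
  simp only [isAlt3_psC.rules, psC_sorted] at k0 k1 k2 k3 k4 k5
  have : ((fderiv ℝ (normSqL ω σ ψ) z : E₆ →L[ℝ] ℝ) : E₆ →ₗ[ℝ] ℝ) = 0 := f.ext fun i ↦ by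
    fin_cases i
    · change fderiv ℝ (normSqL ω σ ψ) z (f 0) = 0; linarith
    · change fderiv ℝ (normSqL ω σ ψ) z (f 1) = 0; linarith
    · change fderiv ℝ (normSqL ω σ ψ) z (f 2) = 0; linarith
    · change fderiv ℝ (normSqL ω σ ψ) z (f 3) = 0; linarith
    · change fderiv ℝ (normSqL ω σ ψ) z (f 4) = 0; linarith
    · change fderiv ℝ (normSqL ω σ ψ) z (f 5) = 0; linarith
  ext v
  exact congrArg (fun L ↦ L v) this

end IsLocalSHF

end LocalConclusion

/-! ### Naturality under linear isomorphisms -/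

section Naturality

variable {V W : Type*} [AddCommGroup V] [Module ℝ V] [AddCommGroup W] [Module ℝ W]

theorem wedge_compLinearMap {p q : ℕ} (α : W [⋀^Fin p]→ₗ[ℝ] ℝ) (β : W [⋀^Fin q]→ₗ[ℝ] ℝ)
    (L : V →ₗ[ℝ] W) :
    wedge (α.compLinearMap L) (β.compLinearMap L) = (wedge α β).compLinearMap L := by
  ext v
  have h1 := factorial_mul_wedge (α.compLinearMap L) (β.compLinearMap L) v
  have h2 := factorial_mul_wedge α β (L ∘ v)
  have h3 : permSum (Fin.castAdd q) (Fin.natAdd p) (α.compLinearMap L) (β.compLinearMap L) v =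
    permSum (Fin.castAdd q) (Fin.natAdd p) α β (L ∘ v) := rfl
  have hpq : (p.factorial * q.factorial : ℝ) ≠ 0 := by positivity
  rw [h3, ← h2] at h1
  exact mul_left_cancel₀ hpq h1

variable (b : Module.Basis (Fin 6) ℝ V) (b' : Module.Basis (Fin 6) ℝ W) (L : V ≃ₗ[ℝ] W)

theorem cube_compLinearMap (ω : W [⋀^Fin 2]→ₗ[ℝ] ℝ) (L : V →ₗ[ℝ] W) :
    cube (ω.compLinearMap L) = (cube ω).compLinearMap L := by
  rw [cube, cube, wedge_compLinearMap]
  exact wedge_compLinearMap (wedge ω ω) ω L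

set_option maxRecDepth 8000 in
theorem volForm_compLinearMap (ω : W [⋀^Fin 2]→ₗ[ℝ] ℝ) (L : V →ₗ[ℝ] W) :
    volForm (ω.compLinearMap L) = (volForm ω).compLinearMap L := by
  rw [volForm, volForm, cube_compLinearMap]
  rfl

theorem compLinearMap_equiv_eq_zero {k : ℕ} {α : W [⋀^Fin k]→ₗ[ℝ] ℝ} :
    α.compLinearMap (L : V →ₗ[ℝ] W) = 0 ↔ α = 0 := by
  refine ⟨fun h ↦ ?_, fun h ↦ by rw [h]; rfl⟩
  ext v
  have := congrArg (fun F ↦ F (L.symm ∘ v)) h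
  simp only [AlternatingMap.compLinearMap_apply] at this
  refine Eq.trans (congrArg α ?_) this
  ext1 i
  simp

theorem compLinearMap_equiv_inj {k : ℕ} {α β : W [⋀^Fin k]→ₗ[ℝ] ℝ} :
    α.compLinearMap (L : V →ₗ[ℝ] W) = β.compLinearMap (L : V →ₗ[ℝ] W) ↔ α = β := by
  rw [← sub_eq_zero, ← sub_eq_zero (a := α), ← compLinearMap_equiv_eq_zero L]
  rfl

/-- The components of S do not depend on the reference basis. In the basis obtained by pulling back
`b'`, the two endomorphisms have equal components. -/
theorem endo_comp {vol : W [⋀^Fin 6]→ₗ[ℝ] ℝ} (hvol : vol ≠ 0) (ρ : W [⋀^Fin 3]→ₗ[ℝ] ℝ) (v : V) :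
    L (endo b (vol.compLinearMap (L : V →ₗ[ℝ] W)) (ρ.compLinearMap (L : V →ₗ[ℝ] W)) v) =
      endo b' vol ρ (L v) := by
  set c := b'.map L.symm with hc
  have hLc (i : Fin 6) : L (c i) = b' i := by simp [hc]
  have hvol' : vol.compLinearMap (L : V →ₗ[ℝ] W) ≠ 0 := fun h ↦
    hvol ((compLinearMap_equiv_eq_zero L).1 h)
  have e1 : vol.compLinearMap (L : V →ₗ[ℝ] W) c = vol b' :=
    congrArg vol (funext hLc)
  suffices (L : V →ₗ[ℝ] W) ∘ₗ endo b (vol.compLinearMap (L : V →ₗ[ℝ] W))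
      (ρ.compLinearMap (L : V →ₗ[ℝ] W)) = endo b' vol ρ ∘ₗ (L : V →ₗ[ℝ] W) from
    congrArg (fun F ↦ F v) this
  refine c.ext fun i ↦ ?_
  simp only [LinearMap.comp_apply, LinearEquiv.coe_coe]
  rw [hLc, endo_apply_basis b hvol' _ c, endo_apply_basis b' hvol ρ b', e1]
  simp only [map_sum, map_smul, compLinearMap_three, LinearEquiv.coe_coe, hLc]

theorem quartic_comp {vol : W [⋀^Fin 6]→ₗ[ℝ] ℝ} (hvol : vol ≠ 0) (ρ : W [⋀^Fin 3]→ₗ[ℝ] ℝ) :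
    quartic b (vol.compLinearMap (L : V →ₗ[ℝ] W)) (ρ.compLinearMap (L : V →ₗ[ℝ] W)) =
      quartic b' vol ρ := by
  have hvol' : vol.compLinearMap (L : V →ₗ[ℝ] W) ≠ 0 := fun h ↦
    hvol ((compLinearMap_equiv_eq_zero L).1 h)
  have h1 := congrArg L (endo_endo b hvol' (ρ.compLinearMap (L : V →ₗ[ℝ] W)) (b 0))
  rw [endo_comp b b' L hvol, endo_comp b b' L hvol, endo_endo b' hvol, map_smul] at h1
  have h0 : L (b 0) ≠ 0 := fun h ↦ b.ne_zero 0 (L.map_eq_zero_iff.1 h)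
  exact (smul_left_injective ℝ h0 h1).symm

namespace IsSU3

variable {b' L} {ω κ : W [⋀^Fin 2]→ₗ[ℝ] ℝ} {ψ φ : W [⋀^Fin 3]→ₗ[ℝ] ℝ}

theorem cplx_comp (h : IsSU3 b' ω ψ) (v : V) :
    L (cplx b (ω.compLinearMap (L : V →ₗ[ℝ] W)) (ψ.compLinearMap (L : V →ₗ[ℝ] W)) v) =
      cplx b' ω ψ (L v) := by
  simp only [cplx, LinearMap.smul_apply, map_smul, volForm_compLinearMap]
  rw [quartic_comp b b' L h.volForm_ne_zero, endo_comp b b' L h.volForm_ne_zero]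

theorem metric_comp (h : IsSU3 b' ω ψ) (v w : V) :
    metric b (ω.compLinearMap (L : V →ₗ[ℝ] W)) (ψ.compLinearMap (L : V →ₗ[ℝ] W)) v w =
      metric b' ω ψ (L v) (L w) := by
  rw [metric, metric, compLinearMap_two, LinearEquiv.coe_coe, h.cplx_comp]

theorem compLinearMap_cplx (h : IsSU3 b' ω ψ) {k : ℕ} (α : W [⋀^Fin k]→ₗ[ℝ] ℝ) :
    (α.compLinearMap (L : V →ₗ[ℝ] W)).compLinearMap
        (cplx b (ω.compLinearMap (L : V →ₗ[ℝ] W)) (ψ.compLinearMap (L : V →ₗ[ℝ] W))) =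
      (α.compLinearMap (cplx b' ω ψ)).compLinearMap (L : V →ₗ[ℝ] W) := by
  ext v
  exact congrArg α (funext fun i ↦ h.cplx_comp b (v i))

theorem hat_comp (h : IsSU3 b' ω ψ) :
    hat b (ω.compLinearMap (L : V →ₗ[ℝ] W)) (ψ.compLinearMap (L : V →ₗ[ℝ] W)) =
      (hat b' ω ψ).compLinearMap (L : V →ₗ[ℝ] W) := h.compLinearMap_cplx b ψ

set_option maxRecDepth 8000 in
theorem comp (h : IsSU3 b' ω ψ) : IsSU3 b (ω.compLinearMap (L : V →ₗ[ℝ] W)) (ψ.compLinearMap (L : V →ₗ[ℝ] W)) where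
  nondegenerate v hv := by
    refine L.map_eq_zero_iff.1 (h.nondegenerate _ fun w ↦ ?_)
    have := hv (L.symm w)
    rwa [compLinearMap_two, LinearEquiv.coe_coe, L.apply_symm_apply] at this
  stable := by
    rw [volForm_compLinearMap, quartic_comp b b' L h.volForm_ne_zero]
    exact h.stable
  compatible := by
    rw [wedge_compLinearMap, h.compatible]; rfl
  normalized := by
    rw [h.hat_comp, wedge_compLinearMap, h.normalized, cube_compLinearMap]; rfl
  posDef v hv := by
    rw [h.metric_comp]
    exact h.posDef _ fun h0 ↦ hv (L.map_eq_zero_iff.1 h0)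

theorem isPrimitive11_comp (h : IsSU3 b' ω ψ) :
    IsPrimitive11 b (ω.compLinearMap (L : V →ₗ[ℝ] W)) (ψ.compLinearMap (L : V →ₗ[ℝ] W))
      (κ.compLinearMap (L : V →ₗ[ℝ] W)) ↔ IsPrimitive11 b' ω ψ κ := by
  rw [IsPrimitive11, IsPrimitive11, h.compLinearMap_cplx, compLinearMap_equiv_inj,
    wedge_compLinearMap]
  exact and_congr ((iff_of_eq (congrArg (· = 0) (wedge_compLinearMap κ (wedge ω ω) _))).trans
    (compLinearMap_equiv_eq_zero L)) Iff.rfl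

theorem isPrimitive21_comp (h : IsSU3 b' ω ψ) :
    IsPrimitive21 b (ω.compLinearMap (L : V →ₗ[ℝ] W)) (ψ.compLinearMap (L : V →ₗ[ℝ] W))
      (φ.compLinearMap (L : V →ₗ[ℝ] W)) ↔ IsPrimitive21 b' ω ψ φ := by
  rw [IsPrimitive21, IsPrimitive21, h.hat_comp, wedge_compLinearMap, wedge_compLinearMap,
    wedge_compLinearMap]
  exact and_congr (compLinearMap_equiv_eq_zero L) (and_congr (compLinearMap_equiv_eq_zero L)
    (compLinearMap_equiv_eq_zero L))

/-- The pullback of an adapted basis is adapted, and in adapted bases both norms are the same sum of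
squares. -/
theorem normSq_comp (h : IsSU3 b' ω ψ) :
    normSq b (ω.compLinearMap (L : V →ₗ[ℝ] W)) (ψ.compLinearMap (L : V →ₗ[ℝ] W))
      (κ.compLinearMap (L : V →ₗ[ℝ] W)) = normSq b' ω ψ κ := by
  obtain ⟨f, hf⟩ := h.exists_adapted
  have hL (i : Fin 6) : L (f.map L.symm i) = f i := by simp
  have hf' : IsAdapted (f.map L.symm) (ω.compLinearMap (L : V →ₗ[ℝ] W))
      (ψ.compLinearMap (L : V →ₗ[ℝ] W)) (cplx b (ω.compLinearMap (L : V →ₗ[ℝ] W))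
      (ψ.compLinearMap (L : V →ₗ[ℝ] W))) := by
    refine ⟨fun i ↦ L.injective ?_, fun i j ↦ ?_, fun i j k ↦ ?_⟩
    · rw [h.cplx_comp, map_smul, hL, hL, hf.cplx]
    · rw [compLinearMap_two, LinearEquiv.coe_coe, hL, hL, hf.omega]
    · rw [compLinearMap_three, LinearEquiv.coe_coe, hL, hL, hL, hf.psi]
  rw [hf.normSq, hf'.normSq]
  simp only [compLinearMap_two, LinearEquiv.coe_coe, hL]

end IsSU3

end Naturality

/-! ### Differential forms in charts -/

section Charts

local notation "E₆" => EuclideanSpace ℝ (Fin 6)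

variable {M : Type*} [TopologicalSpace M] [ChartedSpace (EuclideanSpace ℝ (Fin 6)) M]
  {k : ℕ} {x₀ x₁ p : M} {y : EuclideanSpace ℝ (Fin 6)}

theorem DForm.apply_congr (α : DForm M k) {p q : M} (h : p = q) {v w : Fin k → E₆} (hv : v = w) :
    (α p) v = (α q) w := by
  subst h; subst hv; rfl

theorem DForm.IsSmooth.contDiffAt {α : DForm M k} (hα : α.IsSmooth)
    (hy : y ∈ (extChartAt (𝓡 6) x₀).target) :
    ContDiffAt ℝ ((⊤ : ℕ∞) : WithTop ℕ∞) (α.inChart x₀) y :=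
  (hα x₀).contDiffAt ((isOpen_extChartAt_target (I := 𝓡 6) x₀).mem_nhds hy)

variable [IsManifold (𝓡 6) ((⊤ : ℕ∞) : WithTop ℕ∞) M]

theorem mfderiv_symm_mfderiv (hp : p ∈ (extChartAt (𝓡 6) x₀).source) (v : TangentSpace (𝓡 6) p) :
    (mfderiv (𝓡 6) (𝓡 6) (extChartAt (𝓡 6) x₀).symm (extChartAt (𝓡 6) x₀ p)
      (mfderiv (𝓡 6) (𝓡 6) (extChartAt (𝓡 6) x₀) p v) : E₆) = v := by
  have h := mfderivWithin_extChartAt_symm_comp_mfderiv_extChartAt' (I := 𝓡 6) hp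
  rw [ModelWithCorners.range_eq_univ, mfderivWithin_univ] at h
  exact congrArg (fun F ↦ F v) h

theorem mfderiv_mfderiv_symm (hy : y ∈ (extChartAt (𝓡 6) x₀).target) (v : E₆) :
    (mfderiv (𝓡 6) (𝓡 6) (extChartAt (𝓡 6) x₀) ((extChartAt (𝓡 6) x₀).symm y)
      (mfderiv (𝓡 6) (𝓡 6) (extChartAt (𝓡 6) x₀).symm y v) : E₆) = v := by
  have h := mfderiv_extChartAt_comp_mfderivWithin_extChartAt_symm (I := 𝓡 6) hy
  rw [ModelWithCorners.range_eq_univ, mfderivWithin_univ] at h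
  exact congrArg (fun F ↦ F v) h

theorem mfderiv_symm_mfderiv_symm (hy : y ∈ (extChartAt (𝓡 6) x₀).target)
    (v : TangentSpace (𝓡 6) ((extChartAt (𝓡 6) x₀).symm y)) :
    (mfderiv (𝓡 6) (𝓡 6) (extChartAt (𝓡 6) x₀).symm y
      (mfderiv (𝓡 6) (𝓡 6) (extChartAt (𝓡 6) x₀) ((extChartAt (𝓡 6) x₀).symm y) v) : E₆) = v := by
  have h := mfderivWithin_extChartAt_symm_comp_mfderiv_extChartAt (I := 𝓡 6) hy
  rw [ModelWithCorners.range_eq_univ, mfderivWithin_univ] at h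
  exact congrArg (fun F ↦ F v) h

/-- The derivative of the inverse of a chart. -/
def chartEquiv (x₀ : M) (hy : y ∈ (extChartAt (𝓡 6) x₀).target) :
    E₆ ≃ₗ[ℝ] TangentSpace (𝓡 6) ((extChartAt (𝓡 6) x₀).symm y) :=
  LinearEquiv.ofLinearMap
    (mfderiv (𝓡 6) (𝓡 6) (extChartAt (𝓡 6) x₀).symm y).toLinearMap
    (mfderiv (𝓡 6) (𝓡 6) (extChartAt (𝓡 6) x₀) ((extChartAt (𝓡 6) x₀).symm y)).toLinearMap
    (LinearMap.ext fun v ↦ mfderiv_symm_mfderiv_symm hy v)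
    (LinearMap.ext fun v ↦ mfderiv_mfderiv_symm hy v)

theorem DForm.toAlt_inChart (α : DForm M k) (hy : y ∈ (extChartAt (𝓡 6) x₀).target) :
    (α.inChart x₀ y).toAlternatingMap =
      (α.toAlt ((extChartAt (𝓡 6) x₀).symm y)).compLinearMap
        (chartEquiv x₀ hy : E₆ →ₗ[ℝ] TangentSpace (𝓡 6) ((extChartAt (𝓡 6) x₀).symm y)) := rfl

/-- The tangent space at a point, identified with the model space. -/
def tangentEquiv (x : M) : E₆ ≃ₗ[ℝ] TangentSpace (𝓡 6) x := LinearEquiv.refl ℝ E₆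

/-- The tangent space at x is the model space by way of the preferred chart at x, so that chart has
the identity as its derivative at x. -/
theorem mfderiv_symm_self (x : M) (v : E₆) :
    (mfderiv (𝓡 6) (𝓡 6) (extChartAt (𝓡 6) x).symm (extChartAt (𝓡 6) x x) v : E₆) = v := by
  have h := mfderivWithin_range_extChartAt_symm (I := 𝓡 6) (x := x)
  rw [ModelWithCorners.range_eq_univ, mfderivWithin_univ] at h
  exact congrArg (fun F ↦ F v) h

theorem DForm.toAlt_inChart_self (α : DForm M k) (x : M) :
    (α.inChart x (extChartAt (𝓡 6) x x)).toAlternatingMap =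
      (α.toAlt x).compLinearMap (tangentEquiv x : E₆ →ₗ[ℝ] TangentSpace (𝓡 6) x) := by
  ext v
  exact α.apply_congr (extChartAt_to_inv x) (funext fun i ↦ mfderiv_symm_self x (v i))

theorem contDiffAt_transition (hy : y ∈ (extChartAt (𝓡 6) x₀).target)
    (h1 : (extChartAt (𝓡 6) x₀).symm y ∈ (extChartAt (𝓡 6) x₁).source) :
    ContDiffAt ℝ ((⊤ : ℕ∞) : WithTop ℕ∞) (extChartAt (𝓡 6) x₁ ∘ (extChartAt (𝓡 6) x₀).symm) y := by
  rw [← contMDiffAt_iff_contDiffAt]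
  refine ContMDiffAt.comp (I' := 𝓡 6) y (contMDiffAt_extChartAt' ?_) ?_
  · rwa [extChartAt_source] at h1
  · exact (contMDiffOn_extChartAt_symm x₀).contMDiffAt
      ((isOpen_extChartAt_target (I := 𝓡 6) x₀).mem_nhds hy)

theorem fderiv_transition (hy : y ∈ (extChartAt (𝓡 6) x₀).target)
    (h1 : (extChartAt (𝓡 6) x₀).symm y ∈ (extChartAt (𝓡 6) x₁).source) (v : E₆) :
    fderiv ℝ (extChartAt (𝓡 6) x₁ ∘ (extChartAt (𝓡 6) x₀).symm) y v =
      mfderiv (𝓡 6) (𝓡 6) (extChartAt (𝓡 6) x₁) ((extChartAt (𝓡 6) x₀).symm y)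
        (mfderiv (𝓡 6) (𝓡 6) (extChartAt (𝓡 6) x₀).symm y v) := by
  have h := mfderiv_comp (I := 𝓡 6) (I' := 𝓡 6) (I'' := 𝓡 6) y
    (f := (extChartAt (𝓡 6) x₀).symm) (g := extChartAt (𝓡 6) x₁)
    (mdifferentiableAt_extChartAt (by rwa [extChartAt_source] at h1))
    (mdifferentiableOn_extChartAt_symm.mdifferentiableAt
      ((isOpen_extChartAt_target (I := 𝓡 6) x₀).mem_nhds hy))
  rw [mfderiv_eq_fderiv] at h
  exact congrArg (fun F ↦ F v) h

theorem DForm.inChart_eq_pullback (α : DForm M k) (hy : y ∈ (extChartAt (𝓡 6) x₀).target)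
    (h1 : (extChartAt (𝓡 6) x₀).symm y ∈ (extChartAt (𝓡 6) x₁).source) :
    α.inChart x₀ y =
      (α.inChart x₁ ((extChartAt (𝓡 6) x₁ ∘ (extChartAt (𝓡 6) x₀).symm) y)).compContinuousLinearMap
        (fderiv ℝ (extChartAt (𝓡 6) x₁ ∘ (extChartAt (𝓡 6) x₀).symm) y) := by
  ext v
  refine α.apply_congr ((extChartAt (𝓡 6) x₁).left_inv h1).symm (funext fun i ↦ ?_)
  refine Eq.trans ?_ (congrArg (fun w : E₆ ↦ (mfderiv (𝓡 6) (𝓡 6) (extChartAt (𝓡 6) x₁).symm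
    (extChartAt (𝓡 6) x₁ ((extChartAt (𝓡 6) x₀).symm y)) w : E₆)) (fderiv_transition hy h1 (v i)).symm)
  exact (mfderiv_symm_mfderiv h1 _).symm

/-- The exterior derivative can be computed in any chart. -/
theorem DForm.IsSmooth.inChart_d {α : DForm M k} (hα : α.IsSmooth)
    (hy : y ∈ (extChartAt (𝓡 6) x₀).target) :
    α.d.inChart x₀ y = extDeriv (α.inChart x₀) y := by
  set p := (extChartAt (𝓡 6) x₀).symm y with hp
  have h1 : p ∈ (extChartAt (𝓡 6) p).source := mem_extChartAt_source p
  have hc : ContinuousAt (extChartAt (𝓡 6) x₀).symm y :=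
    (continuousOn_extChartAt_symm x₀).continuousAt
      ((isOpen_extChartAt_target (I := 𝓡 6) x₀).mem_nhds hy)
  -- At p the derivative is defined in the preferred chart of p. Near y the two local expressions
  -- differ by pullback along the transition map, with which d commutes.
  have he : α.inChart x₀ =ᶠ[𝓝 y] fun z ↦
      (α.inChart p ((extChartAt (𝓡 6) p ∘ (extChartAt (𝓡 6) x₀).symm) z)).compContinuousLinearMap
        (fderiv ℝ (extChartAt (𝓡 6) p ∘ (extChartAt (𝓡 6) x₀).symm) z) := by
    filter_upwards [(isOpen_extChartAt_target (I := 𝓡 6) x₀).mem_nhds hy,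
      hc.eventually ((isOpen_extChartAt_source (I := 𝓡 6) p).mem_nhds h1)] with z hz hz1
    exact α.inChart_eq_pullback hz hz1
  have hd : DifferentiableAt ℝ (α.inChart p)
      ((extChartAt (𝓡 6) p ∘ (extChartAt (𝓡 6) x₀).symm) y) :=
    (hα.contDiffAt (mem_extChartAt_target p)).differentiableAt (by simp)
  rw [he.extDeriv_eq, extDeriv_pullback hd (contDiffAt_transition hy h1)
    (by rw [minSmoothness_of_isRCLikeNormedField]; exact two_le_smooth)]
  ext v
  refine congrArg (extDeriv (α.inChart p) (extChartAt (𝓡 6) p p)) (funext fun i ↦ ?_)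
  exact (fderiv_transition hy h1 (v i)).symm

variable {ω : DForm M 2} {ψ : DForm M 3}

theorem IsSU3Structure.isSU3_inChart (h : IsSU3Structure ω ψ)
    (hy : y ∈ (extChartAt (𝓡 6) x₀).target) :
    IsSU3 stdBasis (ω.inChart x₀ y).toAlternatingMap (ψ.inChart x₀ y).toAlternatingMap := by
  rw [ω.toAlt_inChart hy, ψ.toAlt_inChart hy]
  exact (h.isSU3 _).comp stdBasis (L := chartEquiv x₀ hy)

theorem IsSU3Structure.psiHat_inChart (h : IsSU3Structure ω ψ)
    (hy : y ∈ (extChartAt (𝓡 6) x₀).target) :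
    (psiHat ω ψ).inChart x₀ y = hatL (ω.inChart x₀ y) (ψ.inChart x₀ y) := by
  have e (v : E₆) := (h.isSU3 _).cplx_comp stdBasis (L := chartEquiv x₀ hy) v
  simp only [← ω.toAlt_inChart hy, ← ψ.toAlt_inChart hy] at e
  ext v
  exact congrArg (ψ ((extChartAt (𝓡 6) x₀).symm y)) (funext fun i ↦ (e (v i)).symm)

theorem IsSU3Structure.gramInChart_eq (h : IsSU3Structure ω ψ)
    (hy : y ∈ (extChartAt (𝓡 6) x₀).target) :
    gramInChart (inducedMetric ω ψ) x₀ y =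
      entries (fun z ↦ metricL (ω.inChart x₀ z) (ψ.inChart x₀ z)) y := by
  have e (v w : E₆) := (h.isSU3 _).metric_comp stdBasis (L := chartEquiv x₀ hy) v w
  simp only [← ω.toAlt_inChart hy, ← ψ.toAlt_inChart hy] at e
  ext i j
  exact (e (EuclideanSpace.single i 1) (EuclideanSpace.single j 1)).symm

theorem IsSU3Structure.psiHat_smooth (h : IsSU3Structure ω ψ) : (psiHat ω ψ).IsSmooth := by
  intro x₀ y hy
  refine ContDiffAt.contDiffWithinAt ?_
  have ho := isOpen_extChartAt_target (I := 𝓡 6) x₀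
  have h2 := contDiffAt_hatL (h.smooth_omega.contDiffAt hy) (h.smooth_psi.contDiffAt hy)
    (Filter.mem_of_superset (ho.mem_nhds hy) fun z hz ↦ h.isSU3_inChart hz)
  exact h2.congr_of_eventuallyEq
    (Filter.mem_of_superset (ho.mem_nhds hy) fun z hz ↦ h.psiHat_inChart hz)

theorem IsSHF.isLocalSHF (h : IsSHF ω ψ) (x₀ : M) :
    IsLocalSHF (extChartAt (𝓡 6) x₀).target (ω.inChart x₀) (ψ.inChart x₀) where
  isOpen := isOpen_extChartAt_target x₀
  smooth_omega _ hy := h.smooth_omega.contDiffAt hy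
  smooth_psi _ hy := h.smooth_psi.contDiffAt hy
  isSU3 _ hy := h.isSU3_inChart hy
  closed_omega y hy := by
    rw [← h.smooth_omega.inChart_d hy, h.closed_omega]
    rfl
  closed_psi y hy := by
    rw [← h.smooth_psi.inChart_d hy, h.closed_psi]
    rfl

end Charts

/-! ### The Ricci tensor depends only on the germ of the metric -/

section Coordinates

local notation "E₆" => EuclideanSpace ℝ (Fin 6)

theorem christoffel_congr {G G' : E₆ → Matrix (Fin 6) (Fin 6) ℝ} {y : E₆} (h : G =ᶠ[𝓝 y] G')
    (k i j : Fin 6) : christoffel G k i j =ᶠ[𝓝 y] christoffel G' k i j := by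
  filter_upwards [h.eventuallyEq_nhds] with z hz
  have e (a b c : Fin 6) : partialDeriv a (fun z ↦ G z b c) z = partialDeriv a (fun z ↦ G' z b c) z := by
    rw [partialDeriv, partialDeriv, Filter.EventuallyEq.fderiv_eq (hz.mono fun w hw ↦ by rw [hw])]
  simp only [christoffel, e, hz.eq_of_nhds]

theorem ricciCoord_congr {G G' : E₆ → Matrix (Fin 6) (Fin 6) ℝ} {y : E₆} (h : G =ᶠ[𝓝 y] G')
    (i j : Fin 6) : ricciCoord G i j y = ricciCoord G' i j y := by
  have e (a k i j : Fin 6) : partialDeriv a (christoffel G k i j) y =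
      partialDeriv a (christoffel G' k i j) y := by
    rw [partialDeriv, partialDeriv, (christoffel_congr h k i j).fderiv_eq]
  have e' (k i j : Fin 6) := (christoffel_congr h k i j).eq_of_nhds
  simp only [ricciCoord, e, e']

end Coordinates

/-! ### From charts to the manifold -/

section Global

local notation "E₆" => EuclideanSpace ℝ (Fin 6)

variable {M : Type*} [TopologicalSpace M] [ChartedSpace (EuclideanSpace ℝ (Fin 6)) M]
  {x₀ x : M} {y : EuclideanSpace ℝ (Fin 6)}
  {ω σ : DForm M 2} {ψ : DForm M 3}

/-- The intrinsic torsion form. -/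
def torsionForm (ω : DForm M 2) (ψ : DForm M 3) : DForm M 2 := fun x ↦
  (show E₆ [⋀^Fin 2]→L[ℝ] ℝ from torsionL (ω.inChart x) (ψ.inChart x) (extChartAt (𝓡 6) x x))

theorem toAlt_torsionForm (ω : DForm M 2) (ψ : DForm M 3) (x : M) :
    ((torsionForm ω ψ).toAlt x).compLinearMap (tangentEquiv x : E₆ →ₗ[ℝ] TangentSpace (𝓡 6) x) =
      (torsionL (ω.inChart x) (ψ.inChart x) (extChartAt (𝓡 6) x x)).toAlternatingMap := rfl

variable [IsManifold (𝓡 6) ((⊤ : ℕ∞) : WithTop ℕ∞) M]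

namespace IsSHF

theorem extDeriv_hatL (h : IsSHF ω ψ) (hy : y ∈ (extChartAt (𝓡 6) x₀).target) :
    extDeriv (fun z ↦ hatL (ω.inChart x₀ z) (ψ.inChart x₀ z)) y =
      (psiHat ω ψ).d.inChart x₀ y := by
  rw [h.psiHat_smooth.inChart_d hy]
  exact Filter.EventuallyEq.extDeriv_eq (Filter.mem_of_superset
    ((isOpen_extChartAt_target (I := 𝓡 6) x₀).mem_nhds hy) fun z hz ↦ (h.psiHat_inChart hz).symm)

theorem isTorsionAt_inChart (h : IsSHF ω ψ)
    (hp : ∀ x, IsPrimitive11 (tangentBasis x) (ω.toAlt x) (ψ.toAlt x) (σ.toAlt x))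
    (hd : ∀ x, (psiHat ω ψ).d.toAlt x = wedge (σ.toAlt x) (ω.toAlt x))
    (hy : y ∈ (extChartAt (𝓡 6) x₀).target) :
    IsTorsionAt (ω.inChart x₀) (ψ.inChart x₀) y (σ.inChart x₀ y) where
  primitive := by
    rw [ω.toAlt_inChart hy, ψ.toAlt_inChart hy, σ.toAlt_inChart hy]
    exact ((h.isSU3 _).isPrimitive11_comp stdBasis).2 (hp _)
  d_hat := by
    rw [h.extDeriv_hatL hy, DForm.toAlt_inChart _ hy, hd, ω.toAlt_inChart hy, σ.toAlt_inChart hy,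
      wedge_compLinearMap]

theorem isPrimitive11_torsionForm (h : IsSHF ω ψ) (x : M) :
    IsPrimitive11 (tangentBasis x) (ω.toAlt x) (ψ.toAlt x) ((torsionForm ω ψ).toAlt x) := by
  have ht := (h.isLocalSHF x).isTorsionAt_torsionL (mem_extChartAt_target x)
  rw [← (h.isSU3 x).isPrimitive11_comp stdBasis (L := tangentEquiv x), toAlt_torsionForm,
    ← ω.toAlt_inChart_self, ← ψ.toAlt_inChart_self]
  exact ht.primitive

theorem d_psiHat_torsionForm (h : IsSHF ω ψ) (x : M) :
    (psiHat ω ψ).d.toAlt x = wedge ((torsionForm ω ψ).toAlt x) (ω.toAlt x) := by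
  have ht := (h.isLocalSHF x).isTorsionAt_torsionL (mem_extChartAt_target x)
  have hd := ht.d_hat
  rw [h.extDeriv_hatL (mem_extChartAt_target x), DForm.toAlt_inChart_self, ← toAlt_torsionForm,
    ω.toAlt_inChart_self, wedge_compLinearMap] at hd
  exact (compLinearMap_equiv_inj (tangentEquiv x)).1 hd

/-- At each point the torsion form is built in that point's own chart, which does not show
smoothness. Pointwise uniqueness in the fixed chart at x₀ identifies it with the smooth local form
there. -/
theorem torsionForm_inChart (h : IsSHF ω ψ) (hy : y ∈ (extChartAt (𝓡 6) x₀).target) :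
    (torsionForm ω ψ).inChart x₀ y = torsionL (ω.inChart x₀) (ψ.inChart x₀) y :=
  (h.isLocalSHF x₀).torsion_unique hy
    (h.isTorsionAt_inChart h.isPrimitive11_torsionForm h.d_psiHat_torsionForm hy)

theorem isTorsionForm_torsionForm (h : IsSHF ω ψ) : IsTorsionForm ω ψ (torsionForm ω ψ) where
  smooth x₀ _ hy := ContDiffAt.contDiffWithinAt <|
    ((h.isLocalSHF x₀).smooth_torsionL hy).congr_of_eventuallyEq (Filter.mem_of_superset
      ((isOpen_extChartAt_target (I := 𝓡 6) x₀).mem_nhds hy) fun _ hz ↦ h.torsionForm_inChart hz)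
  primitive := h.isPrimitive11_torsionForm
  d_psiHat := h.d_psiHat_torsionForm

end IsSHF

theorem DForm.ext_inChart_self {k : ℕ} {α β : DForm M k}
    (h : ∀ x, α.inChart x (extChartAt (𝓡 6) x x) = β.inChart x (extChartAt (𝓡 6) x x)) : α = β := by
  funext x
  refine ContinuousAlternatingMap.toAlternatingMap_injective
    ((compLinearMap_equiv_inj (tangentEquiv x)).1 ?_)
  have := congrArg ContinuousAlternatingMap.toAlternatingMap (h x)
  rwa [α.toAlt_inChart_self, β.toAlt_inChart_self] at this

theorem IsTorsionForm.eq_torsionForm (h : IsSHF ω ψ) (hσ : IsTorsionForm ω ψ σ) :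
    σ = torsionForm ω ψ := DForm.ext_inChart_self fun x ↦ by
  rw [h.torsionForm_inChart (mem_extChartAt_target x)]
  exact (h.isLocalSHF x).torsion_unique (mem_extChartAt_target x)
    (h.isTorsionAt_inChart hσ.primitive hσ.d_psiHat (mem_extChartAt_target x))

theorem IsTorsionForm.isLocalTorsion (hσ : IsTorsionForm ω ψ σ) (h : IsSHF ω ψ) (x₀ : M) :
    IsLocalTorsion (extChartAt (𝓡 6) x₀).target (ω.inChart x₀) (ψ.inChart x₀) (σ.inChart x₀) where
  smooth _ hy := hσ.smooth.contDiffAt hy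
  torsion _ hy := h.isTorsionAt_inChart hσ.primitive hσ.d_psiHat hy

/-- The primitive part of the derivative of the torsion form. -/
def nuForm (ω σ : DForm M 2) (ψ : DForm M 3) : DForm M 3 := fun x ↦
  σ.d x - (formNormSq ω ψ σ x / 4) • ψ x

namespace IsSHF

theorem normSqL_inChart (h : IsSHF ω ψ) (hy : y ∈ (extChartAt (𝓡 6) x₀).target) :
    normSqL (ω.inChart x₀) (σ.inChart x₀) (ψ.inChart x₀) y =
      formNormSq ω ψ σ ((extChartAt (𝓡 6) x₀).symm y) := by
  rw [normSqL, ω.toAlt_inChart hy, ψ.toAlt_inChart hy, σ.toAlt_inChart hy]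
  exact (h.isSU3 _).normSq_comp stdBasis

theorem normSqL_self (h : IsSHF ω ψ) (x : M) :
    normSqL (ω.inChart x) (σ.inChart x) (ψ.inChart x) (extChartAt (𝓡 6) x x) =
      formNormSq ω ψ σ x := by
  rw [h.normSqL_inChart (mem_extChartAt_target x), extChartAt_to_inv]

theorem nuForm_inChart (h : IsSHF ω ψ) (hσ : σ.IsSmooth)
    (hy : y ∈ (extChartAt (𝓡 6) x₀).target) :
    (nuForm ω σ ψ).inChart x₀ y = nuL (ω.inChart x₀) (σ.inChart x₀) (ψ.inChart x₀) y := by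
  rw [nuL, ← hσ.inChart_d hy, h.normSqL_inChart hy]
  rfl

theorem isPrimitive21Form_nuForm (h : IsSHF ω ψ) (hσ : IsTorsionForm ω ψ σ) :
    IsPrimitive21Form ω ψ (nuForm ω σ ψ) where
  smooth x₀ _ hy := ContDiffAt.contDiffWithinAt <|
    ((h.isLocalSHF x₀).smooth_nuL (hσ.isLocalTorsion h x₀) hy).congr_of_eventuallyEq
      (Filter.mem_of_superset ((isOpen_extChartAt_target (I := 𝓡 6) x₀).mem_nhds hy)
        fun _ hz ↦ h.nuForm_inChart hσ.smooth hz)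
  primitive x := by
    have := (h.isLocalSHF x).isPrimitive21_nuL (hσ.isLocalTorsion h x) (mem_extChartAt_target x)
    rw [← h.nuForm_inChart hσ.smooth (mem_extChartAt_target x), DForm.toAlt_inChart_self,
      DForm.toAlt_inChart_self, DForm.toAlt_inChart_self] at this
    exact ((h.isSU3 x).isPrimitive21_comp stdBasis).1 this

theorem ricci_eq (h : IsSHF ω ψ) (x : M) (v w : E₆) :
    ricci (inducedMetric ω ψ) x (tangentEquiv x v) (tangentEquiv x w) =
      ricciL (ω.inChart x) (ψ.inChart x) (extChartAt (𝓡 6) x x) v w := by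
  have hG : gramInChart (inducedMetric ω ψ) x =ᶠ[𝓝 (extChartAt (𝓡 6) x x)]
      entries fun z ↦ metricL (ω.inChart x z) (ψ.inChart x z) :=
    Filter.mem_of_superset ((isOpen_extChartAt_target (I := 𝓡 6) x).mem_nhds
      (mem_extChartAt_target x)) fun _ hz ↦ h.gramInChart_eq hz
  have hD (v : E₆) : (mfderiv (𝓡 6) (𝓡 6) (extChartAt (𝓡 6) x) x (tangentEquiv x v) : E₆) = v :=
    congrArg (fun F ↦ F v) (mfderiv_extChartAt_self (I := 𝓡 6) (x := x))
  refine (congrArg₂ (fun a b : E₆ ↦ ∑ i, ∑ j, ricciCoord (gramInChart (inducedMetric ω ψ) x) i j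
    (extChartAt (𝓡 6) x x) * a i * b j) (hD v) (hD w)).trans ?_
  simp only [ricciCoord_congr hG]
  rfl

theorem isRicciHermitian_iff (h : IsSHF ω ψ) (hσ : IsTorsionForm ω ψ σ) :
    IsRicciHermitian ω ψ ↔ nuForm ω σ ψ = 0 := by
  have key (x : M) := (h.isLocalSHF x).ricciL_hermitian_iff (hσ.isLocalTorsion h x)
    (mem_extChartAt_target x)
  have hJ (x : M) (v : E₆) : tangentEquiv x (cplxL (ω.inChart x (extChartAt (𝓡 6) x x))
      (ψ.inChart x (extChartAt (𝓡 6) x x)) v) = almostCplx ω ψ x (tangentEquiv x v) := by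
    have := (h.isSU3 x).cplx_comp stdBasis (L := tangentEquiv x) v
    rw [← ω.toAlt_inChart_self, ← ψ.toAlt_inChart_self] at this
    exact this
  simp only [← h.ricci_eq, hJ, ← h.nuForm_inChart hσ.smooth (mem_extChartAt_target _)] at key
  constructor
  · intro H
    refine DForm.ext_inChart_self fun x ↦ ?_
    rw [(key x).1 fun v w ↦ H x _ _]
    rfl
  · intro H x v w
    exact (key x).2 (by rw [H]; rfl) ((tangentEquiv x).symm v) ((tangentEquiv x).symm w)

theorem scal_eq (h : IsSHF ω ψ) (hσ : IsTorsionForm ω ψ σ) (x : M) :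
    scal (inducedMetric ω ψ) x = -(1 / 2) * formNormSq ω ψ σ x := by
  rw [← h.normSqL_self x, ← (h.isLocalSHF x).scal_eq (hσ.isLocalTorsion h x)
    (mem_extChartAt_target x)]
  have hm (v w : E₆) : metric stdBasis (ω.inChart x (extChartAt (𝓡 6) x x)).toAlternatingMap
      (ψ.inChart x (extChartAt (𝓡 6) x x)).toAlternatingMap v w =
      inducedMetric ω ψ x (tangentEquiv x v) (tangentEquiv x w) := by
    rw [ω.toAlt_inChart_self, ψ.toAlt_inChart_self]
    exact (h.isSU3 x).metric_comp stdBasis v w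
  have hb (i : Fin 6) : tangentBasis x i = tangentEquiv x (EuclideanSpace.single i 1) :=
    stdBasis_apply i
  have hg : (Matrix.of fun k l ↦ inducedMetric ω ψ x (tangentBasis x k) (tangentBasis x l)) =
      entries (fun z ↦ metricL (ω.inChart x z) (ψ.inChart x z)) (extChartAt (𝓡 6) x x) := by
    ext i j
    rw [Matrix.of_apply, hb, hb, ← hm]
    rfl
  rw [scal, hg]
  exact Finset.sum_congr rfl fun i _ ↦ Finset.sum_congr rfl fun j _ ↦ by rw [hb, hb, h.ricci_eq]

/-- On a coordinate ball, which is convex, |σ|² has zero derivative and is therefore constant. -/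
theorem isLocallyConstant_formNormSq (h : IsSHF ω ψ) (hσ : IsTorsionForm ω ψ σ)
    (hn : nuForm ω σ ψ = 0) : IsLocallyConstant (formNormSq ω ψ σ) := by
  refine (IsLocallyConstant.iff_eventually_eq _).2 fun x ↦ ?_
  have ho := isOpen_extChartAt_target (I := 𝓡 6) x
  obtain ⟨r, hr, hB⟩ := Metric.isOpen_iff.1 ho _ (mem_extChartAt_target x)
  have hc := (continuousAt_extChartAt (I := 𝓡 6) x).eventually (Metric.ball_mem_nhds _ hr)
  filter_upwards [hc, extChartAt_source_mem_nhds (I := 𝓡 6) x] with z hz hzs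
  have hd : ∀ w ∈ Metric.ball (extChartAt (𝓡 6) x x) r,
      fderivWithin ℝ (normSqL (ω.inChart x) (σ.inChart x) (ψ.inChart x))
        (Metric.ball (extChartAt (𝓡 6) x x) r) w = 0 := fun w hw ↦ by
    rw [fderivWithin_of_isOpen Metric.isOpen_ball hw]
    refine (h.isLocalSHF x).fderiv_normSqL (hσ.isLocalTorsion h x) (fun y hy ↦ ?_) (hB hw)
    rw [← h.nuForm_inChart hσ.smooth hy, hn]
    rfl
  have := (convex_ball (extChartAt (𝓡 6) x x) r).is_const_of_fderivWithin_eq_zero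
    (fun w hw ↦ (((h.isLocalSHF x).smooth_normSqL (hB hw)
      (hσ.smooth.contDiffAt (hB hw))).differentiableAt (by simp)).differentiableWithinAt)
    hd hz (Metric.mem_ball_self hr)
  rwa [h.normSqL_self, h.normSqL_inChart (hB hz), (extChartAt (𝓡 6) x).left_inv hzs] at this

end IsSHF

end Global

end SHF

end

theorem proposition3p1 {M : Type*} [TopologicalSpace M] [ConnectedSpace M]
    [ChartedSpace (EuclideanSpace ℝ (Fin 6)) M]
    [IsManifold (𝓡 6) ((⊤ : ℕ∞) : WithTop ℕ∞) M]
    (ω : SHF.DForm M 2) (ψ : SHF.DForm M 3) (h : SHF.IsSHF ω ψ) :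
    (∃! σ : SHF.DForm M 2, SHF.IsTorsionForm ω ψ σ) ∧
    (∀ σ : SHF.DForm M 2, SHF.IsTorsionForm ω ψ σ →
      (SHF.IsRicciHermitian ω ψ ↔
        ∀ x, SHF.DForm.d σ x = (SHF.formNormSq ω ψ σ x / 4) • ψ x) ∧
      (∃ ν : SHF.DForm M 3, SHF.IsPrimitive21Form ω ψ ν ∧
        (∀ x, SHF.DForm.d σ x = (SHF.formNormSq ω ψ σ x / 4) • ψ x + ν x) ∧
        (SHF.IsRicciHermitian ω ψ ↔ ν = 0))) ∧
    (SHF.IsRicciHermitian ω ψ → ∃ c : ℝ, ∀ x, SHF.scal (SHF.inducedMetric ω ψ) x = c) := by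
  refine ⟨⟨SHF.torsionForm ω ψ, h.isTorsionForm_torsionForm, fun σ hσ ↦ hσ.eq_torsionForm h⟩,
    fun σ hσ ↦ ⟨(h.isRicciHermitian_iff hσ).trans ⟨fun H x ↦ ?_, fun H ↦ ?_⟩,
      SHF.nuForm ω σ ψ, h.isPrimitive21Form_nuForm hσ, fun x ↦ ?_, h.isRicciHermitian_iff hσ⟩,
    fun H ↦ ?_⟩
  · exact sub_eq_zero.1 (congrFun H x)
  · exact funext fun x ↦ sub_eq_zero.2 (H x)
  · exact (add_sub_cancel _ _).symm
  -- The claim does not mention σ; the torsion form just constructed supplies it, and scal = -|σ|²/2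
  -- is constant by connectedness.
  · have hσ := h.isTorsionForm_torsionForm
    have hc := h.isLocallyConstant_formNormSq hσ ((h.isRicciHermitian_iff hσ).1 H)
    obtain ⟨x₀⟩ := (inferInstance : Nonempty M)
    exact ⟨_, fun x ↦ (h.scal_eq hσ x).trans
      (congrArg (-(1 / 2) * ·) (hc.apply_eq_of_preconnectedSpace x x₀))⟩
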